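/- Let $L\ge 0$ be an integer and let $z\in\mathbb{C}$ with $z\neq 0$, $|z|\neq 1$; $\bar z$ is the complex conjugate of $z$. \emph{The ladder function.} For $\beta\in\mathbb{C}$ with $0<\mathrm{Re}\,\beta<1$ and four distinct points $x_1,\dots,x_4\in\mathbb{R}^2\simeq\mathbb{C}$ let $$I^{(L)}(x_1,x_2,x_3,x_4;\beta)=\int_{(\mathbb{R}^2)^L}\prod_{i=1}^{L}\frac{d^2q_i}{|x_2-q_i|^{2\beta}\,|x_4-q_i|^{2\beta}}\;\prod_{m=0}^{L}\frac{1}{|q_m-q_{m+1}|^{2(1-\beta)}},\qquad q_0:=x_1,\quad q_{L+1}:=x_3,$$ and $f_L=|x_2-x_4|^{2L\beta}\,|x_1-x_3|^{2(1-\beta)}\,I^{(L)}$. Write $x_{ij}=x_i-x_j$ and $1/w$ for the inversion $w\mapsto w/|w|^2$ of a plane vector; put $\mathsf{x}=\frac1{x_{12}}-\frac1{x_{42}}$, $\mathsf{y}=\frac1{x_{32}}-\frac1{x_{42}}$ (as complex numbers), and let $a(\beta)=\dfrac{\Gamma(1-\beta)}{4^{\beta}\pi\,\Gamma(\beta)}$.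 There is a unique function $\beta\mapsto\widetilde\Phi_L^{(\beta)}(z,\bar z;0)$, analytic on $\mathbb{C}\setminus\{1,2,3,\dots\}$, such that for $0<\mathrm{Re}\,\beta<1$ and every configuration of four distinct points with $\mathsf{y}/\mathsf{x}=z$ the integral $I^{(L)}$ converges absolutely and $$\widetilde\Phi_L^{(\beta)}(z,\bar z;0)=a(\beta)^{L+1}\,2\pi^2\,\frac{(z\bar z)^{1/2}}{\big((1-z)(1-\bar z)\big)^{1-\beta}}\,f_L .$$ \emph{Claim.} Let $\beta$ be generic, i.e. $\beta\in\mathbb{C}\setminus\{1,2,3,\dots\}$. (1) If $\mathrm{Re}\,\beta>0$, then $$\widetilde\Phi_L^{(\beta)}(z,\bar z;0)=4^{-\beta(L+1)}\sum_{n\in\mathbb{Z}}\int_{\gamma_n}d\nu\,\frac{\Gamma^{L+1}\!\big(\tfrac{n+1}{2}-\beta+i\nu\big)\,\Gamma^{L+1}\!\big(\tfrac{n+1}{2}-i\nu\big)}{\Gamma^{L+1}\!\big(\tfrac{n+1}{2}+\beta-i\nu\big)\,\Gamma^{L+1}\!\big(\tfrac{n+1}{2}+i\nu\big)}\;z^{i\nu+\frac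 n2}\,\bar z^{\,i\nu-\frac n2},$$ where $z^{i\nu+n/2}\bar z^{i\nu-n/2}:=(z\bar z)^{i\nu-n/2}z^n$. Here $\gamma_n$ is any $C^1$ contour from $-\infty$ to $+\infty$, horizontal outside a bounded set, which separates the poles $\nu=i\big(\tfrac{|n|+1}{2}-\beta\big)+ik$ (above $\gamma_n$) from the poles $\nu=-i\,\tfrac{|n|+1}{2}-ik$ (below $\gamma_n$), $k=0,1,2,\dots$ (for $\mathrm{Re}\,\beta<\frac12$ one may take the real line). The integrals converge as improper integrals and the sum over $n$ converges absolutely. (2) If $|z|<1$, then $$\widetilde\Phi_L^{(\beta)}(z,\bar z;0)=\frac{2\pi}{L!}\,4^{-\beta(L+1)}\,\partial_\varepsilon^{L}\Big|_{\varepsilon=0}\left[\varepsilon^{L+1}(z\bar z)^{\frac12-\varepsilon}\,\frac{\sin^{L+1}\big(\pi(\beta+\varepsilon)\big)}{\sin^{L+1}(\pi\varepsilon)}\,F_L(\beta,\varepsilon|z)\,F_L(\beta,\varepsilon|\bar z)\right],$$ where the convergent series $$F_L(\beta,\varepsilon|z)=\sum_{k=0}^{\infty}\frac{\Gamma^{L+1}(1-\beta+k-\varepsilon)}{\Gamma^{L+1}(1+k-\varepsilon)}\,z^k$$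 is used, and the bracket is analytic at $\varepsilon=0$ after its removable singularity there is filled in. -/

import Mathlib

open Complex MeasureTheory Filter Topology
open scoped ComplexConjugate

noncomputable section

namespace Ladder

/-- `(w²)^s` for a point `w` of the Euclidean plane `ℝ² = ℂ`, with `w² = |w|²`. -/
def sqPow (w s : ℂ) : ℂ := ((‖w‖ ^ 2 : ℝ) : ℂ) ^ s

/-- The consecutive points `x₁, q₁, …, q_L, x₃` along the horizontal line of the ladder diagram. -/
def chainPts (L : ℕ) (x₁ x₃ : ℂ) (q : Fin L → ℂ) : Fin (L + 2) → ℂ :=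
  Fin.cons (α := fun _ => ℂ) x₁ (Fin.snoc (α := fun _ => ℂ) q x₃)

/-- Integrand of the two-dimensional conformal `L`-loop ladder integral: each vertex `q_i` is joined
to `x₂` and to `x₄` by lines of index `β`, and consecutive points of the chain
`x₁, q₁, …, q_L, x₃` are joined by lines of index `1 - β`; a line of index `α` between `x` and `y`
is the propagator `1 / ((x - y)²)^α`. -/
def ladderIntegrand (L : ℕ) (β x₁ x₂ x₃ x₄ : ℂ) (q : Fin L → ℂ) : ℂ :=
  (∏ i : Fin L, sqPow (x₂ - q i) (-β) * sqPow (x₄ - q i) (-β)) *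
    ∏ m : Fin (L + 1),
      sqPow (chainPts L x₁ x₃ q m.castSucc - chainPts L x₁ x₃ q m.succ) (-(1 - β))

/-- The ladder integral `I^{(L)}(x₁, x₂, x₃, x₄; β)`, over the `L` vertices in the plane. -/
def ladderIntegral (L : ℕ) (β x₁ x₂ x₃ x₄ : ℂ) : ℂ :=
  ∫ q : Fin L → ℂ, ladderIntegrand L β x₁ x₂ x₃ x₄ q

/-- The conformally normalized integral `f_L = (x₂₄²)^{Lβ} (x₁₃²)^{1-β} I^{(L)}`. -/
def confLadder (L : ℕ) (β x₁ x₂ x₃ x₄ : ℂ) : ℂ :=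
  sqPow (x₂ - x₄) (L * β) * sqPow (x₁ - x₃) (1 - β) * ladderIntegral L β x₁ x₂ x₃ x₄

/-- Inversion `w ↦ w / w²` of the Euclidean plane, in the complex coordinate. -/
def inversion (w : ℂ) : ℂ := (conj w)⁻¹

/-- The variable `z = y / x`, where `x = 1/x₁₂ - 1/x₄₂` and `y = 1/x₃₂ - 1/x₄₂` (inversions of
vectors of the plane). One has `|z|² = u / v` and `|1 - z|² = 1 / v` for the cross-ratios
`u = x₁₂² x₃₄² / (x₂₄² x₁₃²)` and `v = x₁₄² x₂₃² / (x₂₄² x₁₃²)`. -/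
def zVar (x₁ x₂ x₃ x₄ : ℂ) : ℂ :=
  (inversion (x₃ - x₂) - inversion (x₄ - x₂)) / (inversion (x₁ - x₂) - inversion (x₄ - x₂))

/-- The constant `a(β) = Γ(1 - β) / (4^β π Γ(β))` (dimension two). -/
def aConst (β : ℂ) : ℂ := Gamma (1 - β) / ((4 : ℂ) ^ β * Real.pi * Gamma β)

/-- The generic propagator indices: the complex numbers other than `1, 2, 3, …`. -/
def genericIndex : Set ℂ := {β : ℂ | ∀ m : ℕ, β ≠ (m : ℂ) + 1}

/-- `Φ` is the two-dimensional `L`-loop ladder function at the point `z`, as a function of the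
propagator index `β`. In the strip `0 < Re β < 1` the ladder integral converges absolutely and
`Φ β = a(β)^{L+1} 2π² (z z̄)^{1/2} ((1 - z)(1 - z̄))^{-(1-β)} f_L` for every configuration of four
distinct points of the plane with variable `z`; for generic `β` it is the analytic continuation
in `β` from this strip. -/
def IsLadderFunction (L : ℕ) (z : ℂ) (Φ : ℂ → ℂ) : Prop :=
  AnalyticOnNhd ℂ Φ genericIndex ∧
  ∀ β : ℂ, 0 < β.re → β.re < 1 → ∀ x₁ x₂ x₃ x₄ : ℂ,
    x₁ ≠ x₂ → x₁ ≠ x₃ → x₁ ≠ x₄ → x₂ ≠ x₃ → x₂ ≠ x₄ → x₃ ≠ x₄ → zVar x₁ x₂ x₃ x₄ = z →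
    Integrable (ladderIntegrand L β x₁ x₂ x₃ x₄) ∧
    Φ β = aConst β ^ (L + 1) * (2 * Real.pi ^ 2) *
      (sqPow z (1 / 2) / sqPow (1 - z) (1 - β)) * confLadder L β x₁ x₂ x₃ x₄

open Classical in
/-- The two-dimensional ladder function `Φ̃_L^{(β)}(z, z̄; 0)` (the continuation is unique, since
the set of generic indices is open and connected). -/
def ladderFunction (L : ℕ) (β z : ℂ) : ℂ :=
  if h : ∃ Φ : ℂ → ℂ, IsLadderFunction L z Φ then h.choose β else 0

/-- `z^{iν + n/2} z̄^{iν - n/2}`, written single-valuedly as `(z z̄)^{iν - n/2} z^n`. -/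
def zPow (z : ℂ) (n : ℤ) (ν : ℂ) : ℂ := sqPow z (I * ν - (n : ℂ) / 2) * z ^ n

/-- The integrand of the Mellin–Barnes integral. -/
def mbIntegrand (L : ℕ) (β z : ℂ) (n : ℤ) (ν : ℂ) : ℂ :=
  (Gamma (((n : ℂ) + 1) / 2 - β + I * ν) ^ (L + 1) * Gamma (((n : ℂ) + 1) / 2 - I * ν) ^ (L + 1)) /
    (Gamma (((n : ℂ) + 1) / 2 + β - I * ν) ^ (L + 1) *
      Gamma (((n : ℂ) + 1) / 2 + I * ν) ^ (L + 1)) * zPow z n ν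

/-- The upper series of poles `i ((|n| + 1)/2 - β) + i k`. The product of Gamma functions in the
integrand depends, as a meromorphic function, only on `|n|`. -/
def upperPole (β : ℂ) (n : ℤ) (k : ℕ) : ℂ := I * (((n.natAbs : ℂ) + 1) / 2 - β + k)

/-- The lower series of poles `-i (|n| + 1)/2 - i k`. -/
def lowerPole (n : ℤ) (k : ℕ) : ℂ := -I * (((n.natAbs : ℂ) + 1) / 2 + k)

/-- The point `p` is off the contour `γ`, and the integral of `dν / (ν - p)` along `γ`, from left
to right, is `s`. For a contour which is horizontal near its two ends, `s = π i` means that `p` lies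
above (to the left of) the contour, and `s = -π i` that `p` lies below (to the right of) it. -/
def HasIndexIntegral (γ : ℝ → ℂ) (p s : ℂ) : Prop :=
  (∀ t, γ t ≠ p) ∧
  Tendsto (fun T : ℝ => ∫ t in (-T)..T, deriv γ t / (γ t - p)) atTop (𝓝 s)

/-- `γ` is an integration contour for the `n`-th Mellin–Barnes integral: a `C¹` curve from `-∞`
to `+∞`, coinciding with a horizontal line outside a bounded set, which separates the upper series
of poles from the lower one. -/
def IsSeparatingContour (β : ℂ) (n : ℤ) (γ : ℝ → ℂ) : Prop :=
  ContDiff ℝ 1 γ ∧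
  (∃ c R : ℝ, ∀ t : ℝ, R ≤ |t| → γ t = t - c * I) ∧
  (∀ k : ℕ, HasIndexIntegral γ (upperPole β n k) (Real.pi * I)) ∧
  (∀ k : ℕ, HasIndexIntegral γ (lowerPole n k) (-(Real.pi * I)))

/-- The improper contour integral `∫_γ f(ν) dν` converges to `J`. -/
def HasContourIntegral (f : ℂ → ℂ) (γ : ℝ → ℂ) (J : ℂ) : Prop :=
  Tendsto (fun T : ℝ × ℝ => ∫ t in (-T.1)..T.2, f (γ t) * deriv γ t) (atTop ×ˢ atTop) (𝓝 J)

/-- The `k`-th term of the power series `F_L(β, ε | z)`. -/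
def FTerm (L : ℕ) (β ε z : ℂ) (k : ℕ) : ℂ :=
  Gamma (1 - β + k - ε) ^ (L + 1) / Gamma (1 + k - ε) ^ (L + 1) * z ^ k

/-- `F_L(β, ε | z) = ∑_k Γ^{L+1}(1 - β + k - ε) / Γ^{L+1}(1 + k - ε) z^k`. -/
def FSeries (L : ℕ) (β ε z : ℂ) : ℂ := ∑' k : ℕ, FTerm L β ε z k

/-- The function of `ε ≠ 0` to which `∂_ε^L` is applied. -/
def bracket (L : ℕ) (β z ε : ℂ) : ℂ :=
  ε ^ (L + 1) * sqPow z (1 / 2 - ε) *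
    (sin (Real.pi * (β + ε)) ^ (L + 1) / sin (Real.pi * ε) ^ (L + 1)) *
    FSeries L β ε z * FSeries L β ε (conj z)

/-- The same function with its removable singularity at `ε = 0` filled in by the limit. -/
def bracketExt (L : ℕ) (β z : ℂ) : ℂ → ℂ :=
  Function.update (bracket L β z) 0 (limUnder (𝓝[≠] 0) (bracket L β z))

end Ladder

end

/-!
# The two-dimensional ladder function: derivative formula and Mellin-Barnes representation

Everything rests on the function `ladderDeriv L z` of `β`, the right-hand side of the derivative
formula for `|z| < 1`. By Cauchy's formula it is an integral over a small circle in `ε`, hence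
analytic in the generic index `β` (`analyticOnNhd_ladderDeriv`); expanding the two power series on
the circle turns it into an absolutely convergent double sum of residues `residueTerm`
(`hasSum_residueTerm`).

*Mellin-Barnes representation.* By the reflection formula the integrand depends on the Gamma
functions only through `mellinKernel β |n|`, up to a countable set of spurious singular values. For
`|z| < 1` the contour is closed in the lower half-plane. The kernel decays like a power of `|Re ν|`
because `Γ(x - β) / Γ(x)` does; this follows from three lines interpolation for the Beta function
and needs only `Re β > 0`. The residues are collected without a general residue theorem: the contour,
a horizontal line of return and small circles about the lower poles between them form a cycle whose
winding number about every pole vanishes, and such a cycle annihilates all functions with these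
poles (`chainIntegral_eq_zero`). The residues at the lower poles of the `n`-th integrand are the
terms with `i - j = n` of the double sum, which gives `mellinBarnes_of_norm_lt_one`. The symmetry
`ν ↦ -iβ - ν` of the kernel exchanges the two series of poles and carries the case `|z| > 1` to
`z⁻¹` (`mellinBarnes_of_one_lt_norm`).

*The ladder integral.* The Möbius map sending `x₂, x₃, x₄` to `0, 1, ∞` turns the ladder integral for
real `β = b` into the iterated convolution `iterPropagator (1 - b) L` of
`propagator (1 - b) w = |w|^{1-b} |1 - w|^{-2(1-b)}` on the multiplicative group of the plane
(`ladderMass_eq`). It is finite, since up to a constant the propagator's convolution with a suitable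
envelope is bounded by that envelope (`iterPropagator_lt_top`). For `1/2 < b < 1` the Mellin-Barnes
integral over the line half-way between the poles is a Fourier series in `arg z` whose coefficients
`angularCoeff b L n` are Fourier transforms of `(L+1)`-st powers of the kernel. The case `L = 0` is
the binomial series, and shows that the propagator has these coefficients; convolution multiplies
Mellin transforms, so by induction the iterated propagator has them too (`hasSum_angularCoeff`). The
coefficients are nonnegative, which is what justifies the interchanges of sum and integral.
Comparing the two expansions gives `ladderDeriv_ofReal`.

*Conclusion.* For complex `β` in the strip the integrand is dominated by the integrands at two real
indices, so the ladder integral is holomorphic in `β`, and the identity extends from real indices in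
`(1/2, 1)` to the strip (`prefactor_mul_confLadder`). The case `|z| > 1` follows by exchanging `x₂` and
`x₄`, which replaces `z` by `z⁻¹`. Since the generic indices form a connected open set, the ladder
function is the closed form `ladderClosedForm` everywhere (`ladderFunction_eq`).
-/


noncomputable section

namespace Ladder

/-! ### Powers of the Euclidean square -/

theorem sqPow_eq_exp {w : ℂ} (hw : w ≠ 0) (s : ℂ) :
    sqPow w s = cexp (s * (2 * Real.log ‖w‖ : ℝ)) := by
  have h : 0 < ‖w‖ := norm_pos_iff.2 hw
  have h2 : ((‖w‖ ^ 2 : ℝ) : ℂ) ≠ 0 := by exact_mod_cast (pow_pos h 2).ne'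
  rw [sqPow, cpow_def_of_ne_zero h2, ← Complex.ofReal_log (by positivity), Real.log_pow, mul_comm]
  norm_num

theorem sqPow_ne_zero {w : ℂ} (hw : w ≠ 0) (s : ℂ) : sqPow w s ≠ 0 := by
  rw [sqPow_eq_exp hw]; exact exp_ne_zero _

theorem norm_sqPow {w : ℂ} (hw : w ≠ 0) (s : ℂ) : ‖sqPow w s‖ = ‖w‖ ^ (2 * s.re) := by
  rw [sqPow_eq_exp hw, Complex.norm_exp, Real.rpow_def_of_pos (norm_pos_iff.2 hw)]
  congr 1
  simp only [mul_re, ofReal_re, ofReal_im]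
  ring

theorem sqPow_add {w : ℂ} (hw : w ≠ 0) (s t : ℂ) : sqPow w (s + t) = sqPow w s * sqPow w t := by
  rw [sqPow_eq_exp hw, sqPow_eq_exp hw, sqPow_eq_exp hw, ← Complex.exp_add]; ring_nf

theorem sqPow_mul (v w s : ℂ) : sqPow (v * w) s = sqPow v s * sqPow w s := by
  rw [sqPow, sqPow, sqPow, ← mul_cpow_ofReal_nonneg (by positivity) (by positivity), norm_mul,
    mul_pow, ofReal_mul]

theorem sqPow_one (s : ℂ) : sqPow 1 s = 1 := by simp [sqPow]

theorem sqPow_inv (w s : ℂ) : sqPow w⁻¹ s = (sqPow w s)⁻¹ := by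
  by_cases hw : w = 0
  · by_cases hs : s = 0 <;> simp [hw, sqPow, hs]
  · refine eq_inv_of_mul_eq_one_left ?_
    rw [← sqPow_mul, inv_mul_cancel₀ hw, sqPow_one]

theorem sqPow_div (v w s : ℂ) : sqPow (v / w) s = sqPow v s / sqPow w s := by
  rw [div_eq_mul_inv, sqPow_mul, sqPow_inv, div_eq_mul_inv]

theorem sqPow_neg (w s : ℂ) : sqPow w (-s) = (sqPow w s)⁻¹ := by rw [sqPow, cpow_neg, sqPow]

theorem sqPow_congr {v w : ℂ} (h : ‖v‖ = ‖w‖) (s : ℂ) : sqPow v s = sqPow w s := by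
  rw [sqPow, h, sqPow]

theorem sqPow_conj (w s : ℂ) : sqPow (conj w) s = sqPow w s := sqPow_congr (by simp) s

theorem sqPow_natCast (w : ℂ) (n : ℕ) : sqPow w n = w ^ n * conj w ^ n := by
  rw [sqPow, cpow_natCast, ← mul_pow, mul_conj, normSq_eq_norm_sq]

theorem differentiable_sqPow {w : ℂ} (hw : w ≠ 0) : Differentiable ℂ (sqPow w) := by
  have : sqPow w = fun s => cexp (s * (2 * Real.log ‖w‖ : ℝ)) := funext (sqPow_eq_exp hw)
  rw [this]; fun_prop

/-! ### Generic propagator indices -/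

theorem compl_genericIndex : genericIndexᶜ = Set.range fun m : ℕ => (m : ℂ) + 1 := by
  ext β; simp [genericIndex, eq_comm]

theorem isOpen_genericIndex : IsOpen genericIndex := by
  rw [← isClosed_compl_iff, compl_genericIndex]
  refine Metric.isClosed_of_pairwise_le_dist one_pos ?_
  rintro _ ⟨m, rfl⟩ _ ⟨k, rfl⟩ hmk
  have h : m ≠ k := fun h => hmk (by rw [h])
  have h2 : (1 : ℤ) ≤ |(m : ℤ) - k| := Int.one_le_abs (by omega)
  simp only [dist_add_right]
  rw [dist_eq]
  have h3 : ((m : ℂ) - k) = (((m : ℤ) - k : ℤ) : ℂ) := by push_cast; rfl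
  rw [h3, norm_intCast]
  exact_mod_cast h2

theorem isPreconnected_genericIndex : IsPreconnected genericIndex := by
  have h : (genericIndexᶜ).Countable := by
    rw [compl_genericIndex]; exact Set.countable_range _
  rw [← compl_compl genericIndex]
  exact (h.isConnected_compl_of_one_lt_rank (by simp [Complex.rank_real_complex])).isPreconnected

theorem mem_genericIndex_of_re_lt_one {β : ℂ} (h : β.re < 1) : β ∈ genericIndex := by
  intro m hm
  have : β.re = m + 1 := by simp [hm]
  have : (0 : ℝ) ≤ m := m.cast_nonneg
  linarith

/-! ### Holomorphic dependence of integrals on a parameter -/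

/-- An integral of functions that are holomorphic in a parameter, with a common integrable bound,
is holomorphic in the parameter. The derivative is bounded by Cauchy's estimate. -/
theorem differentiableAt_integral_of_dominated {α : Type*} [MeasurableSpace α] {μ : Measure α}
    {F : ℂ → α → ℂ} {x₀ : ℂ} {r : ℝ} (hr : 0 < r) {bound : α → ℝ}
    (hmeas : ∀ x ∈ Metric.ball x₀ r, AEStronglyMeasurable (F x) μ) (hbi : Integrable bound μ)
    (hb : ∀ᵐ a ∂μ, ∀ x ∈ Metric.ball x₀ r, ‖F x a‖ ≤ bound a)
    (hd : ∀ᵐ a ∂μ, DifferentiableOn ℂ (F · a) (Metric.ball x₀ r)) :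
    DifferentiableAt ℂ (fun x => ∫ a, F x a ∂μ) x₀ := by
  have hx₀ : x₀ ∈ Metric.ball x₀ r := Metric.mem_ball_self hr
  have hdx : ∀ᵐ a ∂μ, ∀ x ∈ Metric.ball x₀ r, HasDerivAt (F · a) (deriv (F · a) x) x := by
    filter_upwards [hd] with a ha x hx
    exact (ha.differentiableAt (Metric.isOpen_ball.mem_nhds hx)).hasDerivAt
  refine ((hasDerivAt_integral_of_dominated_loc_of_deriv_le (μ := μ) (F := F)
    (F' := fun x a => deriv (F · a) x) (s := Metric.ball x₀ (r / 2))
    (bound := fun a => bound a / (r / 4)) (Metric.ball_mem_nhds _ (by positivity))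
    ?_ ?_ ?_ ?_ (hbi.div_const _) ?_).2).differentiableAt
  · filter_upwards [Metric.ball_mem_nhds x₀ hr] with x hx using hmeas x hx
  · exact hbi.mono' (hmeas _ hx₀) (hb.mono fun a ha => ha _ hx₀)
  · have hu : Tendsto (fun n : ℕ => x₀ + ((r / 2 / (n + 1) : ℝ) : ℂ)) atTop (𝓝[≠] x₀) := by
      refine tendsto_nhdsWithin_iff.2 ⟨?_, Eventually.of_forall fun n => ?_⟩
      · have : Tendsto (fun n : ℕ => (r / 2 / (n + 1) : ℝ)) atTop (𝓝 0) :=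
          tendsto_const_div_atTop_nhds_zero_nat (r/2) |>.comp (tendsto_add_atTop_nat 1) |>.congr
            (by intro n; simp)
        simpa using (tendsto_const_nhds (x := x₀)).add
          ((continuous_ofReal.tendsto 0).comp this)
      · have : (r / 2 / (n + 1) : ℝ) ≠ 0 := by positivity
        simp only [Set.mem_compl_iff, Set.mem_singleton_iff, add_eq_left]
        exact_mod_cast this
    refine aestronglyMeasurable_of_tendsto_ae atTop
      (f := fun (n : ℕ) a => slope (F · a) x₀ (x₀ + ((r / 2 / (n + 1) : ℝ) : ℂ))) ?_ ?_
    · intro n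
      simp only [slope_def_field, div_eq_mul_inv]
      refine ((hmeas _ ?_).sub (hmeas _ hx₀)).mul_const _
      have h1 : r / 2 / (n + 1 : ℝ) ≤ r / 2 := div_le_self (by positivity) (by simp)
      have h2 : 0 < r / 2 / (n + 1 : ℝ) := by positivity
      simp only [← div_eq_mul_inv]
      rw [Metric.mem_ball, dist_eq, add_sub_cancel_left, norm_real, Real.norm_eq_abs,
        abs_of_pos h2]
      linarith
    · filter_upwards [hdx] with a ha
      exact (hasDerivAt_iff_tendsto_slope.1 (ha _ hx₀)).comp hu
  · filter_upwards [hb, hd] with a ha hda x hx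
    rw [Metric.mem_ball] at hx
    have hsub : Metric.closedBall x (r / 4) ⊆ Metric.ball x₀ r := fun y hy => by
      rw [Metric.mem_closedBall] at hy
      rw [Metric.mem_ball]
      linarith [dist_triangle y x x₀]
    refine norm_deriv_le_of_forall_mem_sphere_norm_le (by positivity) ?_ ?_
    · refine (hda.mono ?_).diffContOnCl
      exact closure_minimal (Metric.ball_subset_closedBall) Metric.isClosed_closedBall |>.trans hsub
    · intro y hy
      exact ha y (hsub (Metric.sphere_subset_closedBall hy))
  · filter_upwards [hdx] with a ha x hx
    exact ha x (Metric.ball_subset_ball (by linarith) hx)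

/-! ### Decay of quotients of Gamma functions -/

theorem norm_betaIntegral_le {y b : ℂ} {c : ℝ} (hy : 1 ≤ y.re) (hc : 0 < c) (hb : c ≤ b.re) :
    ‖betaIntegral y b‖ ≤ 1 / c := by
  have hint : ∀ c : ℝ, 0 < c → IntervalIntegrable (fun x : ℝ => (1 - x) ^ (c - 1)) volume 0 1 := by
    intro c hc
    have := (intervalIntegral.intervalIntegrable_rpow' (a := 0) (b := 1) (r := c - 1)
      (by linarith)).comp_sub_left 1
    simpa using this.symm
  have hval : ∫ x in (0 : ℝ)..1, (1 - x) ^ (c - 1) = 1 / c := by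
    rw [intervalIntegral.integral_comp_sub_left (fun x : ℝ => x ^ (c - 1)) 1]
    rw [integral_rpow (Or.inl (by linarith))]
    simp [Real.zero_rpow hc.ne']
  rw [betaIntegral, ← hval]
  refine intervalIntegral.norm_integral_le_of_norm_le zero_le_one ?_ (hint c hc)
  have h1 : ∀ᵐ x : ℝ, x ≠ 1 := by simp [ae_iff, measure_singleton]
  filter_upwards [h1] with x hx1 hx
  have hx0 : 0 < x := hx.1
  have hx1' : 0 < 1 - x := sub_pos.2 (lt_of_le_of_ne hx.2 hx1)
  have e : (1 - (x : ℂ)) = ((1 - x : ℝ) : ℂ) := by push_cast; rfl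
  rw [norm_mul, e, norm_cpow_eq_rpow_re_of_pos hx0, norm_cpow_eq_rpow_re_of_pos hx1']
  calc x ^ (y - 1).re * (1 - x) ^ (b - 1).re ≤ 1 * (1 - x) ^ (c - 1) :=
        mul_le_mul (Real.rpow_le_one hx0.le hx.2 (by simp; linarith))
          (Real.rpow_le_rpow_of_exponent_ge hx1' (by linarith) (by simp; linarith))
          (by positivity) zero_le_one
    _ = _ := one_mul _

/-- The Beta function `B(y, b)` decays like a power of `|y|` in the half-plane `Re y ≥ 1`. On
`Re b = c` it is bounded, on `Re b = c + 1` it is `O(|b| / |y|)` by its recurrence, and the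
three lines theorem interpolates. -/
theorem norm_betaIntegral_le_rpow {b : ℂ} {κ : ℝ} (hκ : 0 ≤ κ) (hκ1 : κ ≤ 1) (hb : κ < b.re) :
    ∃ C : ℝ, 0 < C ∧ ∀ y : ℂ, 1 ≤ y.re → ‖betaIntegral y b‖ ≤ C * ‖y‖ ^ (-κ) := by
  set c := b.re - κ with hc
  have hc0 : 0 < c := by linarith
  refine ⟨‖b + 1‖ * (1 / c), mul_pos (norm_pos_iff.2 fun h => ?_) (by positivity), fun y hy => ?_⟩
  · have : b.re + 1 = 0 := by simpa using congrArg re h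
    linarith
  have hy0 : y ≠ 0 := by rintro rfl; simp at hy; linarith
  have hyn : 0 < ‖y‖ := norm_pos_iff.2 hy0
  have hn1 : ∀ w : ℂ, c ≤ w.re → 1 ≤ ‖w + 1‖ := fun w hw =>
    le_trans (by simp; linarith) (re_le_norm (w + 1))
  have hdiff : ∀ w : ℂ, 0 < w.re → DifferentiableAt ℂ (fun w => betaIntegral y w / (w + 1)) w := by
    intro w hw
    have hev : (fun w => betaIntegral y w / (w + 1)) =ᶠ[𝓝 w]
        fun w => Gamma y * Gamma w * (Gamma (y + w))⁻¹ / (w + 1) := by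
      filter_upwards [(isOpen_lt continuous_const continuous_re).mem_nhds hw] with v hv
      rw [Complex.betaIntegral_eq_Gamma_mul_div y v (by linarith) hv]
      simp only [div_eq_mul_inv]
    refine DifferentiableAt.congr_of_eventuallyEq ?_ hev
    refine DifferentiableAt.div (((differentiableAt_const _).mul
      (differentiableAt_Gamma w ?_)).mul ?_) (by fun_prop) ?_
    · rintro m rfl
      simp at hw
      have : (0 : ℝ) ≤ m := m.cast_nonneg
      linarith
    · exact (differentiable_one_div_Gamma (y + w)).comp w (by fun_prop)
    · intro h
      have : w.re + 1 = 0 := by simpa using congrArg re h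
      linarith
  have hstrip : ∀ w : ℂ, c ≤ w.re → ‖betaIntegral y w / (w + 1)‖ ≤ 1 / c := by
    intro w hw
    rw [norm_div]
    exact (div_le_self (norm_nonneg _) (hn1 w hw)).trans (norm_betaIntegral_le hy hc0 hw)
  have key := HadamardThreeLines.norm_le_interp_of_mem_verticalClosedStrip'
    (f := fun w => betaIntegral y w / (w + 1)) (z := b) (a := 1 / c) (b := 1 / c * ‖y‖⁻¹)
    (l := c) (u := c + 1) (by linarith) ⟨by linarith, by linarith⟩ ?_ ?_ ?_ ?_
  · have he : (b.re - c) / (c + 1 - c) = κ := by rw [hc]; ring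
    rw [he, Real.mul_rpow (by positivity) (by positivity), ← mul_assoc,
      ← Real.rpow_add (by positivity), sub_add_cancel, Real.rpow_one, norm_div,
      Real.inv_rpow hyn.le, ← Real.rpow_neg hyn.le,
      div_le_iff₀ (by linarith [hn1 b (by linarith)])] at key
    linarith
  · refine DifferentiableOn.diffContOnCl fun w hw => ((hdiff w ?_).differentiableWithinAt)
    have hsub : closure (HadamardThreeLines.verticalStrip c (c + 1)) ⊆ re ⁻¹' Set.Ici c :=
      closure_minimal (fun v hv => le_of_lt hv.1) (isClosed_Ici.preimage continuous_re)
    exact lt_of_lt_of_le hc0 (hsub hw)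
  · refine ⟨1 / c, ?_⟩
    rintro _ ⟨w, hw, rfl⟩
    exact hstrip w hw.1
  · intro w hw
    exact hstrip w (le_of_eq hw.symm)
  · intro w hw
    have hw' : w.re = c + 1 := hw
    have hrec := betaIntegral_recurrence (u := y) (v := w - 1) (by linarith)
      (by simp [hw']; linarith)
    rw [sub_add_cancel] at hrec
    have : betaIntegral y w = (w - 1) * betaIntegral (y + 1) (w - 1) / y := by
      rw [← hrec, mul_div_cancel_left₀ _ hy0]
    rw [this]
    have h1 : ‖betaIntegral (y + 1) (w - 1)‖ ≤ 1 / c :=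
      norm_betaIntegral_le (by simp; linarith) hc0 (by simp [hw'])
    have h2 : ‖w - 1‖ ≤ ‖w + 1‖ := by
      rw [← sq_le_sq₀ (norm_nonneg _) (norm_nonneg _), ← normSq_eq_norm_sq, ← normSq_eq_norm_sq,
        normSq_apply, normSq_apply]
      simp [hw']
      nlinarith
    have h3 := hn1 w (by linarith)
    rw [norm_div, norm_div, norm_mul, div_div, mul_comm ‖y‖, ← div_div, ← div_eq_mul_inv]
    refine div_le_div_of_nonneg_right ?_ (norm_nonneg _)
    rw [div_le_iff₀ (by linarith), mul_comm]
    exact mul_le_mul h1 h2 (norm_nonneg _) (by positivity)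

theorem Gamma_sub_div_Gamma {x b : ℂ} (hb : 0 < b.re) (hx : b.re < x.re) :
    Gamma (x - b) / Gamma x = betaIntegral (x - b) b / Gamma b := by
  have h := Complex.Gamma_mul_Gamma_eq_betaIntegral (s := x - b) (t := b) (by simpa using hx) hb
  rw [sub_add_cancel] at h
  have h1 : Gamma x ≠ 0 := Gamma_ne_zero_of_re_pos (hb.trans hx)
  have h2 : Gamma b ≠ 0 := Gamma_ne_zero_of_re_pos hb
  field_simp
  rw [mul_comm, mul_comm, h]

/-- Decay of `Γ(x - b) / Γ(x)` in the right half-plane. -/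
theorem norm_Gamma_sub_div_Gamma_le {b : ℂ} {κ : ℝ} (hκ : 0 ≤ κ) (hκ1 : κ ≤ 1) (hb : κ < b.re) :
    ∃ C : ℝ, 0 < C ∧ ∀ x : ℂ, b.re + 1 ≤ x.re →
      ‖Gamma (x - b) / Gamma x‖ ≤ C * ‖x - b‖ ^ (-κ) := by
  obtain ⟨C, hC, h⟩ := norm_betaIntegral_le_rpow hκ hκ1 hb
  have hb0 : 0 < b.re := hκ.trans_lt hb
  have h2 : 0 < ‖Gamma b‖ := norm_pos_iff.2 (Gamma_ne_zero_of_re_pos hb0)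
  refine ⟨C / ‖Gamma b‖, by positivity, fun x hx => ?_⟩
  rw [Gamma_sub_div_Gamma hb0 (by linarith), norm_div, div_mul_eq_mul_div]
  gcongr
  exact h _ (by simp; linarith)

theorem Gamma_sub_div_Gamma_add_one {x b : ℂ} (h1 : x ≠ 0) (h2 : x - b ≠ 0) :
    Gamma (x - b) / Gamma x = Gamma (x + 1 - b) / Gamma (x + 1) * (x / (x - b)) := by
  rw [show x + 1 - b = (x - b) + 1 by ring, Gamma_add_one _ h1, Gamma_add_one _ h2]
  field_simp

/-- Decay of `Γ(x - b) / Γ(x)` in any right half-plane, away from the real axis. -/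
theorem norm_Gamma_sub_div_Gamma_le_im {b : ℂ} {κ : ℝ} (hκ : 0 ≤ κ) (hκ1 : κ ≤ 1) (hb : κ < b.re)
    (σ : ℝ) :
    ∃ C : ℝ, 0 < C ∧ ∀ x : ℂ, σ ≤ x.re → 1 ≤ |(x - b).im| → x.im ≠ 0 →
      ‖Gamma (x - b) / Gamma x‖ ≤ C * |(x - b).im| ^ (-κ) := by
  obtain ⟨C, hC, h⟩ := norm_Gamma_sub_div_Gamma_le hκ hκ1 hb
  have claim : ∀ m : ℕ, ∃ C : ℝ, 0 < C ∧ ∀ x : ℂ, b.re + 1 - m ≤ x.re → 1 ≤ |(x - b).im| →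
      x.im ≠ 0 → ‖Gamma (x - b) / Gamma x‖ ≤ C * |(x - b).im| ^ (-κ) := by
    intro m
    induction m with
    | zero =>
      refine ⟨C, hC, fun x hx hxi _ => (h x (by simpa using hx)).trans ?_⟩
      gcongr C * ?_
      exact Real.rpow_le_rpow_of_nonpos (by linarith) (abs_im_le_norm _) (by linarith)
    | succ m ih =>
      obtain ⟨C, hC, h⟩ := ih
      refine ⟨C * (1 + ‖b‖), by positivity, fun x hx hxi hx0 => ?_⟩
      have hn : 1 ≤ ‖x - b‖ := hxi.trans (abs_im_le_norm _)
      have hne : x - b ≠ 0 := norm_pos_iff.1 (by linarith)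
      rw [Gamma_sub_div_Gamma_add_one (by rintro rfl; simp at hx0) hne, norm_mul]
      have h1 := h (x + 1) (by push_cast at hx; simp; linarith) (by simpa using hxi)
        (by simpa using hx0)
      have h2 : ‖x / (x - b)‖ ≤ 1 + ‖b‖ := by
        rw [norm_div, div_le_iff₀ (by linarith)]
        calc ‖x‖ = ‖(x - b) + b‖ := by ring_nf
          _ ≤ ‖x - b‖ + ‖b‖ := norm_add_le _ _
          _ ≤ _ := by nlinarith [norm_nonneg b]
      have h3 : (x + 1 - b).im = (x - b).im := by simp
      rw [h3] at h1
      calc _ ≤ (C * |(x - b).im| ^ (-κ)) * (1 + ‖b‖) := by gcongr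
        _ = _ := by ring
  obtain ⟨m, hm⟩ := exists_nat_ge (b.re + 1 - σ)
  obtain ⟨C, hC, h⟩ := claim m
  exact ⟨C, hC, fun x hx => h x (by linarith)⟩

/-- Along vertical directions away from the real axis, and on the lines half-way between the
zeros of the denominator, `sin (a + b) / sin a` is bounded in `a`. -/
theorem norm_sin_add_div_sin_le (b : ℂ) : ∃ C : ℝ, 0 < C ∧ ∀ a : ℂ,
    (1 ≤ |a.im| ∨ Real.cos a.re = 0) → ‖sin (a + b) / sin a‖ ≤ C := by
  have key : ∃ C : ℝ, 0 < C ∧ ∀ a : ℂ, (1 ≤ |a.im| ∨ Real.cos a.re = 0) →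
      sin a ≠ 0 ∧ ‖cos a‖ ≤ C * ‖sin a‖ := by
    have hsc : ∀ a : ℂ, ‖sin a‖ ^ 2 = Real.sin a.re ^ 2 + Real.sinh a.im ^ 2 ∧
        ‖cos a‖ ^ 2 = Real.cos a.re ^ 2 + Real.sinh a.im ^ 2 := by
      intro a
      have hc := Real.cosh_sq a.im
      have h1 := Real.sin_sq_add_cos_sq a.re
      have hs := Complex.sin_eq a
      have hcs := Complex.cos_eq a
      simp only [← ofReal_sin, ← ofReal_cos, ← ofReal_cosh, ← ofReal_sinh] at hs hcs
      rw [← normSq_eq_norm_sq, ← normSq_eq_norm_sq, hs, hcs]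
      simp only [normSq_apply, add_re, add_im, sub_re, sub_im, mul_re, mul_im, ofReal_re,
        ofReal_im, I_re, I_im]
      constructor <;> ring_nf <;> rw [hc] <;> nlinarith
    refine ⟨1 + 1 / Real.sinh 1, by have := Real.sinh_pos_iff.2 one_pos; positivity, fun a ha => ?_⟩
    obtain ⟨hs, hc⟩ := hsc a
    have h1 := Real.sin_sq_add_cos_sq a.re
    have hS : 0 < Real.sinh 1 := Real.sinh_pos_iff.2 one_pos
    rcases ha with ha | ha
    · have h2 : Real.sinh 1 ≤ |Real.sinh a.im| := by
        rw [Real.abs_sinh]; exact Real.sinh_le_sinh.2 ha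
      have h3 : |Real.sinh a.im| ≤ ‖sin a‖ :=
        abs_le_of_sq_le_sq (by rw [hs]; nlinarith [sq_nonneg (Real.sin a.re)]) (norm_nonneg _)
      refine ⟨norm_pos_iff.1 (by linarith), ?_⟩
      have h4 : 1 ≤ 1 / Real.sinh 1 * ‖sin a‖ := by
        rw [one_div, inv_mul_eq_div, le_div_iff₀ hS]; linarith
      refine abs_le_of_sq_le_sq' (a := ‖cos a‖) ?_ (by positivity) |>.2
      rw [hc]
      nlinarith [norm_nonneg (sin a), sq_nonneg (Real.sin a.re)]
    · rw [ha] at h1 hc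
      have : ‖sin a‖ ^ 2 = 1 + Real.sinh a.im ^ 2 := by rw [hs]; linarith
      refine ⟨fun h => by rw [h] at this; simp at this; nlinarith [sq_nonneg (Real.sinh a.im)], ?_⟩
      have h5 : ‖cos a‖ ≤ ‖sin a‖ := by
        refine abs_le_of_sq_le_sq' (a := ‖cos a‖) ?_ (norm_nonneg _) |>.2
        rw [hc, this]; linarith
      have : 0 ≤ 1 / Real.sinh 1 := by positivity
      nlinarith [norm_nonneg (sin a)]
  obtain ⟨C, hC, h⟩ := key
  refine ⟨‖cos b‖ + C * ‖sin b‖ + 1, by positivity, fun a ha => ?_⟩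
  obtain ⟨h0, h1⟩ := h a ha
  have hpos : 0 < ‖sin a‖ := norm_pos_iff.2 h0
  rw [norm_div, div_le_iff₀ hpos, Complex.sin_add]
  calc _ ≤ ‖sin a * cos b‖ + ‖cos a * sin b‖ := norm_add_le _ _
    _ = ‖sin a‖ * ‖cos b‖ + ‖cos a‖ * ‖sin b‖ := by rw [norm_mul, norm_mul]
    _ ≤ ‖sin a‖ * ‖cos b‖ + (C * ‖sin a‖) * ‖sin b‖ := by gcongr
    _ ≤ _ := by nlinarith

/-! ### The power series `F_L` -/

/-- The coefficient `(Γ(1 - β + k - ε) / Γ(1 + k - ε))^{L+1}` of `F_L(β, ε | z)`. -/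
def coef (L : ℕ) (β ε : ℂ) (k : ℕ) : ℂ := (Gamma (1 - β + k - ε) / Gamma (1 + k - ε)) ^ (L + 1)

theorem FTerm_eq (L : ℕ) (β ε z : ℂ) (k : ℕ) : FTerm L β ε z k = coef L β ε k * z ^ k := by
  rw [FTerm, coef, div_pow]

/-- The product `∏_{j<k} (1 + B/(j + 1/2))`, which bounds quotients of Gamma functions. -/
def majorant (B : ℝ) (k : ℕ) : ℝ := ∏ j ∈ Finset.range k, (1 + B / (j + 1 / 2))

theorem majorant_pos {B : ℝ} (hB : 0 ≤ B) (k : ℕ) : 0 < majorant B k :=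
  Finset.prod_pos fun j _ => by positivity

theorem summable_majorant {B x : ℝ} (hB : 0 ≤ B) (hx0 : 0 ≤ x) (hx1 : x < 1) (L : ℕ) :
    Summable fun k => majorant B k ^ (L + 1) * x ^ k := by
  rcases hx0.eq_or_lt with rfl | hx0
  · refine summable_of_ne_finset_zero (s := {0}) fun k hk => ?_
    rw [zero_pow (by simpa using hk), mul_zero]
  refine summable_of_ratio_test_tendsto_lt_one hx1 (Eventually.of_forall fun k => ?_) ?_
  · have := majorant_pos hB k
    positivity
  · have h1 : ∀ k : ℕ, ‖majorant B (k + 1) ^ (L + 1) * x ^ (k + 1)‖ /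
        ‖majorant B k ^ (L + 1) * x ^ k‖ = (1 + B / (k + 1 / 2)) ^ (L + 1) * x := by
      intro k
      have h0 := majorant_pos hB k
      have h2 : majorant B (k + 1) = majorant B k * (1 + B / (k + 1 / 2)) := by
        rw [majorant, Finset.prod_range_succ, majorant]
      have h3 : (0 : ℝ) ≤ B / (k + 1 / 2) := by positivity
      rw [h2, ← norm_div, Real.norm_of_nonneg (by positivity), mul_pow, pow_succ x]
      field_simp
    simp_rw [h1]
    have h2 : Tendsto (fun k : ℕ => B / ((k : ℝ) + 1 / 2)) atTop (𝓝 0) :=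
      tendsto_const_nhds.div_atTop
        (tendsto_atTop_add_const_right _ _ tendsto_natCast_atTop_atTop)
    simpa using ((h2.const_add 1).pow (L + 1)).mul_const x

/-- A radius `δ` such that the disc of radius `2δ` about `β` avoids `1, 2, 3, …`. The circle
`|ε| = δ` then encloses only the poles in `ε` at the origin. -/
def IsGoodRadius (β : ℂ) (δ : ℝ) : Prop :=
  0 < δ ∧ δ ≤ 1 / 8 ∧ ∀ m : ℕ, 2 * δ < ‖(m : ℂ) + 1 - β‖

theorem exists_isGoodRadius {β₀ : ℂ} (h : β₀ ∈ genericIndex) :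
    ∃ δ : ℝ, 0 < δ ∧ ∀ β ∈ Metric.closedBall β₀ δ, IsGoodRadius β δ := by
  obtain ⟨r, hr, hsub⟩ := Metric.isOpen_iff.1 isOpen_genericIndex β₀ h
  refine ⟨min (r / 4) (1 / 8), by positivity, fun β hβ => ⟨by positivity, min_le_right _ _, ?_⟩⟩
  intro m
  have h1 : r ≤ ‖(m : ℂ) + 1 - β₀‖ := by
    by_contra! hlt
    exact hsub (by rw [Metric.mem_ball, dist_eq]; exact hlt) m rfl
  have h2 : ‖β - β₀‖ ≤ r / 4 := by
    rw [Metric.mem_closedBall, dist_eq] at hβ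
    exact hβ.trans (min_le_left _ _)
  have h3 : ‖(m : ℂ) + 1 - β₀‖ ≤ ‖(m : ℂ) + 1 - β‖ + ‖β - β₀‖ := by
    refine le_trans (le_of_eq ?_) (norm_add_le _ _); ring_nf
  have := min_le_left (r / 4) (1 / 8 : ℝ)
  linarith

theorem IsGoodRadius.mem_genericIndex {β : ℂ} {δ : ℝ} (h : IsGoodRadius β δ) {ε : ℂ}
    (hε : ‖ε‖ ≤ 2 * δ) : β + ε ∈ genericIndex := by
  intro m hm
  have h1 := h.2.2 m
  rw [← hm, add_sub_cancel_left] at h1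
  linarith

theorem differentiableAt_Gamma_one_sub {u : ℂ} (hu : u ∈ genericIndex) (k : ℕ) :
    DifferentiableAt ℂ Gamma (1 - u + k) := by
  refine differentiableAt_Gamma _ fun m hm => hu (k + m) ?_
  push_cast
  linear_combination -hm

theorem Gamma_one_sub_ne_zero {u : ℂ} (hu : u ∈ genericIndex) (k : ℕ) : Gamma (1 - u + k) ≠ 0 := by
  refine Gamma_ne_zero fun m hm => hu (k + m) ?_
  push_cast
  linear_combination -hm

/-- The coefficients are jointly analytic, in particular along every holomorphic curve. -/
theorem differentiableAt_coef {f g : ℂ → ℂ} {x : ℂ} (hf : DifferentiableAt ℂ f x)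
    (hg : DifferentiableAt ℂ g x) (h : f x + g x ∈ genericIndex) (L k : ℕ) :
    DifferentiableAt ℂ (fun y => coef L (f y) (g y) k) x := by
  unfold coef
  refine DifferentiableAt.pow ?_ _
  simp only [div_eq_mul_inv]
  refine DifferentiableAt.mul ?_ ?_
  · refine DifferentiableAt.comp x (f := fun y => 1 - f y + k - g y) (g := Gamma) ?_
      (by fun_prop)
    rw [show 1 - f x + k - g x = 1 - (f x + g x) + k by ring]
    exact differentiableAt_Gamma_one_sub h k
  · exact (differentiable_one_div_Gamma (1 + k - g x)).comp x
      (f := fun y => 1 + k - g y) (by fun_prop)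

/-- A bound for the coefficients which is uniform in `β` and `ε`: the ratio of consecutive
quotients of Gamma functions is `1 - β / (1 + k - ε)`. -/
theorem norm_coef_le {β₀ : ℂ} {ρ δ : ℝ} (h : ∀ β ∈ Metric.closedBall β₀ ρ, IsGoodRadius β δ)
    (L : ℕ) : ∃ C B : ℝ, 0 ≤ C ∧ 0 ≤ B ∧ ∀ β ∈ Metric.closedBall β₀ ρ, ∀ ε : ℂ, ‖ε‖ ≤ 2 * δ →
      ∀ k, ‖coef L β ε k‖ ≤ C * majorant B k ^ (L + 1) := by
  have hcont : ContinuousOn (fun p : ℂ × ℂ => Gamma (1 - p.1 - p.2) / Gamma (1 - p.2))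
      (Metric.closedBall β₀ ρ ×ˢ Metric.closedBall 0 (2 * δ)) := by
    rintro ⟨β, ε⟩ ⟨hβ, hε⟩
    simp only [Metric.mem_closedBall, dist_zero_right] at hε
    refine ContinuousAt.continuousWithinAt ?_
    simp only [div_eq_mul_inv]
    refine ContinuousAt.mul ?_ ?_
    · refine ContinuousAt.comp (f := fun p : ℂ × ℂ => 1 - p.1 - p.2) (g := Gamma) ?_ (by fun_prop)
      have := (differentiableAt_Gamma_one_sub ((h β hβ).mem_genericIndex hε) 0).continuousAt
      rwa [show (1 - (β + ε) + (0 : ℕ) : ℂ) = 1 - β - ε by push_cast; ring] at this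
    · exact ContinuousAt.comp (f := fun p : ℂ × ℂ => 1 - p.2) (g := fun s => (Gamma s)⁻¹)
        differentiable_one_div_Gamma.continuous.continuousAt (by fun_prop)
  obtain ⟨C, hC⟩ := ((isCompact_closedBall β₀ ρ).prod
    (isCompact_closedBall (0 : ℂ) (2 * δ))).exists_bound_of_continuousOn hcont
  refine ⟨max C 0 ^ (L + 1), |‖β₀‖ + ρ|, by positivity, by positivity, fun β hβ ε hε k => ?_⟩
  have hgood := h β hβ
  have hgen := hgood.mem_genericIndex hε
  have hβn : ‖β‖ ≤ |‖β₀‖ + ρ| := by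
    rw [Metric.mem_closedBall, dist_eq] at hβ
    calc ‖β‖ = ‖β₀ + (β - β₀)‖ := by ring_nf
      _ ≤ ‖β₀‖ + ‖β - β₀‖ := norm_add_le _ _
      _ ≤ ‖β₀‖ + ρ := by gcongr
      _ ≤ _ := le_abs_self _
  rw [coef, norm_pow, ← mul_pow]
  refine pow_le_pow_left₀ (norm_nonneg _) ?_ _
  induction k with
  | zero =>
    have := hC (β, ε) ⟨hβ, by simpa using hε⟩
    simpa [majorant] using Or.inl this
  | succ k ih =>
    have hk : (k : ℝ) + 1 / 2 ≤ ‖(1 + k - ε : ℂ)‖ := by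
      have h1 : ‖(1 + k : ℂ)‖ = 1 + k := by
        rw [show (1 + k : ℂ) = ((1 + k : ℝ) : ℂ) by push_cast; rfl, norm_real, Real.norm_of_nonneg]
        positivity
      have := norm_sub_norm_le (1 + k : ℂ) ε
      have := hgood.2.1
      linarith
    have hpos : (0 : ℝ) < k + 1 / 2 := by positivity
    have h0 : (1 + k - ε : ℂ) ≠ 0 := norm_pos_iff.1 (hpos.trans_le hk)
    have h0' : (1 - β + k - ε : ℂ) ≠ 0 := fun h0 => hgen k (by linear_combination -h0)
    have e : Gamma (1 - β + (k + 1 : ℕ) - ε) / Gamma (1 + (k + 1 : ℕ) - ε) =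
        Gamma (1 - β + k - ε) / Gamma (1 + k - ε) * ((1 - β + k - ε) / (1 + k - ε)) := by
      rw [show (1 - β + (k + 1 : ℕ) - ε : ℂ) = (1 - β + k - ε) + 1 by push_cast; ring,
        show (1 + (k + 1 : ℕ) - ε : ℂ) = (1 + k - ε) + 1 by push_cast; ring,
        Gamma_add_one _ h0, Gamma_add_one _ h0', div_mul_div_comm]
      ring
    have hm : majorant |‖β₀‖ + ρ| (k + 1) =
        majorant |‖β₀‖ + ρ| k * (1 + |‖β₀‖ + ρ| / (k + 1 / 2)) := by
      rw [majorant, Finset.prod_range_succ, majorant]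
    rw [e, norm_mul, hm, ← mul_assoc]
    have := majorant_pos (abs_nonneg (‖β₀‖ + ρ)) k
    refine mul_le_mul ih ?_ (norm_nonneg _) (by positivity)
    rw [show (1 - β + k - ε : ℂ) = (1 + k - ε) - β by ring, sub_div, div_self h0]
    refine (norm_sub_le _ _).trans ?_
    rw [norm_one, norm_div]
    gcongr

theorem isGoodRadius_closedBall_zero {β : ℂ} {δ : ℝ} (h : IsGoodRadius β δ) :
    ∀ β' ∈ Metric.closedBall β 0, IsGoodRadius β' δ := by
  intro β' hβ'
  rw [Metric.closedBall_zero, Set.mem_singleton_iff] at hβ'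
  rwa [hβ']

theorem summable_FTerm (L : ℕ) (β ε : ℂ) {z : ℂ} (hz : ‖z‖ < 1) : Summable (FTerm L β ε z) := by
  by_cases hz0 : z = 0
  · refine summable_of_ne_finset_zero (s := {0}) fun k hk => ?_
    rw [FTerm, hz0, zero_pow (by simpa using hk), mul_zero]
  have hsh : ∀ a : ℂ, ∀ᶠ k : ℕ in atTop, 0 < (a + k - ε).re := fun a => by
    obtain ⟨m, hm⟩ := exists_nat_gt (ε.re - a.re)
    filter_upwards [eventually_ge_atTop m] with k hk
    have : (m : ℝ) ≤ k := by exact_mod_cast hk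
    simp; linarith
  have h1 := hsh (1 - β)
  have h2 := hsh 1
  have hne : ∀ {w : ℂ}, 0 < w.re → w ≠ 0 := by rintro w hw rfl; simp at hw
  refine summable_of_ratio_test_tendsto_lt_one hz ?_ ?_
  · filter_upwards [h1, h2] with k hk1 hk2
    have := Gamma_ne_zero_of_re_pos hk1
    have := Gamma_ne_zero_of_re_pos hk2
    rw [FTerm]
    positivity
  · have hlim : Tendsto (fun k : ℕ => ‖1 - β / (1 + k - ε)‖ ^ (L + 1) * ‖z‖) atTop (𝓝 ‖z‖) := by
      have hinf : Tendsto (fun k : ℕ => (1 + k - ε : ℂ)) atTop (Bornology.cobounded ℂ) := by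
        refine tendsto_norm_atTop_iff_cobounded.1 (tendsto_atTop_mono (fun k : ℕ => ?_)
          (tendsto_atTop_add_const_right _ (-‖1 - ε‖) tendsto_natCast_atTop_atTop))
        have h := norm_sub_norm_le (k : ℂ) (-(1 - ε))
        rw [norm_neg, norm_natCast, sub_neg_eq_add] at h
        rw [show (1 + k - ε : ℂ) = k + (1 - ε) by ring]
        linarith
      have h3 := (tendsto_inv₀_cobounded (α := ℂ)).comp hinf
      have h4 : Tendsto (fun k : ℕ => 1 - β / (1 + k - ε : ℂ)) atTop (𝓝 1) := by
        simpa [div_eq_mul_inv] using (h3.const_mul β).const_sub 1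
      simpa using (h4.norm.pow (L + 1)).mul_const ‖z‖
    refine hlim.congr' ?_
    filter_upwards [h1, h2] with k hk1 hk2
    have hg1 := Gamma_ne_zero_of_re_pos hk1
    have hg2 := Gamma_ne_zero_of_re_pos hk2
    rw [← norm_div, ← norm_pow, ← norm_mul, FTerm, FTerm]
    congr 1
    rw [show (1 - β + (k + 1 : ℕ) - ε : ℂ) = (1 - β + k - ε) + 1 by push_cast; ring,
      show (1 + (k + 1 : ℕ) - ε : ℂ) = (1 + k - ε) + 1 by push_cast; ring,
      Gamma_add_one _ (hne hk1), Gamma_add_one _ (hne hk2), mul_pow, mul_pow, pow_succ z,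
      show (1 - β / (1 + k - ε) : ℂ) = (1 - β + k - ε) / (1 + k - ε) by
        have := hne hk2
        field_simp; ring, div_pow]
    have := hne hk2
    field_simp

section

/-! ### The regularised bracket -/

/-- The elementary factor of the bracket, regularised by `ε / sin (π ε) = Γ(1 + ε) Γ(1 - ε) / π`. -/
def prefactor (L : ℕ) (β z ε : ℂ) : ℂ :=
  sqPow z (1 / 2 - ε) * sin (Real.pi * (β + ε)) ^ (L + 1) *
    (Gamma (1 + ε) * Gamma (1 - ε) / Real.pi) ^ (L + 1)

/-- The bracket in a form that is analytic at `ε = 0`. -/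
def regBracket (L : ℕ) (β z ε : ℂ) : ℂ :=
  prefactor L β z ε * FSeries L β ε z * FSeries L β ε (conj z)

theorem Gamma_mul_Gamma_div_pi {ε : ℂ} (hε : ε ≠ 0) :
    Gamma (1 + ε) * Gamma (1 - ε) / Real.pi = ε / sin (Real.pi * ε) := by
  rw [add_comm 1 ε, Gamma_add_one _ hε, mul_assoc, Complex.Gamma_mul_Gamma_one_sub]
  have : (Real.pi : ℂ) ≠ 0 := by exact_mod_cast Real.pi_ne_zero
  field_simp

theorem bracket_eq_regBracket (L : ℕ) (β z : ℂ) {ε : ℂ} (hε : ε ≠ 0) :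
    bracket L β z ε = regBracket L β z ε := by
  rw [bracket, regBracket, prefactor, Gamma_mul_Gamma_div_pi hε, div_pow]
  ring

theorem ne_neg_natCast_of_norm_lt_one {ε : ℂ} (hε : ‖ε‖ < 1) (m : ℕ) : 1 + ε ≠ -m := by
  intro h
  have h2 := congrArg re h
  simp at h2
  have := (abs_le.1 ((abs_re_le_norm ε).trans hε.le)).1
  have := abs_lt.1 ((abs_re_le_norm ε).trans_lt hε)
  have : (0 : ℝ) ≤ m := m.cast_nonneg
  linarith

theorem differentiableAt_prefactor (L : ℕ) {z : ℂ} (hz : z ≠ 0) {f g : ℂ → ℂ} {x : ℂ}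
    (hf : DifferentiableAt ℂ f x) (hg : DifferentiableAt ℂ g x) (h1 : ‖g x‖ < 1) :
    DifferentiableAt ℂ (fun y => prefactor L (f y) z (g y)) x := by
  unfold prefactor
  refine ((((differentiable_sqPow hz) (1 / 2 - g x)).comp x (f := fun y => 1 / 2 - g y)
    (by fun_prop)).mul (by fun_prop)).mul ?_
  refine DifferentiableAt.pow ((DifferentiableAt.mul ?_ ?_).div_const _) _
  · exact (differentiableAt_Gamma (1 + g x) (ne_neg_natCast_of_norm_lt_one h1)).comp x
      (f := fun y => 1 + g y) (by fun_prop)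
  · refine (differentiableAt_Gamma (1 - g x) ?_).comp x (f := fun y => 1 - g y) (by fun_prop)
    simpa [sub_eq_add_neg] using ne_neg_natCast_of_norm_lt_one (ε := -g x) (by simpa using h1)

variable {L : ℕ} {β₀ z : ℂ} {ρ δ : ℝ}

theorem FSeries_eq (L : ℕ) (β ε z : ℂ) : FSeries L β ε z = ∑' k, coef L β ε k * z ^ k := by
  simp only [FSeries, FTerm_eq]

theorem exists_summable_bound (h : ∀ β ∈ Metric.closedBall β₀ ρ, IsGoodRadius β δ)
    (hz : ‖z‖ < 1) (L : ℕ) : ∃ u : ℕ → ℝ, Summable u ∧ ∀ β ∈ Metric.closedBall β₀ ρ, ∀ ε : ℂ,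
      ‖ε‖ ≤ 2 * δ → ∀ k, ‖coef L β ε k * z ^ k‖ ≤ u k := by
  obtain ⟨C, B, hC, hB, hb⟩ := norm_coef_le h L
  refine ⟨fun k => C * (majorant B k ^ (L + 1) * ‖z‖ ^ k),
    (summable_majorant hB (norm_nonneg z) hz L).mul_left C, fun β hβ ε hε k => ?_⟩
  simp only [norm_mul, norm_pow, ← mul_assoc]
  gcongr
  exact hb β hβ ε hε k

theorem differentiableOn_FSeries {U : Set ℂ} (hU : IsOpen U) {f g : ℂ → ℂ}
    (h : ∀ β ∈ Metric.closedBall β₀ ρ, IsGoodRadius β δ) (hz : ‖z‖ < 1)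
    (hf : Differentiable ℂ f) (hg : Differentiable ℂ g)
    (hfU : ∀ x ∈ U, f x ∈ Metric.closedBall β₀ ρ) (hgU : ∀ x ∈ U, ‖g x‖ ≤ 2 * δ) :
    DifferentiableOn ℂ (fun x => FSeries L (f x) (g x) z) U := by
  obtain ⟨u, hu, hb⟩ := exists_summable_bound h hz L
  simp only [FSeries_eq]
  refine differentiableOn_tsum_of_summable_norm hu (fun k x hx => ?_) hU
    (fun k x hx => hb _ (hfU x hx) _ (hgU x hx) k)
  exact ((differentiableAt_coef (hf x) (hg x)
    ((h _ (hfU x hx)).mem_genericIndex (hgU x hx)) L k).mul_const _).differentiableWithinAt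

theorem differentiableOn_regBracket {U : Set ℂ} (hU : IsOpen U) {f g : ℂ → ℂ}
    (h : ∀ β ∈ Metric.closedBall β₀ ρ, IsGoodRadius β δ) (hδ : δ ≤ 1 / 8) (hz0 : z ≠ 0)
    (hz : ‖z‖ < 1)
    (hf : Differentiable ℂ f) (hg : Differentiable ℂ g)
    (hfU : ∀ x ∈ U, f x ∈ Metric.closedBall β₀ ρ) (hgU : ∀ x ∈ U, ‖g x‖ ≤ 2 * δ) :
    DifferentiableOn ℂ (fun x => regBracket L (f x) z (g x)) U := by
  refine DifferentiableOn.mul (DifferentiableOn.mul (fun x hx => ?_)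
    (differentiableOn_FSeries hU h hz hf hg hfU hgU))
    (differentiableOn_FSeries hU h (by simpa using hz) hf hg hfU hgU)
  refine (differentiableAt_prefactor L hz0 (hf x) (hg x) ?_).differentiableWithinAt
  linarith [hgU x hx]

theorem IsGoodRadius.differentiableOn_regBracket {β : ℂ} (h : IsGoodRadius β δ) (hz0 : z ≠ 0)
    (hz : ‖z‖ < 1) : DifferentiableOn ℂ (regBracket L β z) (Metric.ball 0 (2 * δ)) :=
  Ladder.differentiableOn_regBracket Metric.isOpen_ball (f := fun _ => β) (g := fun ε => ε)
    (isGoodRadius_closedBall_zero h) h.2.1 hz0 hz (by fun_prop) (by fun_prop)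
    (fun x _ => by simp) (fun x hx => by simpa using (mem_ball_zero_iff.1 hx).le)

theorem analyticAt_regBracket {β : ℂ} (hβ : β ∈ genericIndex) (hz0 : z ≠ 0) (hz : ‖z‖ < 1) :
    AnalyticAt ℂ (regBracket L β z) 0 := by
  obtain ⟨δ, hδ, h⟩ := exists_isGoodRadius hβ
  exact ((h β (Metric.mem_closedBall_self hδ.le)).differentiableOn_regBracket hz0 hz).analyticAt
    (Metric.ball_mem_nhds _ (by linarith))

theorem bracketExt_eq_regBracket {β : ℂ} (hβ : β ∈ genericIndex) (hz0 : z ≠ 0) (hz : ‖z‖ < 1) :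
    bracketExt L β z = regBracket L β z := by
  have hlim : Tendsto (bracket L β z) (𝓝[≠] 0) (𝓝 (regBracket L β z 0)) := by
    refine ((analyticAt_regBracket hβ hz0 hz).continuousAt.tendsto.mono_left
      nhdsWithin_le_nhds).congr' ?_
    filter_upwards [self_mem_nhdsWithin] with ε hε
    exact (bracket_eq_regBracket L β z hε).symm
  ext ε
  rw [bracketExt, hlim.limUnder_eq]
  by_cases hε : ε = 0
  · rw [hε, Function.update_self]
  · rw [Function.update_of_ne hε, bracket_eq_regBracket L β z hε]

/-- The right-hand side of the derivative formula for the ladder function, as a function of `β`. -/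
def ladderDeriv (L : ℕ) (z β : ℂ) : ℂ :=
  2 * Real.pi / (L.factorial : ℂ) * (4 : ℂ) ^ (-β * ((L : ℂ) + 1)) *
    iteratedDeriv L (regBracket L β z) 0

theorem ladderDeriv_eq_circleIntegral {β : ℂ} (h : IsGoodRadius β δ) (hz0 : z ≠ 0)
    (hz : ‖z‖ < 1) :
    ladderDeriv L z β = (4 : ℂ) ^ (-β * ((L : ℂ) + 1)) *
      (-I * ∮ ε in C(0, δ), regBracket L β z ε / ε ^ (L + 1)) := by
  have hd : DiffContOnCl ℂ (regBracket L β z) (Metric.ball 0 δ) := by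
    refine ((h.differentiableOn_regBracket hz0 hz).mono ?_).diffContOnCl
    exact closure_minimal Metric.ball_subset_closedBall Metric.isClosed_closedBall |>.trans
      (Metric.closedBall_subset_ball (by linarith [h.1]))
  have key := DiffContOnCl.circleIntegral_one_div_sub_center_pow_smul h.1 L hd
  simp only [sub_zero, smul_eq_mul, one_div] at key
  have e : (∮ ε in C(0, δ), regBracket L β z ε / ε ^ (L + 1)) =
      ∮ ε in C(0, δ), (ε ^ (L + 1))⁻¹ * regBracket L β z ε := by
    simp only [div_eq_inv_mul]
  rw [e, key, ladderDeriv]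
  have := I_mul_I
  linear_combination ((2 * Real.pi / (L.factorial : ℂ) * (4 : ℂ) ^ (-β * ((L : ℂ) + 1)) *
    iteratedDeriv L (regBracket L β z) 0)) * this

theorem regBracket_conj (L : ℕ) (β z ε : ℂ) : regBracket L β (conj z) ε = regBracket L β z ε := by
  rw [regBracket, regBracket, conj_conj, prefactor, prefactor, sqPow_conj]; ring

theorem ladderDeriv_conj (L : ℕ) (z β : ℂ) : ladderDeriv L (conj z) β = ladderDeriv L z β := by
  rw [ladderDeriv, ladderDeriv, funext (regBracket_conj L β z)]

theorem continuousOn_prefactor (L : ℕ) (hz0 : z ≠ 0) :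
    ContinuousOn (fun p : ℂ × ℂ => prefactor L p.1 z p.2) (Set.univ ×ˢ Metric.ball 0 1) := by
  rintro ⟨β, ε⟩ ⟨-, hε⟩
  simp only [Metric.mem_ball, dist_zero_right] at hε
  refine ContinuousAt.continuousWithinAt ?_
  have h1 := differentiableAt_Gamma (1 + ε) (ne_neg_natCast_of_norm_lt_one hε)
  have h2 := differentiableAt_Gamma (1 - ε) (by
    simpa [sub_eq_add_neg] using ne_neg_natCast_of_norm_lt_one (ε := -ε) (by simpa using hε))
  unfold prefactor
  refine ((ContinuousAt.comp (f := fun p : ℂ × ℂ => 1 / 2 - p.2) (g := sqPow z)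
    (differentiable_sqPow hz0).continuous.continuousAt (by fun_prop)).mul (by fun_prop)).mul ?_
  refine ContinuousAt.pow ((ContinuousAt.mul ?_ ?_).div_const _) _
  · exact ContinuousAt.comp (f := fun p : ℂ × ℂ => 1 + p.2) (g := Gamma) h1.continuousAt
      (by fun_prop)
  · exact ContinuousAt.comp (f := fun p : ℂ × ℂ => 1 - p.2) (g := Gamma) h2.continuousAt
      (by fun_prop)

/-- The derivative formula defines a function that is analytic in the generic propagator index. -/
theorem analyticOnNhd_ladderDeriv (L : ℕ) (hz0 : z ≠ 0) (hz : ‖z‖ < 1) :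
    AnalyticOnNhd ℂ (ladderDeriv L z) genericIndex := by
  refine DifferentiableOn.analyticOnNhd (fun β₀ hβ₀ => ?_) isOpen_genericIndex
  refine DifferentiableAt.differentiableWithinAt ?_
  obtain ⟨δ, hδ, h⟩ := exists_isGoodRadius hβ₀
  have hδ8 : δ ≤ 1 / 8 := (h β₀ (Metric.mem_closedBall_self hδ.le)).2.1
  have hev : ladderDeriv L z =ᶠ[𝓝 β₀] fun β => (4 : ℂ) ^ (-β * ((L : ℂ) + 1)) *
      (-I * ∫ θ in Set.Ioc 0 (2 * Real.pi), deriv (circleMap 0 δ) θ •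
        (regBracket L β z (circleMap 0 δ θ) / (circleMap 0 δ θ) ^ (L + 1))) := by
    filter_upwards [Metric.closedBall_mem_nhds β₀ hδ] with β hβ
    rw [ladderDeriv_eq_circleIntegral (h β hβ) hz0 hz, circleIntegral,
      intervalIntegral.integral_of_le Real.two_pi_pos.le]
  refine DifferentiableAt.congr_of_eventuallyEq ?_ hev
  have h4 : DifferentiableAt ℂ (fun β : ℂ => (4 : ℂ) ^ (-β * ((L : ℂ) + 1))) β₀ :=
    DifferentiableAt.const_cpow (by fun_prop) (Or.inl (by norm_num))
  refine h4.mul (DifferentiableAt.const_mul ?_ _)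
  obtain ⟨u, hu, hb⟩ := exists_summable_bound h hz L
  obtain ⟨M, hM⟩ := ((isCompact_closedBall β₀ δ).prod
    (isCompact_closedBall (0 : ℂ) δ)).exists_bound_of_continuousOn
    ((continuousOn_prefactor (z := z) L hz0).mono (Set.prod_mono (Set.subset_univ _)
      (Metric.closedBall_subset_ball (by linarith))))
  have hnorm : ∀ θ, ‖circleMap 0 δ θ‖ = δ := fun θ => by simp [abs_of_pos hδ]
  have hF : ∀ w : ℂ, ‖w‖ = ‖z‖ → ∀ β ∈ Metric.closedBall β₀ δ, ∀ θ,
      ‖FSeries L β (circleMap 0 δ θ) w‖ ≤ ∑' k, u k := by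
    intro w hw β hβ θ
    rw [FSeries_eq]
    refine tsum_of_norm_bounded hu.hasSum fun k => ?_
    have := hb β hβ (circleMap 0 δ θ) (by rw [hnorm]; linarith) k
    rwa [norm_mul, norm_pow, hw, ← norm_pow, ← norm_mul]
  refine differentiableAt_integral_of_dominated hδ
    (bound := fun _ => δ * (M * (∑' k, u k) * (∑' k, u k) / δ ^ (L + 1))) ?_ ?_ ?_ ?_
  · intro β hβ
    have hd := ((h β (Metric.ball_subset_closedBall hβ)).differentiableOn_regBracket
      (L := L) hz0 hz).continuousOn
    refine Continuous.aestronglyMeasurable ?_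
    simp only [deriv_circleMap]
    refine ((continuous_circleMap 0 δ).mul continuous_const).smul (Continuous.div ?_
      ((continuous_circleMap 0 δ).pow _) ?_)
    · refine hd.comp_continuous (continuous_circleMap 0 δ) fun θ => ?_
      rw [mem_ball_zero_iff, hnorm]; linarith
    · intro θ
      exact pow_ne_zero _ (norm_pos_iff.1 (by rw [hnorm]; exact hδ))
  · exact integrable_const _
  · refine Eventually.of_forall fun θ β hβ => ?_
    have hβ' := Metric.ball_subset_closedBall hβ
    rw [norm_smul, norm_div, norm_pow, hnorm, deriv_circleMap, norm_mul, hnorm, norm_I, mul_one,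
      regBracket, norm_mul, norm_mul]
    have h1 := hM (β, circleMap 0 δ θ) ⟨hβ', by simp [abs_of_pos hδ]⟩
    have h2 := hF z rfl β hβ' θ
    have h3 := hF (conj z) (by simp) β hβ' θ
    simp only at h1
    have hM0 := (norm_nonneg _).trans h1
    have hu0 := (norm_nonneg _).trans h2
    gcongr
  · refine Eventually.of_forall fun θ => ?_
    simp only [smul_eq_mul]
    refine DifferentiableOn.const_mul (DifferentiableOn.div_const ?_ _) _
    exact differentiableOn_regBracket Metric.isOpen_ball (g := fun _ => circleMap 0 δ θ) h hδ8 hz0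
      hz differentiable_id (by fun_prop) (fun β hβ => Metric.ball_subset_closedBall hβ)
      (fun β _ => by rw [hnorm]; linarith)

/-- The contribution of the terms with indices `i` and `j` of the two power series: `2π` times the
residue at `ε = 0` of the bracket divided by `ε^{L+1}`, for radii `δ` with `IsGoodRadius β δ`. -/
def residueTerm (L : ℕ) (β z : ℂ) (δ : ℝ) (i j : ℕ) : ℂ :=
  -I * ∮ ε in C(0, δ), prefactor L β z ε * coef L β ε i * coef L β ε j / ε ^ (L + 1) *
    (z ^ i * conj z ^ j)

theorem IsGoodRadius.continuousOn_residueTerm {β : ℂ} (h : IsGoodRadius β δ) (hz0 : z ≠ 0)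
    (i j : ℕ) : ContinuousOn (fun ε => prefactor L β z ε * coef L β ε i * coef L β ε j /
      ε ^ (L + 1) * (z ^ i * conj z ^ j)) (Metric.sphere 0 δ) := by
  intro ε hε
  rw [mem_sphere_zero_iff_norm] at hε
  have hδ := h.1
  have h8 := h.2.1
  have hc : ∀ i, ContinuousWithinAt (fun ε => coef L β ε i) (Metric.sphere 0 δ) ε := fun i =>
    (differentiableAt_coef (differentiableAt_const β) differentiableAt_id
      (h.mem_genericIndex (by simp only [id]; linarith)) L i).continuousAt.continuousWithinAt
  refine ((((differentiableAt_prefactor L hz0 (differentiableAt_const β) differentiableAt_id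
    (by simp only [id]; linarith)).continuousAt.continuousWithinAt.mul (hc i)).mul (hc j)).div
    (by fun_prop) ?_).mul_const _
  exact pow_ne_zero _ (norm_pos_iff.1 (by rw [hε]; exact hδ))

/-- Multiplying out the two power series on the circle writes `ladderDeriv` as a double sum of
residues. -/
theorem hasSum_residueTerm {β : ℂ} (h : IsGoodRadius β δ) (hz0 : z ≠ 0) (hz : ‖z‖ < 1) :
    Summable (fun p : ℕ × ℕ => residueTerm L β z δ p.1 p.2) ∧
    (4 : ℂ) ^ (-β * ((L : ℂ) + 1)) * ∑' p : ℕ × ℕ, residueTerm L β z δ p.1 p.2 =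
      ladderDeriv L z β := by
  have hδ := h.1
  have h8 := h.2.1
  have hg := isGoodRadius_closedBall_zero h
  obtain ⟨u, hu, hb⟩ := exists_summable_bound hg hz L
  have hb := hb β (by simp)
  obtain ⟨M, hM⟩ := (isCompact_closedBall (0 : ℂ) δ).exists_bound_of_continuousOn
    (f := fun ε => prefactor L β z ε) ((continuousOn_prefactor (z := z) L hz0).comp
      (f := fun ε => (β, ε)) (by fun_prop) fun ε hε => ⟨Set.mem_univ _, by
        simp only [Metric.mem_closedBall, Metric.mem_ball] at hε ⊢; linarith⟩)
  have hnorm : ∀ θ, ‖circleMap 0 δ θ‖ = δ := fun θ => by simp [abs_of_pos hδ]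
  have hM0 : 0 ≤ M := (norm_nonneg _).trans (hM 0 (by simp [hδ.le]))
  have hu0 : ∀ k, 0 ≤ u k := fun k => (norm_nonneg _).trans (hb 0 (by simp [hδ.le]) k)
  have hconj : ∀ ε : ℂ, ‖ε‖ ≤ 2 * δ → ∀ k, ‖coef L β ε k * conj z ^ k‖ ≤ u k := fun ε hε k => by
    have := hb ε hε k
    rwa [norm_mul, norm_pow, ← RCLike.norm_conj z, ← norm_pow, ← norm_mul] at this
  let F : ℕ × ℕ → ℝ → ℂ := fun p θ => deriv (circleMap 0 δ) θ •
    (prefactor L β z (circleMap 0 δ θ) * coef L β (circleMap 0 δ θ) p.1 *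
      coef L β (circleMap 0 δ θ) p.2 / (circleMap 0 δ θ) ^ (L + 1) * (z ^ p.1 * conj z ^ p.2))
  have hFb : ∀ p θ, ‖F p θ‖ ≤ δ * (M / δ ^ (L + 1)) * (u p.1 * u p.2) := by
    intro p θ
    have e1 : ‖F p θ‖ = δ * (‖prefactor L β z (circleMap 0 δ θ)‖ / δ ^ (L + 1)) *
        (‖coef L β (circleMap 0 δ θ) p.1 * z ^ p.1‖ *
          ‖coef L β (circleMap 0 δ θ) p.2 * conj z ^ p.2‖) := by
      simp only [F, deriv_circleMap, norm_smul, norm_mul, norm_div, norm_pow, hnorm, norm_I]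
      ring
    rw [e1]
    have h1 := hM (circleMap 0 δ θ) (by simp [abs_of_pos hδ])
    have h2 := hb (circleMap 0 δ θ) (by rw [hnorm]; linarith) p.1
    have h3 := hconj (circleMap 0 δ θ) (by rw [hnorm]; linarith) p.2
    have := hu0 p.1
    gcongr
  have hFc : ∀ p, Continuous (F p) := by
    intro p
    simp only [F, deriv_circleMap]
    refine ((continuous_circleMap 0 δ).mul continuous_const).smul ?_
    exact (h.continuousOn_residueTerm (L := L) hz0 p.1 p.2).comp_continuous
      (continuous_circleMap 0 δ) fun θ => by simp [abs_of_pos hδ]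
  have hsu : Summable fun p : ℕ × ℕ => u p.1 * u p.2 := hu.mul_of_nonneg hu hu0 hu0
  have hFi : ∀ p, Integrable (F p) (volume.restrict (Set.Ioc 0 (2 * Real.pi))) := fun p =>
    Integrable.mono' (integrable_const _) (hFc p).aestronglyMeasurable
      (Eventually.of_forall (hFb p))
  have hsum : Summable fun p => ∫ θ in Set.Ioc 0 (2 * Real.pi), ‖F p θ‖ := by
    refine Summable.of_nonneg_of_le (fun p => by positivity) (fun p => ?_)
      ((hsu.mul_left (δ * (M / δ ^ (L + 1)))).mul_left (2 * Real.pi))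
    have := setIntegral_mono_on (hFi p).norm (integrable_const _) measurableSet_Ioc
      fun θ _ => hFb p θ
    simpa [Real.pi_pos.le] using this
  have key := hasSum_integral_of_summable_integral_norm hFi hsum
  have hterm : ∀ p : ℕ × ℕ, residueTerm L β z δ p.1 p.2 =
      -I * ∫ θ in Set.Ioc 0 (2 * Real.pi), F p θ := by
    intro p
    rw [residueTerm, circleIntegral, intervalIntegral.integral_of_le Real.two_pi_pos.le]
  have htot : ∀ θ, ∑' p, F p θ = deriv (circleMap 0 δ) θ •
      (regBracket L β z (circleMap 0 δ θ) / (circleMap 0 δ θ) ^ (L + 1)) := by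
    intro θ
    have hle : ‖circleMap 0 δ θ‖ ≤ 2 * δ := by rw [hnorm]; linarith
    have s1 : Summable fun k => ‖coef L β (circleMap 0 δ θ) k * z ^ k‖ :=
      hu.of_nonneg_of_le (fun _ => norm_nonneg _) (hb _ hle)
    have s2 : Summable fun k => ‖coef L β (circleMap 0 δ θ) k * conj z ^ k‖ :=
      hu.of_nonneg_of_le (fun _ => norm_nonneg _) (hconj _ hle)
    rw [regBracket, FSeries_eq, FSeries_eq, mul_assoc, tsum_mul_tsum_of_summable_norm s1 s2,
      mul_div_right_comm, ← tsum_mul_left, smul_eq_mul, ← tsum_mul_left]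
    refine tsum_congr fun p => ?_
    simp only [F, smul_eq_mul]
    ring
  refine ⟨?_, ?_⟩
  · simp_rw [hterm]
    exact key.summable.mul_left _
  · rw [ladderDeriv_eq_circleIntegral h hz0 hz]
    simp_rw [hterm]
    rw [tsum_mul_left, key.tsum_eq, circleIntegral,
      intervalIntegral.integral_of_le Real.two_pi_pos.le]
    simp_rw [htot]

end

/-! ### Cycles and partial fractions -/

/-- The integral of `f(ν) dν` along the restriction of the curve `g` to `[a, b]`. -/
def pathIntegral (f : ℂ → ℂ) (g : ℝ → ℂ) (a b : ℝ) : ℂ := ∫ t in a..b, f (g t) * deriv g t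

theorem intervalIntegrable_pathIntegral {f : ℂ → ℂ} {g : ℝ → ℂ} {a b : ℝ} (hg : ContDiff ℝ 1 g)
    (hf : ContinuousOn f (g '' Set.uIcc a b)) :
    IntervalIntegrable (fun t => f (g t) * deriv g t) volume a b := by
  refine ContinuousOn.intervalIntegrable ?_
  exact (hf.comp hg.continuous.continuousOn (Set.mapsTo_image _ _)).mul
    (hg.continuous_deriv le_rfl).continuousOn

theorem pathIntegral_of_hasDerivAt {f F : ℂ → ℂ} {g : ℝ → ℂ} {a b : ℝ} (hg : ContDiff ℝ 1 g)
    (hf : ContinuousOn f (g '' Set.uIcc a b))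
    (hF : ∀ x ∈ g '' Set.uIcc a b, HasDerivAt F (f x) x) :
    pathIntegral f g a b = F (g b) - F (g a) := by
  refine intervalIntegral.integral_eq_sub_of_hasDerivAt (f := F ∘ g) (fun t ht => ?_)
    (intervalIntegrable_pathIntegral hg hf)
  exact (hF _ (Set.mem_image_of_mem g ht)).comp t
    ((hg.differentiable one_ne_zero t).hasDerivAt)

section Cycle

variable {ι : Type*} {g : ι → ℝ → ℂ} {a b : ι → ℝ} {σ : ι → ℂ} {P : Set ℂ} {r : ℝ}

/-- The support of a chain. -/
def chainSupport (g : ι → ℝ → ℂ) (a b : ι → ℝ) : Set ℂ := ⋃ i, g i '' Set.uIcc (a i) (b i)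

theorem image_subset_chainSupport (i : ι) :
    g i '' Set.uIcc (a i) (b i) ⊆ chainSupport g a b := Set.subset_iUnion_of_subset i subset_rfl

variable [Fintype ι]

/-- The integral of `f(ν) dν` along a chain of curves with coefficients `σ`. -/
def chainIntegral (σ : ι → ℂ) (g : ι → ℝ → ℂ) (a b : ι → ℝ) (f : ℂ → ℂ) : ℂ :=
  ∑ i, σ i * pathIntegral f (g i) (a i) (b i)

theorem chainIntegral_congr {f₁ f₂ : ℂ → ℂ} (h : Set.EqOn f₁ f₂ (chainSupport g a b)) :
    chainIntegral σ g a b f₁ = chainIntegral σ g a b f₂ := by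
  refine Finset.sum_congr rfl fun i _ => ?_
  congr 1
  refine intervalIntegral.integral_congr fun t ht => ?_
  simp only [h (image_subset_chainSupport i (Set.mem_image_of_mem _ ht))]

theorem chainIntegral_add (hg : ∀ i, ContDiff ℝ 1 (g i)) {f₁ f₂ : ℂ → ℂ}
    (h₁ : ContinuousOn f₁ (chainSupport g a b)) (h₂ : ContinuousOn f₂ (chainSupport g a b)) :
    chainIntegral σ g a b (fun x => f₁ x + f₂ x) =
      chainIntegral σ g a b f₁ + chainIntegral σ g a b f₂ := by
  rw [chainIntegral, chainIntegral, chainIntegral, ← Finset.sum_add_distrib]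
  refine Finset.sum_congr rfl fun i _ => ?_
  rw [← mul_add, pathIntegral, pathIntegral, pathIntegral, ← intervalIntegral.integral_add
    (intervalIntegrable_pathIntegral (hg i) (h₁.mono (image_subset_chainSupport i)))
    (intervalIntegrable_pathIntegral (hg i) (h₂.mono (image_subset_chainSupport i)))]
  simp only [add_mul]

theorem chainIntegral_const_mul (c : ℂ) (f : ℂ → ℂ) :
    chainIntegral σ g a b (fun x => c * f x) = c * chainIntegral σ g a b f := by
  rw [chainIntegral, chainIntegral, Finset.mul_sum]
  refine Finset.sum_congr rfl fun i _ => ?_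
  have h : pathIntegral (fun x => c * f x) (g i) (a i) (b i) =
      c * pathIntegral f (g i) (a i) (b i) := by
    rw [pathIntegral, pathIntegral, ← intervalIntegral.integral_const_mul]
    simp only [mul_assoc]
  rw [h, mul_left_comm]

theorem chainIntegral_eq_zero_of_hasDerivAt (hg : ∀ i, ContDiff ℝ 1 (g i))
    (hclosed : ∀ F : ℂ → ℂ, ∑ i, σ i * (F (g i (b i)) - F (g i (a i))) = 0) {f F : ℂ → ℂ}
    (hf : ContinuousOn f (chainSupport g a b))
    (hF : ∀ x ∈ chainSupport g a b, HasDerivAt F (f x) x) : chainIntegral σ g a b f = 0 := by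
  rw [← hclosed F]
  refine Finset.sum_congr rfl fun i _ => ?_
  rw [pathIntegral_of_hasDerivAt (hg i) (hf.mono (image_subset_chainSupport i))
    fun x hx => hF x (image_subset_chainSupport i hx)]

/-- A cycle which has winding number zero about every point of `P` annihilates the functions with
poles in `P` only: partial fractions and Taylor expansion of the numerator reduce them to
derivatives and to functions `1 / (ν - p)`. -/
theorem chainIntegral_eq_zero (hg : ∀ i, ContDiff ℝ 1 (g i))
    (hclosed : ∀ F : ℂ → ℂ, ∑ i, σ i * (F (g i (b i)) - F (g i (a i))) = 0)
    (hP : ∀ p ∈ P, p ∉ chainSupport g a b) (hr : chainSupport g a b ⊆ Metric.ball 0 r)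
    (hres : ∀ p ∈ P, chainIntegral σ g a b (fun x => (x - p)⁻¹) = 0) (n : ℕ) :
    ∀ (S : Multiset ℂ) (G : ℂ → ℂ), S.card = n → (∀ p ∈ S, p ∈ P) →
      DifferentiableOn ℂ G (Metric.ball 0 r) →
      chainIntegral σ g a b (fun x => G x * (S.map fun p => (x - p)⁻¹).prod) = 0 := by
  have hne : ∀ p ∈ P, ∀ x ∈ chainSupport g a b, x - p ≠ 0 := fun p hp x hx h =>
    hP p hp (by rwa [sub_eq_zero.1 h] at hx)
  have hcont : ∀ (S : Multiset ℂ) (G : ℂ → ℂ), (∀ p ∈ S, p ∈ P) →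
      DifferentiableOn ℂ G (Metric.ball 0 r) →
      ContinuousOn (fun x => G x * (S.map fun p => (x - p)⁻¹).prod) (chainSupport g a b) := by
    intro S G hS hG
    refine (hG.continuousOn.mono hr).mul ?_
    refine continuousOn_multiset_prod S fun p hp => ?_
    exact ContinuousOn.inv₀ (by fun_prop) (hne p (hS p hp))
  have hcm : ∀ (c : ℂ) {f : ℂ → ℂ}, ContinuousOn f (chainSupport g a b) →
      ContinuousOn (fun x => c * f x) (chainSupport g a b) := fun c _ h => continuousOn_const.mul h
  have hexact : ∀ G : ℂ → ℂ, DifferentiableOn ℂ G (Metric.ball 0 r) →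
      chainIntegral σ g a b G = 0 := by
    intro G hG
    obtain ⟨F, hF⟩ := hG.isExactOn_ball
    exact chainIntegral_eq_zero_of_hasDerivAt hg hclosed (hG.continuousOn.mono hr)
      fun x hx => hF x (hr hx)
  induction n with
  | zero =>
    intro S G hS _ hG
    rw [Multiset.card_eq_zero.1 hS]
    simpa using hexact G hG
  | succ n ih =>
    intro S G hcard hS hG
    obtain ⟨p, S', rfl⟩ : ∃ p S', S = p ::ₘ S' := by
      obtain ⟨p, hp⟩ := Multiset.card_pos_iff_exists_mem.1 (by omega : 0 < S.card)
      exact ⟨p, _, (Multiset.cons_erase hp).symm⟩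
    have hcard' : S'.card = n := by simpa using hcard
    have hp : p ∈ P := hS p (Multiset.mem_cons_self _ _)
    have hS' : ∀ q ∈ S', q ∈ P := fun q hq => hS q (Multiset.mem_cons_of_mem hq)
    by_cases hq : ∃ q ∈ S', q ≠ p
    · -- two distinct poles are separated by partial fractions
      obtain ⟨q, hqS, hqp⟩ := hq
      obtain ⟨S'', rfl⟩ : ∃ S'', S' = q ::ₘ S'' := ⟨_, (Multiset.cons_erase hqS).symm⟩
      have hS'' : ∀ q ∈ S'', q ∈ P := fun q hq => hS' q (Multiset.mem_cons_of_mem hq)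
      have hpS'' : ∀ x ∈ p ::ₘ S'', x ∈ P := fun x hx => by
        rcases Multiset.mem_cons.1 hx with rfl | hx
        exacts [hp, hS'' x hx]
      have h1 := ih (q ::ₘ S'') G hcard' hS' hG
      have h2 := ih (p ::ₘ S'') G (by simpa using hcard') hpS'' hG
      have hpq : p - q ≠ 0 := sub_ne_zero.2 (Ne.symm hqp)
      rw [chainIntegral_congr (f₂ := fun x => (p - q)⁻¹ *
          (G x * ((p ::ₘ S'').map fun p => (x - p)⁻¹).prod) + (-(p - q)⁻¹) *
          (G x * ((q ::ₘ S'').map fun p => (x - p)⁻¹).prod)),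
        chainIntegral_add hg (hcm _ (hcont _ G hpS'' hG)) (hcm _ (hcont _ G hS' hG)), chainIntegral_const_mul,
        chainIntegral_const_mul, h1, h2]
      · simp
      · intro x hx
        have hxp := hne p hp x hx
        have hxq := hne q (hS' q (Multiset.mem_cons_self _ _)) x hx
        simp only [Multiset.map_cons, Multiset.prod_cons]
        field_simp
        ring
    · -- a single multiple pole: `G x = G p + (x - p) * dslope G p x` lowers the order by one, and
      -- `(x - p)^{-(n+1)}` has a primitive unless `n = 0`
      push Not at hq
      have hrep : S' = Multiset.replicate n p := Multiset.eq_replicate.2 ⟨hcard', hq⟩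
      have hprod : ∀ x, (S'.map fun p => (x - p)⁻¹).prod = ((x - p)⁻¹) ^ n := fun x => by
        rw [hrep, Multiset.map_replicate, Multiset.prod_replicate]
      simp only [Multiset.map_cons, Multiset.prod_cons, hprod]
      by_cases hpr : p ∈ Metric.ball (0 : ℂ) r
      · have hd : DifferentiableOn ℂ (dslope G p) (Metric.ball 0 r) :=
          (Complex.differentiableOn_dslope (Metric.isOpen_ball.mem_nhds hpr)).2 hG
        have h1 := ih S' (dslope G p) hcard' hS' hd
        have hc1 := hcont S' _ hS' hd
        simp only [hprod] at h1 hc1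
        have hc2 : ContinuousOn (fun x => ((x - p)⁻¹) ^ (n + 1)) (chainSupport g a b) :=
          (ContinuousOn.inv₀ (by fun_prop) (hne p hp)).pow _
        have h2 : chainIntegral σ g a b (fun x => ((x - p)⁻¹) ^ (n + 1)) = 0 := by
          rcases Nat.eq_zero_or_pos n with rfl | hn
          · simpa using hres p hp
          · refine chainIntegral_eq_zero_of_hasDerivAt hg hclosed hc2
              (F := fun x => -(n : ℂ)⁻¹ * ((x - p)⁻¹) ^ n) fun x hx => ?_
            have hx' := hne p hp x hx
            have h3 := ((((hasDerivAt_id x).sub_const p).inv hx').pow n).const_mul (-(n : ℂ)⁻¹)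
            refine h3.congr_deriv ?_
            have hn' : (n : ℂ) ≠ 0 := by exact_mod_cast hn.ne'
            obtain ⟨m, rfl⟩ : ∃ m, n = m + 1 := ⟨n - 1, by omega⟩
            simp only [id, Nat.add_sub_cancel, Pi.inv_apply, inv_pow, pow_succ]
            field_simp
        rw [chainIntegral_congr (f₂ := fun x => dslope G p x * ((x - p)⁻¹) ^ n +
            G p * ((x - p)⁻¹) ^ (n + 1)), chainIntegral_add hg hc1 (hcm _ hc2),
          chainIntegral_const_mul, h1, h2, mul_zero, add_zero]
        intro x hx
        have hx' := hne p hp x hx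
        have h4 : G x = G p + (x - p) * dslope G p x := by
          have := sub_smul_dslope G p x
          rw [smul_eq_mul] at this
          rw [this]; ring
        simp only
        rw [h4, pow_succ]
        field_simp
        ring
      · -- a pole outside the disc does not spoil holomorphy
        refine hexact _ (hG.mul (DifferentiableOn.mul ?_ (DifferentiableOn.pow ?_ _))) <;>
        · refine DifferentiableOn.inv (by fun_prop) fun x hx h => hpr ?_
          rwa [sub_eq_zero.1 h] at hx

end Cycle

/-! ### Winding numbers of separating contours -/

/-- The cycle which follows `γ` from `-T₁` to `T₂` and returns along the line `Im ν = h₁`; the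
contour `γ` is at height `h₀` at both ends. -/
def returnIntegral (γ : ℝ → ℂ) (h₀ h₁ T₁ T₂ : ℝ) (f : ℂ → ℂ) : ℂ :=
  (∫ t in (-T₁)..T₂, f (γ t) * deriv γ t) - (∫ t in (-T₁)..T₂, f (t + h₁ * I)) +
    I * (∫ y in h₀..h₁, f (T₂ + y * I)) - I * ∫ y in h₀..h₁, f ((-T₁ : ℝ) + y * I)

theorem deriv_horizontal (h t : ℝ) : deriv (fun t : ℝ => (t : ℂ) + h * I) t = 1 :=
  ((hasDerivAt_id t).ofReal_comp.add_const _).deriv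

theorem returnIntegral_eq {γ : ℝ → ℂ} {h₀ h₁ R T₁ T₂ : ℝ} (hγ : ContDiff ℝ 1 γ)
    (htail : ∀ t : ℝ, R ≤ |t| → γ t = t + h₀ * I) (h1 : R < T₁) (h2 : R < T₂) (hR : 0 < R)
    {f : ℂ → ℂ} (hf : DifferentiableOn ℂ f {x | R ≤ |x.re|})
    (hfγ : ContinuousOn f (γ '' Set.Icc (-R) R)) (hfh : Continuous fun t : ℝ => f (t + h₁ * I)) :
    returnIntegral γ h₀ h₁ T₁ T₂ f = returnIntegral γ h₀ h₁ R R f := by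
  have hderiv : ∀ t : ℝ, R < |t| → deriv γ t = 1 := by
    intro t ht
    have : γ =ᶠ[𝓝 t] fun t : ℝ => (t : ℂ) + h₀ * I := by
      filter_upwards [(isOpen_lt continuous_const continuous_abs).mem_nhds ht] with s hs
      exact htail s (le_of_lt hs)
    rw [this.deriv_eq, deriv_horizontal]
  have hcr : Continuous fun t => deriv γ t := hγ.continuous_deriv le_rfl
  have habs : ∀ t : ℝ, R ≤ t → |t| = t := fun t ht => abs_of_nonneg (hR.le.trans ht)
  have habs' : ∀ t : ℝ, t ≤ -R → |t| = -t := fun t ht => abs_of_nonpos (by linarith)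
  -- the tails of the cycle bound rectangles on which `f` is holomorphic
  have rect1 := integral_boundary_rect_eq_zero_of_differentiableOn f (R + h₀ * I) (T₂ + h₁ * I)
    (hf.mono (by
      rintro x ⟨hx, -⟩
      simp only [add_re, ofReal_re, mul_re, I_re, ofReal_im, I_im, Set.mem_preimage] at hx
      rw [Set.uIcc_of_le (by simp; linarith)] at hx
      have := hx.1
      simp at this
      simp only [Set.mem_ofPred_eq]
      exact this.trans (le_abs_self _)))
  have rect2 := integral_boundary_rect_eq_zero_of_differentiableOn f ((-T₁ : ℝ) + h₀ * I)
    ((-R : ℝ) + h₁ * I) (hf.mono (by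
      rintro x ⟨hx, -⟩
      simp only [add_re, ofReal_re, mul_re, I_re, ofReal_im, I_im, Set.mem_preimage] at hx
      rw [Set.uIcc_of_le (by simp; linarith)] at hx
      have := hx.2
      simp at this
      simp only [Set.mem_ofPred_eq]
      exact (by linarith : R ≤ -x.re).trans (neg_le_abs _)))
  simp only [add_re, ofReal_re, mul_re, I_re, ofReal_im, I_im, add_im, mul_im, mul_zero, mul_one,
    sub_self, add_zero, zero_add, smul_eq_mul] at rect1 rect2
  have i0 : IntervalIntegrable (fun t => f (γ t) * deriv γ t) volume (-R) R :=
    intervalIntegrable_pathIntegral hγ (by rwa [Set.uIcc_of_le (by linarith)])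
  have hline : ∀ a b : ℝ, (∀ t ∈ Set.uIcc a b, R ≤ |t|) →
      IntervalIntegrable (fun t : ℝ => f (t + h₀ * I)) volume a b := by
    intro a b hab
    refine ContinuousOn.intervalIntegrable ?_
    exact hf.continuousOn.comp (by fun_prop) fun t ht => by simpa using hab t ht
  have hae : ∀ᵐ t : ℝ, t ≠ -R ∧ t ≠ R :=
    (Measure.ae_ne volume (-R)).and (Measure.ae_ne volume R)
  have e1 : ∀ᵐ t : ℝ, t ∈ Set.uIoc R T₂ → f (t + h₀ * I) = f (γ t) * deriv γ t := by
    filter_upwards [hae] with t ht htm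
    rw [Set.uIoc_of_le h2.le] at htm
    have hlt : R < |t| := by rw [habs t htm.1.le]; exact htm.1
    rw [hderiv t hlt, htail t hlt.le, mul_one]
  have e2 : ∀ᵐ t : ℝ, t ∈ Set.uIoc (-T₁) (-R) → f (t + h₀ * I) = f (γ t) * deriv γ t := by
    filter_upwards [hae] with t ht htm
    rw [Set.uIoc_of_le (by linarith)] at htm
    have hlt : R < |t| := by
      rw [habs' t htm.2]
      have := lt_of_le_of_ne htm.2 ht.1
      linarith
    rw [hderiv t hlt, htail t hlt.le, mul_one]
  have l1 := hline R T₂ (fun t ht => by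
    rw [Set.uIcc_of_le h2.le] at ht; rw [habs t ht.1]; exact ht.1)
  have l2 := hline (-T₁) (-R) (fun t ht => by
    rw [Set.uIcc_of_le (by linarith)] at ht; rw [habs' t ht.2]; linarith [ht.2])
  have i1 : IntervalIntegrable (fun t => f (γ t) * deriv γ t) volume R T₂ :=
    l1.congr_ae ((ae_restrict_iff' measurableSet_uIoc).2 e1)
  have i2 : IntervalIntegrable (fun t => f (γ t) * deriv γ t) volume (-T₁) (-R) :=
    l2.congr_ae ((ae_restrict_iff' measurableSet_uIoc).2 e2)
  have s1 := intervalIntegral.integral_add_adjacent_intervals (i2.trans i0) i1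
  have s2 := intervalIntegral.integral_add_adjacent_intervals i2 i0
  have s3 := intervalIntegral.integral_add_adjacent_intervals
    (hfh.intervalIntegrable (-T₁) R (μ := volume)) (hfh.intervalIntegrable R T₂)
  have s4 := intervalIntegral.integral_add_adjacent_intervals
    (hfh.intervalIntegrable (-T₁) (-R) (μ := volume)) (hfh.intervalIntegrable (-R) R)
  rw [intervalIntegral.integral_congr_ae e1] at rect1
  rw [intervalIntegral.integral_congr_ae e2] at rect2
  rw [returnIntegral, returnIntegral, ← s1, ← s2, ← s3, ← s4]
  linear_combination rect1 + rect2

/-- The index integral of a horizontal line. Multiplication by `c = ± i` moves the line into the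
right half-plane, where the principal logarithm is a primitive. -/
theorem tendsto_integral_line_aux {c w : ℂ} (hc : c = I ∨ c = -I) (hw : 0 < (-(c * w)).re) :
    Tendsto (fun T : ℝ => ∫ t in (-T)..T, ((t : ℂ) - w)⁻¹) atTop (𝓝 (log c - log (-c))) := by
  have hc0 : c ≠ 0 := by rcases hc with rfl | rfl <;> simp
  have hcre : c.re = 0 := by rcases hc with rfl | rfl <;> simp
  have hcs : c ∈ slitPlane ∧ -c ∈ slitPlane := by
    rcases hc with rfl | rfl <;> simp [mem_slitPlane_iff]
  have hre : ∀ t : ℝ, 0 < (c * (t - w)).re := fun t => by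
    have : (c * (t - w)).re = (-(c * w)).re := by simp [mul_sub, hcre]
    rw [this]; exact hw
  have hint : ∀ T : ℝ, ∫ t in (-T)..T, ((t : ℂ) - w)⁻¹ =
      log (c * (T - w)) - log (c * ((-T : ℝ) - w)) := by
    intro T
    have hne : ∀ t : ℝ, (t : ℂ) - w ≠ 0 := fun t h => by
      have := hre t
      rw [h, mul_zero] at this
      simp at this
    refine intervalIntegral.integral_eq_sub_of_hasDerivAt (f := fun t : ℝ => log (c * (t - w)))
      (fun t _ => ?_) ?_
    · have h := ((((hasDerivAt_id t).ofReal_comp).sub_const w).const_mul c).clog_real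
        (Or.inl (hre t))
      refine h.congr_deriv ?_
      have := hne t
      simp only [id]
      field_simp
      simp
    · exact (Continuous.inv₀ (by fun_prop) hne).intervalIntegrable _ _
  have hlim : ∀ e : ℂ, e ∈ slitPlane → Tendsto (fun T : ℝ => log (e + (-(c * w)) / (T : ℂ))) atTop
      (𝓝 (log e)) := by
    intro e he
    refine (continuousAt_clog he).tendsto.comp ?_
    have h1 : Tendsto (fun T : ℝ => ((T⁻¹ : ℝ) : ℂ)) atTop (𝓝 0) := by
      have := (continuous_ofReal.tendsto 0).comp (tendsto_inv_atTop_zero (𝕜 := ℝ))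
      rw [ofReal_zero] at this
      exact this
    have h2 := (h1.const_mul (-(c * w))).const_add e
    simpa [div_eq_mul_inv] using h2
  refine ((hlim c hcs.1).sub (hlim (-c) hcs.2)).congr' ?_
  filter_upwards [eventually_gt_atTop 0] with T hT
  have hT' : (T : ℂ) ≠ 0 := by exact_mod_cast hT.ne'
  have key : ∀ e : ℂ, ∀ t : ℝ, (T : ℂ) * e = c * t →
      log (c * (t - w)) = Real.log T + log (e + (-(c * w)) / (T : ℂ)) := by
    intro e t het
    have h1 : c * (t - w) = (T : ℂ) * (e + (-(c * w)) / (T : ℂ)) := by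
      rw [mul_add, het]; field_simp; ring
    have h2 : e + (-(c * w)) / (T : ℂ) ≠ 0 := by
      intro h
      rw [h, mul_zero] at h1
      have := hre t
      rw [h1] at this
      simp at this
    rw [h1, log_ofReal_mul hT h2]
  rw [hint, key c T (mul_comm _ _), key (-c) (-T) (by push_cast; ring)]
  ring

theorem tendsto_integral_line_of_lt {p : ℂ} {h : ℝ} (hp : h < p.im) :
    Tendsto (fun T : ℝ => ∫ t in (-T)..T, ((t : ℂ) + h * I - p)⁻¹) atTop (𝓝 (Real.pi * I)) := by
  have := tendsto_integral_line_aux (c := I) (w := p - h * I) (Or.inl rfl) (by simpa using hp)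
  rw [log_I, log_neg_I] at this
  convert! this using 2
  · simp only [sub_sub_eq_add_sub]
  · ring

theorem tendsto_integral_line_of_gt {p : ℂ} {h : ℝ} (hp : p.im < h) :
    Tendsto (fun T : ℝ => ∫ t in (-T)..T, ((t : ℂ) + h * I - p)⁻¹) atTop
      (𝓝 (-(Real.pi * I))) := by
  have := tendsto_integral_line_aux (c := -I) (w := p - h * I) (Or.inr rfl) (by simpa using hp)
  rw [neg_neg, log_I, log_neg_I] at this
  convert! this using 2
  · simp only [sub_sub_eq_add_sub]
  · ring

/-- The winding number of the cycle about `p` is the difference of the index integrals of the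
contour and of the line of return. -/
theorem returnIntegral_inv_sub {γ : ℝ → ℂ} {h₀ h₁ R : ℝ} (hγ : ContDiff ℝ 1 γ)
    (htail : ∀ t : ℝ, R ≤ |t| → γ t = t + h₀ * I) {p s s' : ℂ} (hR : |p.re| < R)
    (hp : HasIndexIntegral γ p s) (hph : p.im ≠ h₁)
    (hline : Tendsto (fun T : ℝ => ∫ t in (-T)..T, ((t : ℂ) + h₁ * I - p)⁻¹) atTop (𝓝 s')) :
    returnIntegral γ h₀ h₁ R R (fun x => (x - p)⁻¹) = s - s' := by
  have hR0 : 0 < R := (abs_nonneg _).trans_lt hR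
  have hne : ∀ x : ℂ, R ≤ |x.re| → x - p ≠ 0 := fun x hx h => by
    rw [sub_eq_zero.1 h] at hx; linarith
  have hvert : ∀ σ : ℝ, |σ| = 1 → Tendsto (fun T : ℝ =>
      I * ∫ y in h₀..h₁, (((σ * T : ℝ) : ℂ) + y * I - p)⁻¹) atTop (𝓝 0) := by
    intro σ hσ
    have hb : Tendsto (fun T : ℝ => (T - |p.re|)⁻¹ * |h₁ - h₀|) atTop (𝓝 0) := by
      have := (tendsto_inv_atTop_zero (𝕜 := ℝ)).comp
        (tendsto_atTop_add_const_right _ (-|p.re|) tendsto_id)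
      simpa [sub_eq_add_neg] using this.mul_const |h₁ - h₀|
    refine squeeze_zero_norm' ?_ hb
    filter_upwards [eventually_gt_atTop R] with T hT
    rw [norm_mul, norm_I, one_mul]
    refine intervalIntegral.norm_integral_le_of_norm_le_const fun y _ => ?_
    rw [norm_inv]
    have h1 : T - |p.re| ≤ ‖((σ * T : ℝ) : ℂ) + y * I - p‖ := by
      refine le_trans ?_ (abs_re_le_norm _)
      have h2 : (((σ * T : ℝ) : ℂ) + y * I - p).re = σ * T - p.re := by simp
      rw [h2]
      refine le_trans ?_ (abs_sub_abs_le_abs_sub _ _)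
      rw [abs_mul, hσ, one_mul, abs_of_pos (hR0.trans hT)]
    exact inv_anti₀ (by linarith) h1
  -- the integral over the cycle does not depend on its width
  have hconst : Tendsto (fun T : ℝ => returnIntegral γ h₀ h₁ T T (fun x => (x - p)⁻¹)) atTop
      (𝓝 (returnIntegral γ h₀ h₁ R R (fun x => (x - p)⁻¹))) := by
    refine tendsto_const_nhds.congr' ?_
    filter_upwards [eventually_gt_atTop R] with T hT
    refine (returnIntegral_eq hγ htail hT hT hR0 ?_ ?_ ?_).symm
    · exact DifferentiableOn.inv (by fun_prop) hne
    · refine ContinuousOn.inv₀ (by fun_prop) ?_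
      rintro _ ⟨t, -, rfl⟩ h
      exact hp.1 t (sub_eq_zero.1 h)
    · refine Continuous.inv₀ (by fun_prop) fun t h => hph ?_
      have := congrArg im h
      simp at this
      linarith
  refine tendsto_nhds_unique hconst ?_
  have h1 := hvert 1 (by simp)
  have h2 := hvert (-1) (by simp)
  have := ((hp.2.sub hline).add h1).sub h2
  simp only [add_zero, sub_zero] at this
  refine this.congr fun T => ?_
  rw [returnIntegral]
  simp only [one_mul, neg_one_mul, div_eq_inv_mul]

/-! ### The kernel of the Mellin-Barnes integral -/

/-- The quotient of Gamma functions in the integrand of the Mellin-Barnes integral, for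
angular momentum `N ≥ 0`. -/
def mellinKernel (β : ℂ) (N : ℕ) (ν : ℂ) : ℂ :=
  Gamma (((N : ℂ) + 1) / 2 - β + I * ν) * Gamma (((N : ℂ) + 1) / 2 - I * ν) /
    (Gamma (((N : ℂ) + 1) / 2 + β - I * ν) * Gamma (((N : ℂ) + 1) / 2 + I * ν))

/-- The integrand of the Mellin-Barnes integral with its spurious singularities removed. -/
def regIntegrand (L : ℕ) (β z : ℂ) (n : ℤ) (ν : ℂ) : ℂ :=
  mellinKernel β n.natAbs ν ^ (L + 1) * zPow z n ν

theorem mellinKernel_symm (β : ℂ) (N : ℕ) (ν : ℂ) :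
    mellinKernel β N (-I * β - ν) = mellinKernel β N ν := by
  have h : I * (-I * β - ν) = β - I * ν := by linear_combination (-β) * I_mul_I
  rw [mellinKernel, mellinKernel, h]
  ring_nf

theorem inv_Gamma_eq {u : ℂ} (h : Gamma (1 - u) ≠ 0) :
    (Gamma u)⁻¹ = Gamma (1 - u) * sin (Real.pi * u) / Real.pi := by
  have hpi : (Real.pi : ℂ) ≠ 0 := by exact_mod_cast Real.pi_ne_zero
  have key := Complex.Gamma_mul_Gamma_one_sub u
  by_cases hs : sin (Real.pi * u) = 0
  · rw [hs, div_zero] at key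
    rw [(mul_eq_zero.1 key).resolve_right h, hs]
    simp
  · have h0 : Gamma u ≠ 0 := fun h0 => by
      rw [h0, zero_mul, eq_comm, div_eq_zero_iff] at key
      tauto
    rw [eq_div_iff hs] at key
    rw [inv_eq_iff_eq_inv, inv_div, eq_div_iff (mul_ne_zero h hs)]
    linear_combination key

theorem Gamma_div_Gamma_eq {u v : ℂ} (hu : Gamma (1 - u) ≠ 0) (hv : Gamma (1 - v) ≠ 0) :
    Gamma u / Gamma v =
      sin (Real.pi * v) / sin (Real.pi * u) * (Gamma (1 - v) / Gamma (1 - u)) := by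
  have hpi : (Real.pi : ℂ) ≠ 0 := by exact_mod_cast Real.pi_ne_zero
  have h := inv_Gamma_eq hu
  rw [div_eq_mul_inv, inv_Gamma_eq hv, ← inv_inv (Gamma u), h]
  field_simp

/-- By the reflection formula the kernel is a product of two quotients `Γ(x - β) / Γ(x)`, whose
arguments move to the right as `Im ν → -∞`, and of a quotient of sines. -/
theorem mellinKernel_eq {β : ℂ} {N : ℕ} {ν : ℂ}
    (h1 : Gamma (1 - ((N : ℂ) + 1) / 2 + I * ν) ≠ 0)
    (h2 : Gamma (1 - ((N : ℂ) + 1) / 2 - β + I * ν) ≠ 0) :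
    mellinKernel β N ν =
      Gamma (((N : ℂ) + 1) / 2 + I * ν - β) / Gamma (((N : ℂ) + 1) / 2 + I * ν) *
      (Gamma (1 - ((N : ℂ) + 1) / 2 + I * ν - β) / Gamma (1 - ((N : ℂ) + 1) / 2 + I * ν)) *
      (sin (Real.pi * (((N : ℂ) + 1) / 2 - I * ν) + Real.pi * β) /
        sin (Real.pi * (((N : ℂ) + 1) / 2 - I * ν))) := by
  have e1 : 1 - (((N : ℂ) + 1) / 2 - I * ν) = 1 - ((N : ℂ) + 1) / 2 + I * ν := by ring
  have e2 : 1 - (((N : ℂ) + 1) / 2 + β - I * ν) = 1 - ((N : ℂ) + 1) / 2 - β + I * ν := by ring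
  have := Gamma_div_Gamma_eq (u := ((N : ℂ) + 1) / 2 - I * ν)
    (v := ((N : ℂ) + 1) / 2 + β - I * ν) (by rwa [e1]) (by rwa [e2])
  rw [mellinKernel, mul_comm (Gamma (((N : ℂ) + 1) / 2 + β - I * ν)), mul_div_mul_comm, this, e1,
    e2]
  ring_nf

theorem zPow_norm {z : ℂ} (hz : z ≠ 0) (n : ℤ) (ν : ℂ) : ‖zPow z n ν‖ = ‖z‖ ^ (-2 * ν.im) := by
  have hz' : 0 < ‖z‖ := norm_pos_iff.2 hz
  rw [zPow, norm_mul, norm_sqPow hz, norm_zpow, ← Real.rpow_intCast, ← Real.rpow_add hz']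
  congr 1
  have : ((n : ℂ) / 2).re = n / 2 := by
    rw [show (n : ℂ) / 2 = ((n / 2 : ℝ) : ℂ) by push_cast; rfl, ofReal_re]
  simp only [sub_re, mul_re, I_re, I_im, this]
  ring

theorem ne_neg_nat_of_im {x : ℂ} (hx : x.im ≠ 0) (m : ℕ) : x ≠ -m := by
  rintro rfl; simp at hx

/-- Decay of the kernel as `Re ν → ±∞`, uniformly in half-planes `Im ν ≤ h`. -/
theorem norm_mellinKernel_le {β : ℂ} {κ : ℝ} (hκ : 0 ≤ κ) (hκ1 : κ ≤ 1) (hb : κ < β.re) (N : ℕ)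
    (h : ℝ) : ∃ C : ℝ, 0 < C ∧ ∀ ν : ℂ, 1 + |β.im| ≤ |ν.re| → ν.im ≤ h →
      ‖mellinKernel β N ν‖ ≤ C * (|ν.re| - |β.im|) ^ (-(2 * κ)) := by
  obtain ⟨C₁, hC₁, h₁⟩ := norm_Gamma_sub_div_Gamma_le_im hκ hκ1 hb (-h - N)
  obtain ⟨C₂, hC₂, h₂⟩ := norm_sin_add_div_sin_le (Real.pi * β)
  refine ⟨C₁ * C₁ * C₂, by positivity, fun ν hν him => ?_⟩
  have hν0 : ν.re ≠ 0 := by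
    rintro h0; rw [h0, abs_zero] at hν; linarith [abs_nonneg β.im]
  have hN : (((N : ℂ) + 1) / 2) = (((N + 1) / 2 : ℝ) : ℂ) := by push_cast; rfl
  have him1 : (((N : ℂ) + 1) / 2 + I * ν).im = ν.re := by rw [hN]; simp
  have him2 : (1 - ((N : ℂ) + 1) / 2 + I * ν).im = ν.re := by rw [hN]; simp
  have hre1 : (((N : ℂ) + 1) / 2 + I * ν).re = (N + 1) / 2 - ν.im := by rw [hN]; simp; ring
  have hre2 : (1 - ((N : ℂ) + 1) / 2 + I * ν).re = 1 - (N + 1) / 2 - ν.im := by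
    rw [hN]; simp; ring
  have hdist : |ν.re| - |β.im| ≤ |ν.re - β.im| := abs_sub_abs_le_abs_sub _ _
  have h1le : 1 ≤ |ν.re - β.im| := by linarith
  rw [mellinKernel_eq (Gamma_ne_zero (ne_neg_nat_of_im (by rwa [him2])))
    (Gamma_ne_zero (ne_neg_nat_of_im (by
      rw [show 1 - ((N : ℂ) + 1) / 2 - β + I * ν = (1 - ((N : ℂ) + 1) / 2 + I * ν) - β by ring,
        sub_im, him2]
      intro h0; rw [h0, abs_zero] at h1le; linarith))), norm_mul, norm_mul]
  have hN0 : (0 : ℝ) ≤ N := N.cast_nonneg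
  have b1 := h₁ (((N : ℂ) + 1) / 2 + I * ν) (by rw [hre1]; linarith)
    (by rwa [sub_im, him1]) (by rwa [him1])
  have b2 := h₁ (1 - ((N : ℂ) + 1) / 2 + I * ν) (by rw [hre2]; linarith)
    (by rwa [sub_im, him2]) (by rwa [him2])
  rw [sub_im, him1] at b1
  rw [sub_im, him2] at b2
  have b3 := h₂ (Real.pi * (((N : ℂ) + 1) / 2 - I * ν)) (Or.inl (by
    have : ((Real.pi : ℂ) * (((N : ℂ) + 1) / 2 - I * ν)).im = -(Real.pi * ν.re) := by
      rw [hN]; simp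
    rw [this, abs_neg, abs_mul, abs_of_pos Real.pi_pos]
    nlinarith [Real.pi_gt_three, abs_nonneg β.im]))
  have hmono : |ν.re - β.im| ^ (-κ) ≤ (|ν.re| - |β.im|) ^ (-κ) :=
    Real.rpow_le_rpow_of_nonpos (by linarith) hdist (by linarith)
  have hsq : (|ν.re| - |β.im|) ^ (-(2 * κ)) =
      (|ν.re| - |β.im|) ^ (-κ) * (|ν.re| - |β.im|) ^ (-κ) := by
    rw [← Real.rpow_add (by linarith)]; ring_nf
  have hp : 0 ≤ |ν.re - β.im| ^ (-κ) := by positivity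
  rw [hsq]
  have hp' : 0 ≤ (|ν.re| - |β.im|) ^ (-κ) := hp.trans hmono
  calc _ ≤ (C₁ * |ν.re - β.im| ^ (-κ)) * (C₁ * |ν.re - β.im| ^ (-κ)) * C₂ := by gcongr
    _ ≤ (C₁ * (|ν.re| - |β.im|) ^ (-κ)) * (C₁ * (|ν.re| - |β.im|) ^ (-κ)) * C₂ := by gcongr
    _ = _ := by ring

/-- The kernel is bounded on the lines half-way between consecutive lower poles. -/
theorem norm_mellinKernel_le_line {β : ℂ} (hb : 0 < β.re) (N : ℕ) : ∃ C : ℝ, 0 < C ∧ ∃ K₀ : ℕ,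
    ∀ K : ℕ, K₀ ≤ K → ∀ ν : ℂ, ν.im = -(((N : ℝ) + 1) / 2 + K - 1 / 2) →
      ‖mellinKernel β N ν‖ ≤ C := by
  obtain ⟨C₁, hC₁, h₁⟩ := norm_Gamma_sub_div_Gamma_le le_rfl zero_le_one hb
  obtain ⟨C₂, hC₂, h₂⟩ := norm_sin_add_div_sin_le (Real.pi * β)
  obtain ⟨K₀, hK₀⟩ := exists_nat_ge (β.re + 1)
  refine ⟨C₁ * C₁ * C₂, by positivity, K₀, fun K hK ν hν => ?_⟩
  have hK' : β.re + 1 ≤ K := hK₀.trans (by exact_mod_cast hK)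
  have hN : (((N : ℂ) + 1) / 2) = (((N + 1) / 2 : ℝ) : ℂ) := by push_cast; rfl
  have hN0 : (0 : ℝ) ≤ N := N.cast_nonneg
  have hre1 : (((N : ℂ) + 1) / 2 + I * ν).re = (N + 1) / 2 - ν.im := by rw [hN]; simp; ring
  have hre2 : (1 - ((N : ℂ) + 1) / 2 + I * ν).re = 1 / 2 + K := by
    rw [hN]; simp [hν]; ring
  have hre3 : (1 - ((N : ℂ) + 1) / 2 - β + I * ν).re = 1 / 2 + K - β.re := by
    rw [show 1 - ((N : ℂ) + 1) / 2 - β + I * ν = (1 - ((N : ℂ) + 1) / 2 + I * ν) - β by ring,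
      sub_re, hre2]
  rw [mellinKernel_eq (Gamma_ne_zero_of_re_pos (by rw [hre2]; linarith))
    (Gamma_ne_zero_of_re_pos (by rw [hre3]; linarith)), norm_mul, norm_mul]
  have b1 := h₁ (((N : ℂ) + 1) / 2 + I * ν) (by rw [hre1, hν]; linarith)
  have b2 := h₁ (1 - ((N : ℂ) + 1) / 2 + I * ν) (by rw [hre2]; linarith)
  simp only [neg_zero, Real.rpow_zero, mul_one] at b1 b2
  have b3 := h₂ (Real.pi * (((N : ℂ) + 1) / 2 - I * ν)) (Or.inr (by
    have : ((Real.pi : ℂ) * (((N : ℂ) + 1) / 2 - I * ν)).re = Real.pi / 2 - K * Real.pi := by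
      rw [hN]; simp [hν]; ring
    rw [this, Real.cos_sub_nat_mul_pi, Real.cos_pi_div_two, mul_zero]))
  gcongr

/-! ### Residues at the lower poles -/

theorem Gamma_add_natCast {a : ℂ} (m : ℕ) (h : ∀ j < m, a + j ≠ 0) :
    Gamma (a + m) = Gamma a * ∏ j ∈ Finset.range m, (a + j) := by
  induction m with
  | zero => simp
  | succ m ih =>
    rw [Finset.prod_range_succ, ← mul_assoc, ← ih fun j hj => h j (by omega), Nat.cast_succ,
      ← add_assoc, Gamma_add_one _ (h m (by omega)), mul_comm]

/-- The set of all poles of the `n`-th integrand. -/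
def poles (β : ℂ) (n : ℤ) : Set ℂ := Set.range (upperPole β n) ∪ Set.range (lowerPole n)

theorem upper_factor (β : ℂ) (n : ℤ) (x : ℂ) (j : ℕ) :
    ((n.natAbs : ℂ) + 1) / 2 - β + I * x + j = I * (x - upperPole β n j) := by
  rw [upperPole]
  linear_combination (((n.natAbs : ℂ) + 1) / 2 - β + j) * I_mul_I

theorem lower_factor (n : ℤ) (x : ℂ) (j : ℕ) :
    ((n.natAbs : ℂ) + 1) / 2 - I * x + j = -I * (x - lowerPole n j) := by
  rw [lowerPole]
  linear_combination (((n.natAbs : ℂ) + 1) / 2 + j) * I_mul_I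

theorem upper_ne {β : ℂ} {n : ℤ} {x : ℂ} (hx : x ∉ poles β n) (j : ℕ) :
    ((n.natAbs : ℂ) + 1) / 2 - β + I * x + j ≠ 0 := by
  rw [upper_factor]
  exact mul_ne_zero I_ne_zero (sub_ne_zero.2 fun h => hx (Or.inl ⟨j, h.symm⟩))

theorem lower_ne {β : ℂ} {n : ℤ} {x : ℂ} (hx : x ∉ poles β n) (j : ℕ) :
    ((n.natAbs : ℂ) + 1) / 2 - I * x + j ≠ 0 := by
  rw [lower_factor]
  exact mul_ne_zero (neg_ne_zero.2 I_ne_zero) (sub_ne_zero.2 fun h => hx (Or.inr ⟨j, h.symm⟩))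

/-- The integrand with the first `m` poles of either series removed. -/
def numerator (L : ℕ) (β z : ℂ) (n : ℤ) (m : ℕ) (x : ℂ) : ℂ :=
  (Gamma (((n.natAbs : ℂ) + 1) / 2 - β + I * x + m) * Gamma (((n.natAbs : ℂ) + 1) / 2 - I * x + m) *
    ((Gamma (((n.natAbs : ℂ) + 1) / 2 + β - I * x))⁻¹ *
      (Gamma (((n.natAbs : ℂ) + 1) / 2 + I * x))⁻¹)) ^ (L + 1) * zPow z n x

/-- The first `m` poles of either series, with their multiplicity. -/
def poleMultiset (L : ℕ) (β : ℂ) (n : ℤ) (m : ℕ) : Multiset ℂ :=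
  (L + 1) • ((Multiset.range m).map (upperPole β n) + (Multiset.range m).map (lowerPole n))

theorem mem_poles_of_mem_poleMultiset {L : ℕ} {β : ℂ} {n : ℤ} {m : ℕ} {p : ℂ}
    (hp : p ∈ poleMultiset L β n m) : p ∈ poles β n := by
  have h := Multiset.mem_of_mem_nsmul hp
  rw [Multiset.mem_add, Multiset.mem_map, Multiset.mem_map] at h
  rcases h with ⟨j, -, rfl⟩ | ⟨j, -, rfl⟩
  exacts [Or.inl ⟨j, rfl⟩, Or.inr ⟨j, rfl⟩]

theorem regIntegrand_eq_numerator (L : ℕ) (β z : ℂ) (n : ℤ) (m : ℕ) {x : ℂ}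
    (hx : x ∉ poles β n) : regIntegrand L β z n x =
      numerator L β z n m x * ((poleMultiset L β n m).map fun p => (x - p)⁻¹).prod := by
  have hu : ∀ j, x - upperPole β n j ≠ 0 := fun j => sub_ne_zero.2 fun h => hx (Or.inl ⟨j, h.symm⟩)
  have hl : ∀ j, x - lowerPole n j ≠ 0 := fun j => sub_ne_zero.2 fun h => hx (Or.inr ⟨j, h.symm⟩)
  have h3 : (∏ j ∈ Finset.range m, (((n.natAbs : ℂ) + 1) / 2 - β + I * x + j)) *
      (∏ j ∈ Finset.range m, (((n.natAbs : ℂ) + 1) / 2 - I * x + j)) *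
      ((∏ j ∈ Finset.range m, (x - upperPole β n j)⁻¹) *
        ∏ j ∈ Finset.range m, (x - lowerPole n j)⁻¹) = 1 := by
    rw [← Finset.prod_mul_distrib, ← Finset.prod_mul_distrib, ← Finset.prod_mul_distrib]
    refine Finset.prod_eq_one fun j _ => ?_
    rw [upper_factor, lower_factor]
    have := hu j
    have := hl j
    field_simp
    simp
  have hprod : ((poleMultiset L β n m).map fun p => (x - p)⁻¹).prod =
      ((∏ j ∈ Finset.range m, (x - upperPole β n j)⁻¹) *
        ∏ j ∈ Finset.range m, (x - lowerPole n j)⁻¹) ^ (L + 1) := by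
    rw [poleMultiset, Multiset.map_nsmul, Multiset.prod_nsmul, Multiset.map_add, Multiset.prod_add,
      Multiset.map_map, Multiset.map_map]
    rfl
  rw [hprod, numerator, regIntegrand, mellinKernel, Gamma_add_natCast m fun j _ => upper_ne hx j,
    Gamma_add_natCast m fun j _ => lower_ne hx j, mul_right_comm, ← mul_pow, div_eq_mul_inv,
    mul_inv]
  congr 2
  linear_combination (-(Gamma (((n.natAbs : ℂ) + 1) / 2 - β + I * x) *
    Gamma (((n.natAbs : ℂ) + 1) / 2 - I * x) *
    ((Gamma (((n.natAbs : ℂ) + 1) / 2 + β - I * x))⁻¹ *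
      (Gamma (((n.natAbs : ℂ) + 1) / 2 + I * x))⁻¹))) * h3

theorem differentiable_zPow {z : ℂ} (hz : z ≠ 0) (n : ℤ) : Differentiable ℂ (zPow z n) := by
  unfold zPow
  exact (((differentiable_sqPow hz).comp (f := fun ν => I * ν - (n : ℂ) / 2)
    (by fun_prop))).mul_const _

theorem differentiableAt_gammaFactors (β : ℂ) (N : ℕ) (x : ℂ) :
    DifferentiableAt ℂ (fun x => (Gamma (((N : ℂ) + 1) / 2 + β - I * x))⁻¹ *
      (Gamma (((N : ℂ) + 1) / 2 + I * x))⁻¹) x :=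
  (((differentiable_one_div_Gamma _).comp x (f := fun x => ((N : ℂ) + 1) / 2 + β - I * x)
    (by fun_prop))).mul ((differentiable_one_div_Gamma _).comp x
    (f := fun x => ((N : ℂ) + 1) / 2 + I * x) (by fun_prop))

theorem differentiableAt_numerator {L : ℕ} {β z : ℂ} {n : ℤ} {m : ℕ} {x : ℂ} (hz : z ≠ 0)
    (h1 : ∀ j : ℕ, ((n.natAbs : ℂ) + 1) / 2 - β + I * x + m ≠ -j)
    (h2 : ∀ j : ℕ, ((n.natAbs : ℂ) + 1) / 2 - I * x + m ≠ -j) :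
    DifferentiableAt ℂ (numerator L β z n m) x := by
  unfold numerator
  refine DifferentiableAt.mul (DifferentiableAt.pow (DifferentiableAt.mul ?_
    (differentiableAt_gammaFactors β n.natAbs x)) _) (differentiable_zPow hz n x)
  exact ((differentiableAt_Gamma _ h1).comp x
    (f := fun x => ((n.natAbs : ℂ) + 1) / 2 - β + I * x + m) (by fun_prop)).mul
    ((differentiableAt_Gamma _ h2).comp x
    (f := fun x => ((n.natAbs : ℂ) + 1) / 2 - I * x + m) (by fun_prop))

theorem numerator_zero (L : ℕ) (β z : ℂ) (n : ℤ) :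
    numerator L β z n 0 = regIntegrand L β z n := by
  ext x
  rw [numerator, regIntegrand, mellinKernel, div_eq_mul_inv (Gamma _ * Gamma _), mul_inv,
    Nat.cast_zero, add_zero, add_zero]

theorem differentiableAt_regIntegrand {L : ℕ} {β z : ℂ} {n : ℤ} {x : ℂ} (hz : z ≠ 0)
    (hx : x ∉ poles β n) : DifferentiableAt ℂ (regIntegrand L β z n) x := by
  rw [← numerator_zero]
  refine differentiableAt_numerator hz (fun j h => upper_ne hx j ?_) (fun j h => lower_ne hx j ?_)
  · rw [Nat.cast_zero, add_zero] at h; rw [h]; ring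
  · rw [Nat.cast_zero, add_zero] at h; rw [h]; ring

theorem exists_differentiableOn_numerator (L : ℕ) (β : ℂ) {z : ℂ} (hz : z ≠ 0) (n : ℤ) (r : ℝ) :
    ∃ m : ℕ, DifferentiableOn ℂ (numerator L β z n m) (Metric.ball 0 r) := by
  obtain ⟨m, hm⟩ := exists_nat_gt (r + |β.re|)
  refine ⟨m, fun x hx => (differentiableAt_numerator hz ?_ ?_).differentiableWithinAt⟩ <;>
  · intro j h
    have h' := congrArg re h
    rw [mem_ball_zero_iff] at hx
    have := (abs_le.1 ((abs_im_le_norm x).trans hx.le))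
    have hN : (((n.natAbs : ℂ) + 1) / 2) = (((n.natAbs + 1) / 2 : ℝ) : ℂ) := by push_cast; rfl
    have hN0 : (0 : ℝ) ≤ n.natAbs := Nat.cast_nonneg _
    have hj0 : (0 : ℝ) ≤ j := Nat.cast_nonneg _
    rw [hN] at h'
    simp only [add_re, sub_re, ofReal_re, mul_re, I_re, I_im, natCast_re, neg_re] at h'
    have := le_abs_self β.re
    have := abs_nonneg β.re
    linarith

theorem sin_pi_mul_sub_nat (x : ℂ) (k : ℕ) :
    sin (Real.pi * (x - k)) = (-1) ^ k * sin (Real.pi * x) := by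
  rw [mul_sub, mul_comm (Real.pi : ℂ) (k : ℂ), Complex.sin_antiperiodic.sub_nat_mul_eq]

/-- The integrand near the `k`-th lower pole, in terms of the coefficients of the power series. In
the coordinate `ε = -i (ν - lowerPole n k)` the two quotients of Gamma functions are the
coefficients with indices `k + |n|` and `k`. -/
theorem regIntegrand_lowerPole {L : ℕ} {β z : ℂ} {δ : ℝ} (h : IsGoodRadius β δ) (hz : z ≠ 0)
    (n : ℤ) (k : ℕ) {ε : ℂ} (hε : ‖ε‖ = δ) :
    regIntegrand L β z n (lowerPole n k + I * ε) =
      prefactor L β z ε * coef L β ε (k + n.toNat) * coef L β ε (k + (-n).toNat) / ε ^ (L + 1) *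
        (z ^ (k + n.toNat) * conj z ^ (k + (-n).toNat)) := by
  have hδ := h.1
  have h8 := h.2.1
  have hgen := h.mem_genericIndex (ε := ε) (by linarith)
  have hε0 : ε ≠ 0 := norm_pos_iff.1 (by linarith)
  have hεgen : ε ∈ genericIndex := mem_genericIndex_of_re_lt_one
    (lt_of_le_of_lt (re_le_norm ε) (by linarith))
  have hs : I * (lowerPole n k + I * ε) = ((n.natAbs : ℂ) + 1) / 2 + k - ε := by
    rw [lowerPole]
    linear_combination (-(((n.natAbs : ℂ) + 1) / 2 + k) + ε) * I_mul_I
  -- the quotient of Gamma functions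
  have hk : mellinKernel β n.natAbs (lowerPole n k + I * ε) =
      Gamma (1 - β + (k + n.natAbs : ℕ) - ε) / Gamma (1 + (k + n.natAbs : ℕ) - ε) *
      (Gamma (1 - β + k - ε) / Gamma (1 + k - ε)) *
      (sin (Real.pi * (β + ε)) / sin (Real.pi * ε)) := by
    have g1 : Gamma (1 - (-k + ε)) ≠ 0 := by
      have := Gamma_one_sub_ne_zero hεgen k
      rwa [show (1 - (-k + ε) : ℂ) = 1 - ε + k by ring]
    have g2 : Gamma (1 - (β - k + ε)) ≠ 0 := by
      have := Gamma_one_sub_ne_zero hgen k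
      rwa [show (1 - (β - k + ε) : ℂ) = 1 - (β + ε) + k by ring]
    have hr := Gamma_div_Gamma_eq g1 g2
    rw [show (-k + ε : ℂ) = ε - k by ring, show (β - k + ε : ℂ) = (β + ε) - k by ring,
      sin_pi_mul_sub_nat, sin_pi_mul_sub_nat, mul_div_mul_left _ _ (by simp)] at hr
    rw [mellinKernel, hs]
    rw [show ((n.natAbs : ℂ) + 1) / 2 - β + (((n.natAbs : ℂ) + 1) / 2 + k - ε) =
        1 - β + (k + n.natAbs : ℕ) - ε by push_cast; ring,
      show ((n.natAbs : ℂ) + 1) / 2 + (((n.natAbs : ℂ) + 1) / 2 + k - ε) =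
        1 + (k + n.natAbs : ℕ) - ε by push_cast; ring,
      show ((n.natAbs : ℂ) + 1) / 2 - (((n.natAbs : ℂ) + 1) / 2 + k - ε) = ε - k by ring,
      show ((n.natAbs : ℂ) + 1) / 2 + β - (((n.natAbs : ℂ) + 1) / 2 + k - ε) =
        β + ε - k by ring, mul_comm (Gamma (β + ε - k)), mul_div_mul_comm, hr,
      show (1 - (β + ε - k) : ℂ) = 1 - β + k - ε by ring,
      show (1 - (ε - k) : ℂ) = 1 + k - ε by ring]
    ring
  have hcoef : coef L β ε (k + n.natAbs) * coef L β ε k =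
      coef L β ε (k + n.toNat) * coef L β ε (k + (-n).toNat) := by
    rcases le_total 0 n with hn | hn
    · rw [show (-n).toNat = 0 by omega, show n.natAbs = n.toNat by omega, add_zero]
    · rw [show n.toNat = 0 by omega, show n.natAbs = (-n).toNat by omega, add_zero, mul_comm]
  -- the power of `z`
  have hzp : zPow z n (lowerPole n k + I * ε) =
      sqPow z (1 / 2 - ε) * (z ^ (k + n.toNat) * conj z ^ (k + (-n).toNat)) := by
    have hN : (n.natAbs : ℂ) = n + 2 * ((-n).toNat : ℂ) := by
      have : (n.natAbs : ℤ) = n + 2 * ((-n).toNat : ℤ) := by omega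
      rw [← Int.cast_natCast n.natAbs, this]; push_cast; rfl
    rw [zPow, hs, hN, show (n + 2 * ((-n).toNat : ℂ) + 1) / 2 + k - ε - n / 2 =
      (1 / 2 - ε) + ((k + (-n).toNat : ℕ) : ℂ) by push_cast; ring, sqPow_add hz, sqPow_natCast,
      mul_assoc, mul_right_comm (z ^ _), ← zpow_natCast z, ← zpow_natCast z, ← zpow_add₀ hz]
    congr 4
    omega
  rw [regIntegrand, hk, hzp, prefactor, Gamma_mul_Gamma_div_pi hε0]
  have hc1 : (Gamma (1 - β + (k + n.natAbs : ℕ) - ε) / Gamma (1 + (k + n.natAbs : ℕ) - ε) *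
      (Gamma (1 - β + k - ε) / Gamma (1 + k - ε)) *
      (sin (Real.pi * (β + ε)) / sin (Real.pi * ε))) ^ (L + 1) =
      coef L β ε (k + n.toNat) * coef L β ε (k + (-n).toNat) *
        (sin (Real.pi * (β + ε)) / sin (Real.pi * ε)) ^ (L + 1) := by
    rw [mul_pow, mul_pow, ← hcoef, coef, coef]
  rw [hc1, div_pow, div_pow]
  have := pow_ne_zero (L + 1) hε0
  field_simp

theorem lowerPole_im (n : ℤ) (k : ℕ) :
    (lowerPole n k).im = -(((n.natAbs : ℝ) + 1) / 2 + k) := by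
  rw [lowerPole, show -I * ((((n.natAbs : ℂ) + 1) / 2) + k) =
    -((((n.natAbs + 1) / 2 + k : ℝ) : ℂ) * I) by push_cast; ring]
  simp

theorem lowerPole_re (n : ℤ) (k : ℕ) : (lowerPole n k).re = 0 := by
  rw [lowerPole, show -I * ((((n.natAbs : ℂ) + 1) / 2) + k) =
    -((((n.natAbs + 1) / 2 + k : ℝ) : ℂ) * I) by push_cast; ring]
  simp

theorem upperPole_im (β : ℂ) (n : ℤ) (k : ℕ) :
    (upperPole β n k).im = ((n.natAbs : ℝ) + 1) / 2 - β.re + k := by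
  rw [upperPole, show I * ((((n.natAbs : ℂ) + 1) / 2) - β + k) =
    (((n.natAbs + 1) / 2 + k : ℝ) : ℂ) * I - I * β by push_cast; ring]
  simp; ring

theorem upperPole_re (β : ℂ) (n : ℤ) (k : ℕ) : (upperPole β n k).re = β.im := by
  rw [upperPole, show I * ((((n.natAbs : ℂ) + 1) / 2) - β + k) =
    (((n.natAbs + 1) / 2 + k : ℝ) : ℂ) * I - I * β by push_cast; ring]
  simp

theorem lowerPole_add_ne {n : ℤ} {k j : ℕ} {β ε : ℂ} {δ : ℝ} (h : IsGoodRadius β δ)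
    (hε : ‖ε‖ ≤ δ) (hjk : j = k → ε ≠ 0) : lowerPole n k + I * ε ≠ lowerPole n j := by
  intro he
  have h1 : ε = (k : ℂ) - j := by
    rw [lowerPole, lowerPole] at he
    have : I * (ε - (k - j)) = 0 := by linear_combination he
    exact sub_eq_zero.1 ((mul_eq_zero.1 this).resolve_left I_ne_zero)
  by_cases hj : j = k
  · exact hjk hj (by rw [h1, hj, sub_self])
  · have h2 : (1 : ℝ) ≤ ‖ε‖ := by
      have h3 : ((k : ℂ) - j) = (((k : ℤ) - j : ℤ) : ℂ) := by push_cast; rfl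
      rw [h1, h3, norm_intCast]
      have : (1 : ℤ) ≤ |(k : ℤ) - j| := Int.one_le_abs (by omega)
      exact_mod_cast this
    linarith [h.1, h.2.1]

theorem lowerPole_add_ne_upperPole {n : ℤ} {k j : ℕ} {β ε : ℂ} {δ : ℝ} (h : IsGoodRadius β δ)
    (hε : ‖ε‖ ≤ δ) : lowerPole n k + I * ε ≠ upperPole β n j := by
  intro he
  refine h.mem_genericIndex (ε := ε) (by linarith [h.1]) (n.natAbs + k + j) ?_
  rw [lowerPole, upperPole] at he
  have : I * (β + ε - ((n.natAbs + k + j : ℕ) + 1)) = 0 := by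
    push_cast
    linear_combination he
  exact sub_eq_zero.1 ((mul_eq_zero.1 this).resolve_left I_ne_zero)

theorem circle_curve_contDiff (c : ℂ) (δ : ℝ) :
    ContDiff ℝ 1 fun t => c + I * circleMap 0 δ t := by
  have := contDiff_circleMap (n := 1) 0 δ
  fun_prop

theorem pathIntegral_circle (f : ℂ → ℂ) (c : ℂ) (δ : ℝ) :
    pathIntegral f (fun t => c + I * circleMap 0 δ t) 0 (2 * Real.pi) =
      I * ∮ ε in C(0, δ), f (c + I * ε) := by
  rw [pathIntegral, circleIntegral, ← intervalIntegral.integral_const_mul]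
  refine intervalIntegral.integral_congr fun t _ => ?_
  have := ((hasDerivAt_circleMap 0 δ t).const_mul I).const_add c
  simp only [this.deriv, deriv_circleMap, smul_eq_mul]
  ring

theorem circleIntegral_inv_add {c p : ℂ} {δ : ℝ} (hδ : 0 < δ)
    (hp : ∀ ε : ℂ, ‖ε‖ ≤ δ → c + I * ε ≠ p) :
    I * (∮ ε in C(0, δ), (c + I * ε - p)⁻¹) = 0 := by
  have : (∮ ε in C(0, δ), (c + I * ε - p)⁻¹) = 0 := by
    refine DiffContOnCl.circleIntegral_eq_zero hδ.le
      (DifferentiableOn.diffContOnCl fun ε hε => DifferentiableAt.differentiableWithinAt ?_)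
    have hε' : ‖ε‖ ≤ δ := by
      have := (closure_minimal Metric.ball_subset_closedBall Metric.isClosed_closedBall) hε
      simpa using this
    have hne : c + I * ε - p ≠ 0 := sub_ne_zero.2 (hp ε hε')
    exact DifferentiableAt.fun_inv (by fun_prop) hne
  rw [this, mul_zero]

theorem circleIntegral_inv_self (c : ℂ) {δ : ℝ} (hδ : 0 < δ) :
    I * (∮ ε in C(0, δ), (c + I * ε - c)⁻¹) = 2 * Real.pi * I := by
  have h := circleIntegral.integral_sub_center_inv 0 hδ.ne'
  have : (∮ ε in C(0, δ), (c + I * ε - c)⁻¹) = ∮ ε in C(0, δ), I⁻¹ * (ε - 0)⁻¹ := by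
    simp only [add_sub_cancel_left, mul_inv, sub_zero]
  rw [this, circleIntegral.integral_const_mul, h, ← mul_assoc, mul_inv_cancel₀ I_ne_zero, one_mul]

/-! ### Closing the contour -/

/-- The curves of the cycle made of a contour, its line of return and `K` small circles. -/
def cycleCurve (γ : ℝ → ℂ) (n : ℤ) (h₁ R δ : ℝ) (K : ℕ) : Fin 4 ⊕ Fin K → ℝ → ℂ :=
  Sum.elim ![γ, fun t => (t : ℂ) + h₁ * I, fun y => (R : ℂ) + y * I,
    fun y => ((-R : ℝ) : ℂ) + y * I] fun k t => lowerPole n k + I * circleMap 0 δ t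

/-- The initial parameters of the curves of the cycle. -/
def cycleStart (h₀ R : ℝ) (K : ℕ) : Fin 4 ⊕ Fin K → ℝ := Sum.elim ![-R, -R, h₀, h₀] fun _ => 0

/-- The final parameters of the curves of the cycle. -/
def cycleEnd (h₁ R : ℝ) (K : ℕ) : Fin 4 ⊕ Fin K → ℝ :=
  Sum.elim ![R, R, h₁, h₁] fun _ => 2 * Real.pi

/-- The coefficients of the curves of the cycle. -/
def cycleCoeff (K : ℕ) : Fin 4 ⊕ Fin K → ℂ := Sum.elim ![1, -1, 1, -1] fun _ => 1

theorem deriv_vertical (c : ℂ) (t : ℝ) : deriv (fun t : ℝ => c + t * I) t = I := by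
  simpa using (((hasDerivAt_id t).ofReal_comp.mul_const I).const_add c).deriv

theorem chainIntegral_cycle (γ : ℝ → ℂ) (n : ℤ) (h₀ h₁ R δ : ℝ) (K : ℕ) (f : ℂ → ℂ) :
    chainIntegral (cycleCoeff K) (cycleCurve γ n h₁ R δ K) (cycleStart h₀ R K) (cycleEnd h₁ R K) f =
      returnIntegral γ h₀ h₁ R R f +
        ∑ k ∈ Finset.range K, I * ∮ ε in C(0, δ), f (lowerPole n k + I * ε) := by
  rw [chainIntegral, Fintype.sum_sum_type, Fin.sum_univ_four, Finset.sum_range]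
  congr 1
  · have e1 : pathIntegral f γ (-R) R = ∫ t in (-R)..R, f (γ t) * deriv γ t := rfl
    have e2 : pathIntegral f (fun t => (t : ℂ) + h₁ * I) (-R) R =
        ∫ t in (-R)..R, f (t + h₁ * I) := by
      simp only [pathIntegral, deriv_horizontal, mul_one]
    have e3 : ∀ c : ℂ, pathIntegral f (fun y => c + y * I) h₀ h₁ =
        I * ∫ y in h₀..h₁, f (c + y * I) := by
      intro c
      simp only [pathIntegral, deriv_vertical, intervalIntegral.integral_mul_const]
      ring
    simp only [cycleCoeff, cycleCurve, cycleStart, cycleEnd, Sum.elim_inl, Matrix.cons_val_zero,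
      Matrix.cons_val_one, Matrix.cons_val, e1, e2, e3, returnIntegral]
    ring
  · refine Finset.sum_congr rfl fun k _ => ?_
    simp only [cycleCoeff, cycleCurve, cycleStart, cycleEnd, Sum.elim_inr, one_mul,
      pathIntegral_circle]

theorem contDiff_cycleCurve {γ : ℝ → ℂ} (hγ : ContDiff ℝ 1 γ) (n : ℤ) (h₁ R δ : ℝ) (K : ℕ)
    (i : Fin 4 ⊕ Fin K) : ContDiff ℝ 1 (cycleCurve γ n h₁ R δ K i) := by
  have hre : ContDiff ℝ 1 fun t : ℝ => (t : ℂ) := ofRealCLM.contDiff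
  rcases i with i | k
  · fin_cases i
    · exact hγ
    · exact hre.add contDiff_const
    · exact contDiff_const.add (hre.mul contDiff_const)
    · exact contDiff_const.add (hre.mul contDiff_const)
  · exact circle_curve_contDiff _ _

/-- The cycle made of a separating contour, its line of return and the circles about the lower
poles between them has winding number zero about every pole; hence the integral over the contour
and its line of return is a sum of residues. -/
theorem returnIntegral_regIntegrand {L : ℕ} {β z : ℂ} {δ : ℝ} (hgood : IsGoodRadius β δ)
    (hz : z ≠ 0) {n : ℤ} {γ : ℝ → ℂ} (hγ : ContDiff ℝ 1 γ) {h₀ R : ℝ}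
    (htail : ∀ t : ℝ, R ≤ |t| → γ t = t + h₀ * I) (hR : |β.im| < R)
    (hup : ∀ k, HasIndexIntegral γ (upperPole β n k) (Real.pi * I))
    (hlow : ∀ k, HasIndexIntegral γ (lowerPole n k) (-(Real.pi * I))) {K : ℕ}
    (hK : β.re + 1 ≤ K) :
    returnIntegral γ h₀ (-(((n.natAbs : ℝ) + 1) / 2 + K - 1 / 2)) R R (regIntegrand L β z n) =
      ∑ k ∈ Finset.range K, residueTerm L β z δ (k + n.toNat) (k + (-n).toNat) := by
  set h₁ : ℝ := -(((n.natAbs : ℝ) + 1) / 2 + K - 1 / 2) with hh₁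
  have hR0 : 0 < R := (abs_nonneg _).trans_lt hR
  have hδ := hgood.1
  have hN0 : (0 : ℝ) ≤ n.natAbs := Nat.cast_nonneg _
  have hnorm : ∀ θ, ‖circleMap 0 δ θ‖ = δ := fun θ => by simp [abs_of_pos hδ]
  have hpre : ∀ p ∈ poles β n, |p.re| < R := by
    rintro _ (⟨j, rfl⟩ | ⟨j, rfl⟩)
    · rwa [upperPole_re]
    · rwa [lowerPole_re, abs_zero]
  have hpim : ∀ p ∈ poles β n, p.im ≠ h₁ := by
    rintro _ (⟨j, rfl⟩ | ⟨j, rfl⟩) h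
    · rw [upperPole_im] at h
      have : (0 : ℝ) ≤ j := Nat.cast_nonneg _
      linarith
    · rw [lowerPole_im, hh₁] at h
      have h2 : (2 * j + 1 : ℝ) = 2 * K := by linarith
      have h3 : 2 * j + 1 = 2 * K := by exact_mod_cast h2
      omega
  have hpγ : ∀ p ∈ poles β n, ∀ t, γ t ≠ p := by
    rintro _ (⟨j, rfl⟩ | ⟨j, rfl⟩)
    exacts [(hup j).1, (hlow j).1]
  have hpc : ∀ p ∈ poles β n, ∀ (k : ℕ) (ε : ℂ), ‖ε‖ = δ → lowerPole n k + I * ε ≠ p := by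
    rintro _ (⟨j, rfl⟩ | ⟨j, rfl⟩) k ε hε
    · exact lowerPole_add_ne_upperPole hgood hε.le
    · exact lowerPole_add_ne hgood hε.le fun _ => norm_pos_iff.1 (by rw [hε]; exact hδ)
  have hg := contDiff_cycleCurve hγ n h₁ R δ K
  have hP : ∀ p ∈ poles β n,
      p ∉ chainSupport (cycleCurve γ n h₁ R δ K) (cycleStart h₀ R K) (cycleEnd h₁ R K) := by
    intro p hp hmem
    obtain ⟨i, t, -, ht⟩ := Set.mem_iUnion.1 hmem
    rcases i with i | k
    · fin_cases i
      · exact hpγ p hp t ht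
      · refine hpim p hp ?_
        rw [← ht]; simp [cycleCurve]
      · have h1 := hpre p hp
        have : p.re = R := by rw [← ht]; simp [cycleCurve]
        rw [this, abs_of_pos hR0] at h1
        exact lt_irrefl _ h1
      · have h1 := hpre p hp
        have : p.re = -R := by rw [← ht]; simp [cycleCurve]
        rw [this, abs_neg, abs_of_pos hR0] at h1
        exact lt_irrefl _ h1
    · exact hpc p hp k _ (hnorm t) ht
  obtain ⟨r, hr⟩ : ∃ r, chainSupport (cycleCurve γ n h₁ R δ K) (cycleStart h₀ R K)
      (cycleEnd h₁ R K) ⊆ Metric.ball 0 r := by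
    have hc : IsCompact (chainSupport (cycleCurve γ n h₁ R δ K) (cycleStart h₀ R K)
        (cycleEnd h₁ R K)) :=
      isCompact_iUnion fun i => isCompact_uIcc.image (hg i).continuous
    obtain ⟨r, hr⟩ := hc.isBounded.subset_ball 0
    exact ⟨r, hr⟩
  have hclosed : ∀ F : ℂ → ℂ, ∑ i, cycleCoeff K i * (F (cycleCurve γ n h₁ R δ K i
      (cycleEnd h₁ R K i)) - F (cycleCurve γ n h₁ R δ K i (cycleStart h₀ R K i))) = 0 := by
    intro F
    rw [Fintype.sum_sum_type, Fin.sum_univ_four]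
    have h1 := htail R (by rw [abs_of_pos hR0])
    have h2 := htail (-R) (by rw [abs_neg, abs_of_pos hR0])
    have h3 : ∀ k : Fin K, cycleCoeff K (Sum.inr k) * (F (cycleCurve γ n h₁ R δ K (Sum.inr k)
        (cycleEnd h₁ R K (Sum.inr k))) - F (cycleCurve γ n h₁ R δ K (Sum.inr k)
        (cycleStart h₀ R K (Sum.inr k)))) = 0 := by
      intro k
      simp only [cycleCoeff, cycleCurve, cycleStart, cycleEnd, Sum.elim_inr]
      have := periodic_circleMap 0 δ 0
      rw [zero_add] at this
      rw [this, sub_self, mul_zero]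
    simp only [h3, Finset.sum_const_zero, add_zero]
    simp only [cycleCoeff, cycleCurve, cycleStart, cycleEnd, Sum.elim_inl, Matrix.cons_val_zero,
      Matrix.cons_val_one, Matrix.cons_val, h1, h2]
    ring
  -- the separation property makes the contour and its line of return wind around the lower poles
  -- with index less than `K` only, and there the circles compensate
  have hres : ∀ p ∈ poles β n, chainIntegral (cycleCoeff K) (cycleCurve γ n h₁ R δ K)
      (cycleStart h₀ R K) (cycleEnd h₁ R K) (fun x => (x - p)⁻¹) = 0 := by
    intro p hp
    rw [chainIntegral_cycle]
    rcases hp with ⟨j, rfl⟩ | ⟨j, rfl⟩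
    · have him : h₁ < (upperPole β n j).im := by
        rw [upperPole_im]
        have : (0 : ℝ) ≤ j := Nat.cast_nonneg _
        linarith
      rw [returnIntegral_inv_sub hγ htail (hpre _ (Or.inl ⟨j, rfl⟩)) (hup j) him.ne'
        (tendsto_integral_line_of_lt him), sub_self, zero_add]
      exact Finset.sum_eq_zero fun k _ => circleIntegral_inv_add hδ
        fun ε hε => lowerPole_add_ne_upperPole hgood hε
    · have hne := hpim _ (Or.inr ⟨j, rfl⟩)
      have hother : ∀ k, k ≠ j → I * (∮ ε in C(0, δ), (lowerPole n k + I * ε -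
          lowerPole n j)⁻¹) = 0 := fun k hk => circleIntegral_inv_add hδ
        fun ε hε => lowerPole_add_ne hgood hε fun h => absurd h.symm hk
      by_cases hjK : j < K
      · have him : h₁ < (lowerPole n j).im := by
          rw [lowerPole_im, hh₁]
          have : (j : ℝ) + 1 ≤ K := by exact_mod_cast hjK
          linarith
        rw [returnIntegral_inv_sub hγ htail (hpre _ (Or.inr ⟨j, rfl⟩)) (hlow j) hne
          (tendsto_integral_line_of_lt him),
          Finset.sum_eq_single_of_mem j (Finset.mem_range.2 hjK) fun k _ hk => hother k hk,
          circleIntegral_inv_self _ hδ]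
        ring
      · have him : (lowerPole n j).im < h₁ := by
          rw [lowerPole_im, hh₁]
          have : (K : ℝ) ≤ j := by exact_mod_cast not_lt.1 hjK
          linarith
        rw [returnIntegral_inv_sub hγ htail (hpre _ (Or.inr ⟨j, rfl⟩)) (hlow j) hne
          (tendsto_integral_line_of_gt him), sub_self, zero_add]
        refine Finset.sum_eq_zero fun k hk => hother k ?_
        rintro rfl
        exact hjK (Finset.mem_range.1 hk)
  obtain ⟨m, hm⟩ := exists_differentiableOn_numerator L β hz n r
  have key := chainIntegral_eq_zero hg hclosed hP hr hres _ (poleMultiset L β n m)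
    (numerator L β z n m) rfl (fun p hp => mem_poles_of_mem_poleMultiset hp) hm
  rw [← chainIntegral_congr (f₁ := regIntegrand L β z n) fun x hx =>
    regIntegrand_eq_numerator L β z n m fun hxp => hP x hxp hx, chainIntegral_cycle] at key
  rw [eq_neg_of_add_eq_zero_left key, ← Finset.sum_neg_distrib]
  refine Finset.sum_congr rfl fun k _ => ?_
  rw [residueTerm, neg_mul]
  congr 2
  exact circleIntegral.integral_congr hδ.le fun ε hε =>
    regIntegrand_lowerPole hgood hz n k (by simpa using hε)

/-- The Mellin-Barnes integral over a separating contour is the sum of the residues at the lower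
poles, for `|z| < 1`. -/
theorem hasContourIntegral_regIntegrand {L : ℕ} {β z : ℂ} {δ : ℝ} (hgood : IsGoodRadius β δ)
    (hb : 0 < β.re) (hz0 : z ≠ 0) (hz : ‖z‖ < 1) {n : ℤ} {γ : ℝ → ℂ}
    (hγ : IsSeparatingContour β n γ) :
    HasContourIntegral (regIntegrand L β z n) γ
      (∑' k, residueTerm L β z δ (k + n.toNat) (k + (-n).toNat)) := by
  obtain ⟨hC1, ⟨c, R₀, htail₀⟩, hup, hlow⟩ := hγ
  set h₀ : ℝ := -c with hh₀
  set R : ℝ := max R₀ (1 + |β.im|) with hRdef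
  have htail : ∀ t : ℝ, R ≤ |t| → γ t = t + h₀ * I := fun t ht => by
    rw [htail₀ t ((le_max_left _ _).trans ht), hh₀]; push_cast; ring
  have hR1 : 1 + |β.im| ≤ R := le_max_right _ _
  have hR : |β.im| < R := by linarith
  have hR0 : 0 < R := (abs_nonneg _).trans_lt hR
  set f := regIntegrand L β z n with hf
  have hzpos : 0 < ‖z‖ := norm_pos_iff.2 hz0
  set a : ℝ := -Real.log ‖z‖ with ha
  have ha0 : 0 < a := neg_pos.2 (Real.log_neg hzpos hz)
  have hzp : ∀ ν, ‖zPow z n ν‖ = Real.exp (2 * a * ν.im) := fun ν => by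
    rw [zPow_norm hz0, Real.rpow_def_of_pos hzpos, ha]; ring_nf
  have hsum : Summable fun k => residueTerm L β z δ (k + n.toNat) (k + (-n).toNat) := by
    refine (hasSum_residueTerm hgood hz0 hz).1.comp_injective
      (i := fun k : ℕ => ((k + n.toNat, k + (-n).toNat) : ℕ × ℕ)) fun k l h => ?_
    have := (Prod.ext_iff.1 h).1
    simpa using this
  -- the decay of the integrand at both ends
  set κ := min (β.re / 2) 1 with hκ
  have hκ0 : 0 < κ := by positivity
  obtain ⟨C₁, hC₁, hdec⟩ := norm_mellinKernel_le hκ0.le (min_le_right _ _)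
    ((min_le_left _ _).trans_lt (by linarith : β.re / 2 < β.re)) n.natAbs h₀
  obtain ⟨C₂, hC₂, K₀, hline⟩ := norm_mellinKernel_le_line hb n.natAbs
  let E : ℝ → ℝ := fun T =>
    (C₁ * (T - |β.im|) ^ (-(2 * κ))) ^ (L + 1) * (Real.exp (2 * a * h₀) / (2 * a))
  have hE : Tendsto E atTop (𝓝 0) := by
    have h1 : Tendsto (fun T : ℝ => (T - |β.im|) ^ (-(2 * κ))) atTop (𝓝 0) := by
      refine (tendsto_rpow_neg_atTop (by positivity)).comp ?_
      exact tendsto_atTop_add_const_right _ _ tendsto_id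
    simpa using ((h1.const_mul C₁).pow (L + 1)).mul_const (Real.exp (2 * a * h₀) / (2 * a))
  have hvert : ∀ (T x : ℝ), R ≤ T → |x| = T → ∀ h₁ ≤ h₀,
      ‖I * ∫ y in h₀..h₁, f (x + y * I)‖ ≤ E T := by
    intro T x hT hx h₁ hh
    rw [norm_mul, norm_I, one_mul, intervalIntegral.integral_symm, norm_neg]
    have hexp : ∫ y in h₁..h₀, Real.exp (2 * a * y) =
        (Real.exp (2 * a * h₀) - Real.exp (2 * a * h₁)) / (2 * a) := by
      rw [intervalIntegral.integral_comp_mul_left (fun y => Real.exp y) (by positivity : 2 * a ≠ 0),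
        integral_exp, smul_eq_mul]
      field_simp
    have hb1 : ∀ y ∈ Set.Ioc h₁ h₀, ‖f (x + y * I)‖ ≤
        (C₁ * (T - |β.im|) ^ (-(2 * κ))) ^ (L + 1) * Real.exp (2 * a * y) := by
      intro y hy
      have hre : ((x : ℂ) + y * I).re = x := by simp
      have him : ((x : ℂ) + y * I).im = y := by simp
      rw [hf, regIntegrand, norm_mul, norm_pow, hzp, him]
      have := hdec (x + y * I) (by rw [hre, hx]; linarith) (by rw [him]; exact hy.2)
      rw [hre, hx] at this
      gcongr
    refine (intervalIntegral.norm_integral_le_of_norm_le hh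
      (Eventually.of_forall fun y hy => hb1 y hy)
      (Continuous.intervalIntegrable (by fun_prop) _ _)).trans ?_
    rw [intervalIntegral.integral_const_mul, hexp]
    have : 0 ≤ T - |β.im| := by linarith
    change _ ≤ (C₁ * (T - |β.im|) ^ (-(2 * κ))) ^ (L + 1) * (Real.exp (2 * a * h₀) / (2 * a))
    gcongr
    linarith [Real.exp_pos (2 * a * h₁)]
  have hpre : ∀ p ∈ poles β n, |p.re| < R := by
    rintro _ (⟨j, rfl⟩ | ⟨j, rfl⟩)
    · rwa [upperPole_re]
    · rw [lowerPole_re, abs_zero]; exact hR0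
  have hdiff : DifferentiableOn ℂ f {x | R ≤ |x.re|} := fun x hx =>
    (differentiableAt_regIntegrand hz0 fun hp => not_lt.2 hx (hpre x hp)).differentiableWithinAt
  -- at a fixed width of the cycle, the line of return moves down to infinity
  have hbound : ∀ T₁ T₂ : ℝ, R < T₁ → R < T₂ →
      ‖(∫ t in (-T₁)..T₂, f (γ t) * deriv γ t) -
        ∑' k, residueTerm L β z δ (k + n.toNat) (k + (-n).toNat)‖ ≤ E T₁ + E T₂ := by
    intro T₁ T₂ hT₁ hT₂
    let B : ℕ → ℝ := fun K => C₂ ^ (L + 1) *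
      Real.exp (2 * a * (-(((n.natAbs : ℝ) + 1) / 2 + K - 1 / 2))) * (T₁ + T₂)
    have hB : Tendsto B atTop (𝓝 0) := by
      have h1 : Tendsto (fun K : ℕ => 2 * a * (-(((n.natAbs : ℝ) + 1) / 2 + K - 1 / 2))) atTop
          atBot := by
        refine Tendsto.const_mul_atBot (by positivity) (tendsto_neg_atTop_atBot.comp ?_)
        exact tendsto_atTop_add_const_right _ _
          (tendsto_atTop_add_const_left _ _ tendsto_natCast_atTop_atTop)
      have h2 := ((Real.tendsto_exp_atBot.comp h1).const_mul (C₂ ^ (L + 1))).mul_const (T₁ + T₂)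
      rw [mul_zero, zero_mul] at h2
      exact h2
    have hlim := (hsum.hasSum.tendsto_sum_nat.const_sub
      (∫ t in (-T₁)..T₂, f (γ t) * deriv γ t)).norm
    have hlim2 := hB.const_add (E T₁ + E T₂)
    rw [add_zero] at hlim2
    obtain ⟨K₁, hK₁⟩ := exists_nat_ge (max (β.re + 1) (-h₀))
    refine le_of_tendsto_of_tendsto hlim hlim2 ?_
    filter_upwards [eventually_ge_atTop (max K₀ K₁)] with K hK
    have hK₁' : max (β.re + 1) (-h₀) ≤ K :=
      hK₁.trans (by exact_mod_cast (le_max_right _ _).trans hK)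
    set h₁ : ℝ := -(((n.natAbs : ℝ) + 1) / 2 + K - 1 / 2) with hh₁
    have hN0 : (0 : ℝ) ≤ n.natAbs := Nat.cast_nonneg _
    have hle : h₁ ≤ h₀ := by
      have := (le_max_right _ _).trans hK₁'
      rw [hh₁]; linarith
    have hnotpole : ∀ t : ℝ, (t : ℂ) + h₁ * I ∉ poles β n := by
      rintro t (⟨j, hj⟩ | ⟨j, hj⟩)
      · have h := congrArg im hj
        rw [upperPole_im] at h
        have : (0 : ℝ) ≤ j := Nat.cast_nonneg _
        have := (le_max_left _ _).trans hK₁'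
        simp only [add_im, ofReal_im, mul_im, ofReal_re, I_im, I_re, mul_one, mul_zero, add_zero,
          zero_add, hh₁] at h
        linarith
      · have h := congrArg im hj
        rw [lowerPole_im] at h
        simp only [add_im, ofReal_im, mul_im, ofReal_re, I_im, I_re, mul_one, mul_zero, add_zero,
          zero_add, hh₁] at h
        have h2 : (2 * j + 1 : ℝ) = 2 * K := by linarith
        have h3 : 2 * j + 1 = 2 * K := by exact_mod_cast h2
        omega
    have hcont : Continuous fun t : ℝ => f (t + h₁ * I) := by
      refine continuous_iff_continuousAt.2 fun t => ?_
      exact ContinuousAt.comp (f := fun t : ℝ => (t : ℂ) + h₁ * I)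
        (differentiableAt_regIntegrand hz0 (hnotpole t)).continuousAt (by fun_prop)
    have hγc : ContinuousOn f (γ '' Set.Icc (-R) R) := by
      rintro _ ⟨t, -, rfl⟩
      refine (differentiableAt_regIntegrand hz0 ?_).continuousAt.continuousWithinAt
      rintro (⟨j, hj⟩ | ⟨j, hj⟩)
      exacts [(hup j).1 t hj.symm, (hlow j).1 t hj.symm]
    have e1 := returnIntegral_eq (f := f) hC1 htail hT₁ hT₂ hR0 hdiff hγc hcont
    rw [returnIntegral_regIntegrand hgood hz0 hC1 htail hR hup hlow
      ((le_max_left _ _).trans hK₁')] at e1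
    have e2 : (∫ t in (-T₁)..T₂, f (γ t) * deriv γ t) -
        ∑ k ∈ Finset.range K, residueTerm L β z δ (k + n.toNat) (k + (-n).toNat) =
        (I * ∫ y in h₀..h₁, f ((-T₁ : ℝ) + y * I)) - (I * ∫ y in h₀..h₁, f (T₂ + y * I)) +
          ∫ t in (-T₁)..T₂, f (t + h₁ * I) := by
      rw [← e1, returnIntegral]; ring
    have hbot : ‖∫ t in (-T₁)..T₂, f (t + h₁ * I)‖ ≤ B K := by
      have := intervalIntegral.norm_integral_le_of_norm_le_const (a := -T₁) (b := T₂)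
        (C := C₂ ^ (L + 1) * Real.exp (2 * a * h₁)) (f := fun t : ℝ => f (t + h₁ * I))
        fun t _ => by
          have him : ((t : ℂ) + h₁ * I).im = h₁ := by simp
          rw [hf, regIntegrand, norm_mul, norm_pow, hzp, him]
          gcongr
          exact hline K ((le_max_left _ _).trans hK) _ him
      rwa [sub_neg_eq_add, add_comm T₂, abs_of_pos (by linarith)] at this
    rw [e2]
    calc _ ≤ _ := norm_add_le _ _
      _ ≤ _ := add_le_add (norm_sub_le _ _) le_rfl
      _ ≤ _ := add_le_add (add_le_add
        (hvert T₁ (-T₁) hT₁.le (by rw [abs_neg, abs_of_pos (hR0.trans hT₁)]) h₁ hle)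
        (hvert T₂ T₂ hT₂.le (abs_of_pos (hR0.trans hT₂)) h₁ hle)) hbot
  rw [HasContourIntegral, tendsto_iff_norm_sub_tendsto_zero]
  refine squeeze_zero' (g := fun T : ℝ × ℝ => E T.1 + E T.2)
    (Eventually.of_forall fun _ => norm_nonneg _) ?_ ?_
  · filter_upwards [(eventually_gt_atTop R).prod_mk (eventually_gt_atTop R)] with T hT
    exact hbound T.1 T.2 hT.1 hT.2
  · simpa using (hE.comp tendsto_fst).add (hE.comp tendsto_snd)

/-! ### The Mellin-Barnes representation -/

theorem Gamma_reflect_div {u : ℂ} (N : ℕ) (hu : ∀ m : ℤ, u ≠ m) :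
    Gamma u / Gamma (1 - u - N) = (-1) ^ N * (Gamma (u + N) / Gamma (1 - u)) := by
  have h1 : Gamma (1 - u) ≠ 0 := Gamma_ne_zero fun m h =>
    hu (m + 1) (by push_cast; linear_combination -h)
  have h2 : Gamma (1 - (1 - u - N)) ≠ 0 := Gamma_ne_zero fun m h =>
    hu (-m - N) (by push_cast; linear_combination h)
  have hs : sin (Real.pi * u) ≠ 0 := by
    intro h
    obtain ⟨m, hm⟩ := Complex.sin_eq_zero_iff.1 h
    have hpi : (Real.pi : ℂ) ≠ 0 := by exact_mod_cast Real.pi_ne_zero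
    exact hu m (mul_left_cancel₀ hpi (by rw [hm]; ring))
  have e : sin (Real.pi * (1 - u - N)) = (-1) ^ N * sin (Real.pi * u) := by
    rw [show (Real.pi : ℂ) * (1 - u - N) = Real.pi * (1 - u - N) by ring, sin_pi_mul_sub_nat,
      show (Real.pi : ℂ) * (1 - u) = Real.pi - Real.pi * u by ring, Complex.sin_pi_sub]
  rw [Gamma_div_Gamma_eq h1 h2, e, mul_div_assoc, div_self hs, mul_one]
  congr 3
  ring

/-- The points at which the Gamma functions of the Mellin-Barnes integrand may take the value
which stands for a pole. -/
def exceptionalSet (β : ℂ) (n : ℤ) : Set ℂ :=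
  {ν | ∃ m : ℤ, ((n : ℂ) + 1) / 2 - β + I * ν = m ∨ ((n : ℂ) + 1) / 2 - I * ν = m}

theorem countable_exceptionalSet (β : ℂ) (n : ℤ) : (exceptionalSet β n).Countable := by
  refine ((Set.countable_range fun m : ℤ => -I * (m - ((n : ℂ) + 1) / 2 + β)).union
    (Set.countable_range fun m : ℤ => -I * (((n : ℂ) + 1) / 2 - m))).mono ?_
  rintro ν ⟨m, h | h⟩
  · exact Or.inl ⟨m, by linear_combination I * h - ν * I_mul_I⟩
  · exact Or.inr ⟨m, by linear_combination (-I) * h - ν * I_mul_I⟩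

/-- The Gamma functions depend only on `|n|`, by the reflection formula. -/
theorem mbIntegrand_eq_regIntegrand (L : ℕ) (β z : ℂ) (n : ℤ) {ν : ℂ}
    (hν : ν ∉ exceptionalSet β n) : mbIntegrand L β z n ν = regIntegrand L β z n ν := by
  rw [mbIntegrand, regIntegrand, ← mul_pow, ← mul_pow, ← div_pow]
  congr 2
  rw [mellinKernel]
  obtain ⟨N, rfl | rfl⟩ := n.eq_nat_or_neg
  · simp
  · have h1 := Gamma_reflect_div (u := (((-N : ℤ) : ℂ) + 1) / 2 - β + I * ν) N
      fun m hm => hν ⟨m, Or.inl hm⟩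
    have h2 := Gamma_reflect_div (u := (((-N : ℤ) : ℂ) + 1) / 2 - I * ν) N
      fun m hm => hν ⟨m, Or.inr hm⟩
    rw [show 1 - ((((-N : ℤ) : ℂ) + 1) / 2 - β + I * ν) - N =
      (((-N : ℤ) : ℂ) + 1) / 2 + β - I * ν by push_cast; ring] at h1
    rw [show 1 - ((((-N : ℤ) : ℂ) + 1) / 2 - I * ν) - N =
      (((-N : ℤ) : ℂ) + 1) / 2 + I * ν by push_cast; ring] at h2
    rw [mul_div_mul_comm, h1, h2, mul_div_mul_comm, Int.natAbs_neg, Int.natAbs_natCast,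
      mul_mul_mul_comm, ← mul_pow, neg_one_mul, neg_neg, one_pow, one_mul]
    congr 3 <;> push_cast <;> ring

/-- A curve passes through a given point with nonzero velocity at countably many times only. -/
theorem countable_setOf_eq_of_deriv_ne_zero (γ : ℝ → ℂ) (p : ℂ) :
    {t | γ t = p ∧ deriv γ t ≠ 0}.Countable := by
  have : DiscreteTopology {t | γ t = p ∧ deriv γ t ≠ 0} := by
    rw [discreteTopology_subtype_iff]
    rintro t ⟨ht, hd⟩
    have hdiff : DifferentiableAt ℝ γ t := by
      by_contra h; exact hd (deriv_zero_of_not_differentiableAt h)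
    have h := hdiff.hasDerivAt.eventually_ne (c := p) hd
    rw [← disjoint_iff, disjoint_principal_right]
    filter_upwards [h] with u hu hu'
    exact hu hu'.1
  exact Set.countable_coe_iff.1 (TopologicalSpace.separableSpace_iff_countable.1 inferInstance)

/-- The values of `mbIntegrand` at its spurious singularities do not matter: a contour meets this
countable set either with zero velocity or at countably many times. -/
theorem HasContourIntegral.mbIntegrand {L : ℕ} {β z : ℂ} {n : ℤ} {γ : ℝ → ℂ} {J : ℂ}
    (h : HasContourIntegral (regIntegrand L β z n) γ J) :
    HasContourIntegral (mbIntegrand L β z n) γ J := by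
  refine Tendsto.congr (fun T => ?_) h
  refine intervalIntegral.integral_congr_ae (Eventually.mono ?_ fun t ht _ => ht)
  have hc : (⋃ p ∈ exceptionalSet β n, {t | γ t = p ∧ deriv γ t ≠ 0}).Countable :=
    (countable_exceptionalSet β n).biUnion fun p _ => countable_setOf_eq_of_deriv_ne_zero γ p
  filter_upwards [hc.ae_notMem volume] with t ht
  by_cases hd : deriv γ t = 0
  · rw [hd, mul_zero, mul_zero]
  · rw [mbIntegrand_eq_regIntegrand L β z n fun hp =>
      ht (Set.mem_biUnion hp ⟨rfl, hd⟩)]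

/-- A pair of natural numbers given by its difference and its minimum. -/
def diffMinEquiv : ℤ × ℕ ≃ ℕ × ℕ where
  toFun p := (p.2 + p.1.toNat, p.2 + (-p.1).toNat)
  invFun p := ((p.1 : ℤ) - p.2, min p.1 p.2)
  left_inv p := by
    ext
    · simp
    · simp; omega
  right_inv p := by ext <;> (simp; omega)

/-- For `|z| < 1` the integral with index `n` collects the residues with `i - j = n`. -/
theorem mellinBarnes_of_norm_lt_one (L : ℕ) {β z : ℂ} (hβ : β ∈ genericIndex) (hb : 0 < β.re)
    (hz0 : z ≠ 0) (hz : ‖z‖ < 1) {γ : ℤ → ℝ → ℂ} (hγ : ∀ n, IsSeparatingContour β n (γ n)) :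
    ∃ J : ℤ → ℂ, (∀ n, HasContourIntegral (regIntegrand L β z n) (γ n) (J n)) ∧ Summable J ∧
      ladderDeriv L z β = (4 : ℂ) ^ (-β * ((L : ℂ) + 1)) * ∑' n, J n := by
  obtain ⟨δ, hδ, h⟩ := exists_isGoodRadius hβ
  have hgood := h β (Metric.mem_closedBall_self hδ.le)
  obtain ⟨hs, ht⟩ := hasSum_residueTerm (L := L) hgood hz0 hz
  have hs' := diffMinEquiv.summable_iff.2 hs
  refine ⟨fun n => ∑' k, residueTerm L β z δ (k + n.toNat) (k + (-n).toNat),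
    fun n => hasContourIntegral_regIntegrand hgood hb hz0 hz (hγ n), hs'.prod, ?_⟩
  rw [← ht, ← diffMinEquiv.tsum_eq]
  exact congrArg _ hs'.tsum_prod

/-! ### The reflection of contours -/

/-- Index integrals may be truncated symmetrically about any point; this is needed because the
reflection of a contour shifts its parameter. -/
theorem tendsto_indexIntegral_shift {γ : ℝ → ℂ} (hγ : ContDiff ℝ 1 γ) {c R : ℝ}
    (htail : ∀ t : ℝ, R ≤ |t| → γ t = t - c * I) {p s : ℂ} (h : HasIndexIntegral γ p s) (a : ℝ) :
    Tendsto (fun T : ℝ => ∫ t in (a - T)..(a + T), deriv γ t / (γ t - p)) atTop (𝓝 s) := by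
  set g : ℝ → ℂ := fun t => deriv γ t / (γ t - p) with hg
  have hgc : Continuous g := (hγ.continuous_deriv le_rfl).div (hγ.continuous.sub continuous_const)
    fun t => sub_ne_zero.2 (h.1 t)
  have hgt : ∀ t : ℝ, R < |t| → |p.re| < |t| → ‖g t‖ ≤ (|t| - |p.re|)⁻¹ := by
    intro t ht htp
    have hd : deriv γ t = 1 := by
      have : γ =ᶠ[𝓝 t] fun t => (t : ℂ) + ((-c : ℝ) : ℂ) * I := by
        filter_upwards [continuous_abs.continuousAt.eventually_const_lt ht] with u hu
        rw [htail u hu.le]; push_cast; ring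
      rw [this.deriv_eq, deriv_horizontal]
    simp only [hg, hd, one_div]
    rw [norm_inv]
    refine inv_anti₀ (sub_pos.2 htp) ((abs_sub_abs_le_abs_sub _ _).trans ?_)
    rw [htail t ht.le]
    refine le_trans (le_of_eq ?_) (abs_re_le_norm _)
    simp
  have hend : ∀ σ : ℝ, |σ| = 1 →
      Tendsto (fun T : ℝ => ∫ t in (σ * T)..(a + σ * T), g t) atTop (𝓝 0) := by
    intro σ hσ
    have hb : Tendsto (fun T : ℝ => (T - |a| - |p.re|)⁻¹ * |a|) atTop (𝓝 0) := by
      have := (tendsto_inv_atTop_zero (𝕜 := ℝ)).comp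
        (tendsto_atTop_add_const_right _ (-|a| - |p.re|) tendsto_id)
      simpa [sub_eq_add_neg, add_assoc] using this.mul_const |a|
    refine squeeze_zero_norm' ?_ hb
    filter_upwards [eventually_gt_atTop (|R| + |a| + |p.re|)] with T hT
    have hT0 : 0 < T := lt_of_le_of_lt (by positivity) hT
    refine (intervalIntegral.norm_integral_le_of_norm_le_const (C := (T - |a| - |p.re|)⁻¹)
      fun t ht => ?_).trans (by rw [add_sub_cancel_right])
    have h1 : |t - σ * T| ≤ |a| := by
      have := Set.abs_sub_left_of_mem_uIcc (Set.uIoc_subset_uIcc ht)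
      rwa [add_sub_cancel_right] at this
    have h2 : |σ * T| = T := by rw [abs_mul, hσ, one_mul, abs_of_pos hT0]
    have h3 : T - |a| ≤ |t| := by
      have := abs_sub_abs_le_abs_sub (σ * T) t
      rw [h2, abs_sub_comm] at this
      linarith
    refine (hgt t ?_ ?_).trans ?_
    · linarith [le_abs_self R, abs_nonneg p.re]
    · linarith [abs_nonneg R]
    · exact inv_anti₀ (by linarith [abs_nonneg R]) (by linarith)
  have := (h.2.add (hend 1 (by simp))).sub (hend (-1) (by simp))
  rw [add_zero, sub_zero] at this
  refine this.congr fun T => ?_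
  have hi : ∀ x y : ℝ, IntervalIntegrable g volume x y := fun x y => hgc.intervalIntegrable x y
  rw [one_mul, neg_one_mul, intervalIntegral.integral_add_adjacent_intervals (hi _ _) (hi _ _),
    intervalIntegral.integral_interval_sub_left (hi _ _) (hi _ _), ← sub_eq_add_neg]

/-- The image of a contour under `ν ↦ -iβ - ν`, which exchanges the two series of poles,
parametrized from left to right. -/
def reflectContour (β : ℂ) (γ : ℝ → ℂ) (t : ℝ) : ℂ := -I * β - γ (β.im - t)

theorem deriv_reflectContour (β : ℂ) (γ : ℝ → ℂ) (t : ℝ) :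
    deriv (reflectContour β γ) t = deriv γ (β.im - t) := by
  have : reflectContour β γ = fun t => -I * β - γ (β.im - t) := rfl
  rw [this, deriv_const_sub, deriv_comp_const_sub (f := γ), neg_neg]

theorem hasIndexIntegral_reflectContour {β : ℂ} {γ : ℝ → ℂ} (hγ : ContDiff ℝ 1 γ) {c R : ℝ}
    (htail : ∀ t : ℝ, R ≤ |t| → γ t = t - c * I) {p s : ℂ}
    (h : HasIndexIntegral γ (-I * β - p) s) : HasIndexIntegral (reflectContour β γ) p (-s) := by
  refine ⟨fun t ht => h.1 (β.im - t) ?_, ?_⟩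
  · rw [← ht, reflectContour]; ring
  · refine (tendsto_indexIntegral_shift hγ htail h β.im).neg.congr fun T => ?_
    have := intervalIntegral.integral_comp_sub_left (a := -T) (b := T)
      (fun t => deriv γ t / (γ t - (-I * β - p))) β.im
    rw [sub_neg_eq_add] at this
    rw [← this, ← intervalIntegral.integral_neg]
    refine intervalIntegral.integral_congr fun t _ => ?_
    simp only [deriv_reflectContour, reflectContour]
    rw [← div_neg]
    congr 1
    ring

theorem isSeparatingContour_reflectContour {β : ℂ} {n : ℤ} {γ : ℝ → ℂ}
    (h : IsSeparatingContour β n γ) : IsSeparatingContour β (-n) (reflectContour β γ) := by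
  obtain ⟨hC, ⟨c, R, htail⟩, hup, hlow⟩ := h
  refine ⟨?_, ⟨β.re - c, R + |β.im|, fun t ht => ?_⟩, fun k => ?_, fun k => ?_⟩
  · exact contDiff_const.sub (hC.comp (contDiff_const.sub contDiff_id))
  · have h1 : R ≤ |β.im - t| := by
      have := abs_sub_abs_le_abs_sub t β.im
      rw [abs_sub_comm] at this
      linarith
    rw [reflectContour, htail _ h1]
    apply Complex.ext
    · simp
    · simp; ring
  · have := hasIndexIntegral_reflectContour (β := β) (p := upperPole β (-n) k) hC htail
      (s := -(Real.pi * I)) (by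
        convert! hlow k using 1
        rw [upperPole, lowerPole, Int.natAbs_neg]; ring)
    rwa [neg_neg] at this
  · refine hasIndexIntegral_reflectContour (β := β) (p := lowerPole (-n) k) hC htail ?_
    convert! hup k using 1
    rw [upperPole, lowerPole, Int.natAbs_neg]; ring

theorem regIntegrand_reflect (L : ℕ) (β : ℂ) {z : ℂ} (hz : z ≠ 0) (n : ℤ) (ν : ℂ) :
    regIntegrand L β z n (-I * β - ν) = sqPow z β * regIntegrand L β z⁻¹ (-n) ν := by
  have : zPow z n (-I * β - ν) = sqPow z β * zPow z⁻¹ (-n) ν := by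
    rw [zPow, zPow, sqPow_inv, ← sqPow_neg, inv_zpow', neg_neg, ← mul_assoc, ← sqPow_add hz]
    congr 2
    push_cast
    linear_combination (-β) * I_mul_I
  rw [regIntegrand, regIntegrand, mellinKernel_symm, this, Int.natAbs_neg]
  ring

theorem HasContourIntegral.of_reflect {L : ℕ} {β z : ℂ} (hz : z ≠ 0) {n : ℤ} {γ : ℝ → ℂ} {J : ℂ}
    (h : HasContourIntegral (regIntegrand L β z⁻¹ (-n)) (reflectContour β γ) J) :
    HasContourIntegral (regIntegrand L β z n) γ (sqPow z β * J) := by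
  have hmap : Tendsto (fun T : ℝ × ℝ => (T.2 - β.im, T.1 + β.im)) (atTop ×ˢ atTop)
      (atTop ×ˢ atTop) :=
    (tendsto_atTop_add_const_right _ (-β.im) tendsto_snd).prodMk
      (tendsto_atTop_add_const_right _ _ tendsto_fst)
  refine ((Tendsto.comp h hmap).const_mul (sqPow z β)).congr fun T => ?_
  have := intervalIntegral.integral_comp_sub_left (a := -T.1) (b := T.2)
    (fun t => regIntegrand L β z⁻¹ (-n) (reflectContour β γ t) * deriv (reflectContour β γ) t) β.im
  rw [sub_neg_eq_add, add_comm β.im, ← neg_sub T.2 β.im] at this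
  rw [Function.comp_apply, ← this, ← intervalIntegral.integral_const_mul]
  refine intervalIntegral.integral_congr fun t _ => ?_
  simp only [deriv_reflectContour, sub_sub_cancel, ← mul_assoc]
  rw [← regIntegrand_reflect L β hz, reflectContour, sub_sub_cancel, sub_sub_cancel]

/-- For `|z| > 1` the reflected contours lead back to `z⁻¹`. -/
theorem mellinBarnes_of_one_lt_norm (L : ℕ) {β z : ℂ} (hβ : β ∈ genericIndex) (hb : 0 < β.re)
    (hz : 1 < ‖z‖) {γ : ℤ → ℝ → ℂ} (hγ : ∀ n, IsSeparatingContour β n (γ n)) :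
    ∃ J : ℤ → ℂ, (∀ n, HasContourIntegral (regIntegrand L β z n) (γ n) (J n)) ∧ Summable J ∧
      sqPow z β * ladderDeriv L z⁻¹ β = (4 : ℂ) ^ (-β * ((L : ℂ) + 1)) * ∑' n, J n := by
  have hz0 : z ≠ 0 := by rintro rfl; simp at hz; linarith
  obtain ⟨J, hJ, hs, ht⟩ := mellinBarnes_of_norm_lt_one L hβ hb (inv_ne_zero hz0)
    (by rw [norm_inv]; exact inv_lt_one_of_one_lt₀ hz)
    (γ := fun n => reflectContour β (γ (-n))) fun n => by
      simpa using isSeparatingContour_reflectContour (hγ (-n))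
  refine ⟨fun n => sqPow z β * J (-n), fun n => ?_, ?_, ?_⟩
  · refine HasContourIntegral.of_reflect hz0 ?_
    simpa using hJ (-n)
  · exact ((Equiv.neg ℤ).summable_iff.2 hs).mul_left _
  · rw [ht, tsum_mul_left]
    have := (Equiv.neg ℤ).tsum_eq J
    simp only [Equiv.neg_apply] at this
    rw [this]
    ring

/-! ### The invariant measure of the punctured plane -/

theorem det_restrictScalars_toSpanSingleton (a : ℂ) :
    (((ContinuousLinearMap.toSpanSingleton ℂ a).restrictScalars ℝ : ℂ →L[ℝ] ℂ)).det =
      ‖a‖ ^ 2 := by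
  rw [ContinuousLinearMap.det]
  have := LinearMap.det_restrictScalars (R := ℝ) (S := ℂ)
    (f := ((ContinuousLinearMap.toSpanSingleton ℂ a : ℂ →L[ℂ] ℂ) : ℂ →ₗ[ℂ] ℂ))
  rw [show (((ContinuousLinearMap.toSpanSingleton ℂ a).restrictScalars ℝ : ℂ →L[ℝ] ℂ) :
    ℂ →ₗ[ℝ] ℂ) = (((ContinuousLinearMap.toSpanSingleton ℂ a : ℂ →L[ℂ] ℂ) : ℂ →ₗ[ℂ] ℂ)).restrictScalars ℝ
    from rfl, this]
  simp [Algebra.norm_complex_eq, Complex.normSq_eq_norm_sq]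

/-- Change of variables under an injective holomorphic map, for measures with densities. -/
theorem measurePreserving_of_hasDerivAt {f f' : ℂ → ℂ} {s : Set ℂ} (hs : MeasurableSet s)
    (hf : ∀ x ∈ s, HasDerivAt f (f' x) x) (hinj : Set.InjOn f s) (himg : ∀ᵐ y, y ∈ f '' s)
    (hfm : Measurable f) {ρ σ : ℂ → ENNReal}
    (h0 : ∀ x, x ∉ s → ρ x = 0)
    (h : ∀ x ∈ s, ρ x = ENNReal.ofReal (‖f' x‖ ^ 2) * σ (f x)) :
    MeasurePreserving f (volume.withDensity ρ) (volume.withDensity σ) := by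
  refine ⟨hfm, Measure.ext fun A hA => ?_⟩
  have key := lintegral_image_eq_lintegral_abs_det_fderiv_mul volume hs
    (f := f) (f' := fun x => (ContinuousLinearMap.toSpanSingleton ℂ (f' x)).restrictScalars ℝ)
    (fun x hx => ((hf x hx).hasFDerivAt.restrictScalars ℝ).hasFDerivWithinAt) hinj
    (A.indicator σ)
  rw [setLIntegral_congr (t := Set.univ) (by
    filter_upwards [himg] with y hy
    exact propext ⟨fun _ => trivial, fun _ => hy⟩), Measure.restrict_univ,
    lintegral_indicator hA] at key
  rw [Measure.map_apply hfm hA, withDensity_apply _ (hfm hA), withDensity_apply _ hA, key,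
    ← lintegral_indicator (hfm hA), ← lintegral_indicator hs]
  refine lintegral_congr fun x => ?_
  by_cases hx : x ∈ s
  · rw [Set.indicator_of_mem hx, det_restrictScalars_toSpanSingleton,
      abs_of_nonneg (by positivity)]
    by_cases hxA : f x ∈ A
    · rw [Set.indicator_of_mem (show x ∈ f ⁻¹' A from hxA), Set.indicator_of_mem hxA, h x hx]
    · rw [Set.indicator_of_notMem (show x ∉ f ⁻¹' A from hxA), Set.indicator_of_notMem hxA,
        mul_zero]
  · rw [Set.indicator_of_notMem hx]
    by_cases hxA : f x ∈ A
    · rw [Set.indicator_of_mem (show x ∈ f ⁻¹' A from hxA), h0 x hx]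
    · rw [Set.indicator_of_notMem (show x ∉ f ⁻¹' A from hxA)]

/-- The density `1 / |w|²` of the invariant measure. -/
def haarDensity (w : ℂ) : ENNReal := ENNReal.ofReal ((‖w‖ ^ 2)⁻¹)

/-- The measure `d²w / |w|²`, invariant under the multiplicative group. -/
def mulHaar : Measure ℂ := volume.withDensity haarDensity

theorem measurable_haarDensity : Measurable haarDensity := by
  unfold haarDensity; fun_prop

theorem haarDensity_zero : haarDensity 0 = 0 := by simp [haarDensity]

theorem lintegral_mulHaar (f : ℂ → ENNReal) :
    ∫⁻ w, f w ∂mulHaar = ∫⁻ w, haarDensity w * f w := by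
  rw [mulHaar, lintegral_withDensity_eq_lintegral_mul_non_measurable _ measurable_haarDensity
    (Eventually.of_forall fun w => ENNReal.ofReal_lt_top)]
  rfl

instance : SFinite mulHaar := by unfold mulHaar; infer_instance

theorem mulHaar_absolutelyContinuous : mulHaar ≪ volume := withDensity_absolutelyContinuous _ _

theorem ae_mulHaar_ne (a : ℂ) : ∀ᵐ w ∂mulHaar, w ≠ a :=
  mulHaar_absolutelyContinuous.ae_le (Measure.ae_ne volume a)

theorem measurePreserving_const_mul {a : ℂ} (ha : a ≠ 0) :
    MeasurePreserving (fun w => a * w) mulHaar mulHaar := by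
  refine measurePreserving_of_hasDerivAt (s := {0}ᶜ) (f' := fun _ => a)
    (measurableSet_singleton _).compl
    (fun x _ => by simpa using (hasDerivAt_id x).const_mul a)
    (fun x _ y _ h => mul_left_cancel₀ ha h) ?_ (by fun_prop) (fun x hx => ?_) fun x hx => ?_
  · filter_upwards [Measure.ae_ne volume (0 : ℂ)] with y hy
    exact ⟨a⁻¹ * y, by simp [ha, hy], by simp [ha]⟩
  · rw [Set.notMem_compl_iff, Set.mem_singleton_iff] at hx
    rw [hx, haarDensity_zero]
  · have : 0 < ‖a‖ := norm_pos_iff.2 ha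
    rw [haarDensity, haarDensity, ← ENNReal.ofReal_mul (by positivity), norm_mul]
    congr 1
    field_simp

theorem measurePreserving_inv : MeasurePreserving (fun w : ℂ => w⁻¹) mulHaar mulHaar := by
  refine measurePreserving_of_hasDerivAt (s := {0}ᶜ) (f' := fun x => -(x ^ 2)⁻¹)
    (measurableSet_singleton _).compl
    (fun x hx => hasDerivAt_inv hx) inv_injective.injOn ?_ (by fun_prop) (fun x hx => ?_)
    fun x hx => ?_
  · filter_upwards [Measure.ae_ne volume (0 : ℂ)] with y hy
    exact ⟨y⁻¹, by simp [hy], by simp⟩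
  · rw [Set.notMem_compl_iff, Set.mem_singleton_iff] at hx
    rw [hx, haarDensity_zero]
  · have : 0 < ‖x‖ := norm_pos_iff.2 hx
    rw [haarDensity, haarDensity, ← ENNReal.ofReal_mul (by positivity), norm_neg, norm_inv,
      norm_inv, norm_pow]
    congr 1
    field_simp

theorem ae_mem_slitPlane : ∀ᵐ w : ℂ, w ∈ slitPlane := by
  have h : volume ((LinearMap.ker imLm : Submodule ℝ ℂ) : Set ℂ) = 0 := by
    refine Measure.addHaar_submodule _ _ fun h => ?_
    have : I ∈ LinearMap.ker imLm := h ▸ Submodule.mem_top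
    simp at this
  filter_upwards [measure_eq_zero_iff_ae_notMem.1 h] with w hw
  exact Or.inr hw

/-- Logarithmic polar coordinates on the punctured plane. -/
theorem measurePreserving_exp :
    MeasurePreserving (fun p : ℝ × ℝ => cexp (p.1 + p.2 * I))
      ((volume : Measure ℝ).prod (volume.restrict (Set.Ioo (-Real.pi) Real.pi))) mulHaar := by
  have hstrip : MeasurableSet {w : ℂ | w.im ∈ Set.Ioo (-Real.pi) Real.pi} :=
    measurable_im measurableSet_Ioo
  have h1 : MeasurePreserving cexp (volume.restrict {w : ℂ | w.im ∈ Set.Ioo (-Real.pi) Real.pi})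
      mulHaar := by
    rw [← withDensity_indicator_one hstrip]
    refine measurePreserving_of_hasDerivAt hstrip (fun x _ => Complex.hasDerivAt_exp x) ?_ ?_
      (by fun_prop) (fun x hx => Set.indicator_of_notMem hx _) fun x hx => ?_
    · intro x hx y hy h
      exact exp_inj_of_neg_pi_lt_of_le_pi hx.1 hx.2.le hy.1 hy.2.le h
    · filter_upwards [ae_mem_slitPlane] with w hw
      refine ⟨log w, ⟨neg_pi_lt_log_im w, ?_⟩, exp_log (slitPlane_ne_zero hw)⟩
      rw [log_im]
      exact lt_of_le_of_ne (arg_le_pi w) (mem_slitPlane_iff_arg.1 hw).1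
    · rw [Set.indicator_of_mem hx, haarDensity, ← ENNReal.ofReal_mul (by positivity),
        mul_inv_cancel₀ (by simp), ENNReal.ofReal_one, Pi.one_apply]
  have h2 : MeasurePreserving measurableEquivRealProd.symm
      ((volume : Measure ℝ).prod (volume.restrict (Set.Ioo (-Real.pi) Real.pi)))
      (volume.restrict {w : ℂ | w.im ∈ Set.Ioo (-Real.pi) Real.pi}) := by
    have h3 := (volume_preserving_equiv_real_prod.symm measurableEquivRealProd).restrict_preimage
      hstrip
    convert! h3 using 1
    have h4 := Measure.prod_restrict (μ := (volume : Measure ℝ)) (ν := (volume : Measure ℝ))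
      Set.univ (Set.Ioo (-Real.pi) Real.pi)
    rw [Measure.restrict_univ] at h4
    rw [h4]
    congr 1
    ext p
    simp [measurableEquivRealProd]
  have h5 := h1.comp h2
  convert! h5 using 1
  ext p
  simp only [Function.comp_apply]
  congr 1
  apply Complex.ext <;> simp [measurableEquivRealProd]

/-! ### Iterated convolutions of the propagator -/

/-- The propagator `|w|^c / |1 - w|^{2c}` in multiplicative coordinates. -/
def propagator (c : ℝ) (w : ℂ) : ℝ := ‖w‖ ^ c * ‖1 - w‖ ^ (-(2 * c))

theorem propagator_nonneg (c : ℝ) (w : ℂ) : 0 ≤ propagator c w := by unfold propagator; positivity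

theorem measurable_propagator (c : ℝ) : Measurable (propagator c) := by
  unfold propagator; fun_prop

theorem propagator_inv (c : ℝ) (w : ℂ) : propagator c w⁻¹ = propagator c w := by
  by_cases hw : w = 0
  · simp [hw]
  have hw' : 0 < ‖w‖ := norm_pos_iff.2 hw
  have : ‖1 - w⁻¹‖ = ‖1 - w‖ * ‖w‖⁻¹ := by
    rw [← norm_inv, ← norm_mul, norm_sub_rev, sub_mul, one_mul, mul_inv_cancel₀ hw]
  rw [propagator, propagator, this, norm_inv, Real.mul_rpow (norm_nonneg _) (by positivity),
    Real.inv_rpow hw'.le, Real.inv_rpow hw'.le, ← Real.rpow_neg hw'.le, ← Real.rpow_neg hw'.le,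
    neg_neg, mul_left_comm, ← Real.rpow_add hw', mul_comm]
  ring_nf

/-- The `L`-fold convolution of the propagator with itself, with respect to the invariant measure:
the ladder integral in multiplicative coordinates. -/
def iterPropagator (c : ℝ) : ℕ → ℂ → ENNReal
  | 0 => fun z => ENNReal.ofReal (propagator c z)
  | L + 1 => fun z => ∫⁻ w, ENNReal.ofReal (propagator c (z / w)) * iterPropagator c L w ∂mulHaar

theorem iterPropagator_zero (c : ℝ) (z : ℂ) :
    iterPropagator c 0 z = ENNReal.ofReal (propagator c z) := rfl

theorem iterPropagator_succ (c : ℝ) (L : ℕ) (z : ℂ) : iterPropagator c (L + 1) z =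
    ∫⁻ w, ENNReal.ofReal (propagator c (z / w)) * iterPropagator c L w ∂mulHaar := rfl

theorem measurable_iterPropagator (c : ℝ) (L : ℕ) : Measurable (iterPropagator c L) := by
  induction L with
  | zero => exact (measurable_propagator c).ennreal_ofReal
  | succ L ih =>
    refine Measurable.lintegral_prod_right' (f := fun p : ℂ × ℂ =>
      ENNReal.ofReal (propagator c (p.1 / p.2)) * iterPropagator c L p.2) ?_
    exact (((measurable_propagator c).comp (measurable_fst.div measurable_snd)).ennreal_ofReal).mul
      (ih.comp measurable_snd)

/-- The propagator behaves like `|w|^c` at `0` and like `|w|^{-c}` at infinity, and its singularity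
`|1 - w|^{-2c}` at `1` is integrable in the plane as `c < 1`. -/
theorem integrable_propagator {c : ℝ} (hc : 0 < c) (hc1 : c < 1) :
    Integrable fun w : ℂ => (‖w‖ ^ 2)⁻¹ * propagator c w := by
  set h : ℂ → ℝ := fun w => (‖w‖ ^ 2)⁻¹ * propagator c w with hh
  have hm : Measurable h := by
    have := measurable_propagator c
    fun_prop
  have heq : ∀ w : ℂ, w ≠ 0 → h w = ‖w‖ ^ (-(2 - c)) * ‖1 - w‖ ^ (-(2 * c)) := by
    intro w hw
    have hw' : 0 < ‖w‖ := norm_pos_iff.2 hw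
    rw [hh]
    simp only [propagator]
    rw [← mul_assoc, ← Real.rpow_natCast, ← Real.rpow_neg hw'.le, ← Real.rpow_add hw']
    congr 2
    push_cast
    ring
  have hn : ∀ w, ‖h w‖ = h w := fun w =>
    Real.norm_of_nonneg (mul_nonneg (by positivity) (propagator_nonneg c w))
  have hfin : ((Module.finrank ℝ ℂ : ℕ) : ℝ) = 2 := by rw [finrank_real_complex]; norm_num
  have hfar : ∀ (x : ℝ) (s : ℝ), 0 ≤ s → 1 / 2 ≤ x → x ^ (-s) ≤ (1 / 2 : ℝ) ^ (-s) := fun x s hs hx =>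
    Real.rpow_le_rpow_of_nonpos (by norm_num) hx (by linarith)
  have h0 : IntegrableOn h (Metric.ball 0 (1 / 2)) := by
    refine integrableOn_ball_of_norm_le_rpow (α := 2 - c) (C := (1 / 2 : ℝ) ^ (-(2 * c)))
      (by rw [finrank_real_complex]; norm_num) (by rw [hfin]; linarith) ?_
      hm.aestronglyMeasurable
    filter_upwards [ae_restrict_mem Metric.isOpen_ball.measurableSet,
      ae_restrict_of_ae (Measure.ae_ne volume (0 : ℂ))] with w hw hw0
    rw [hn, heq w hw0, mul_comm]
    have h1 : 1 / 2 ≤ ‖1 - w‖ := by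
      have h2 := norm_sub_norm_le (1 : ℂ) w
      rw [mem_ball_zero_iff] at hw
      rw [norm_one] at h2
      linarith
    exact mul_le_mul_of_nonneg_right (hfar _ _ (by linarith) h1) (by positivity)
  have h1 : IntegrableOn h (Metric.ball 1 (1 / 2)) := by
    have hp := Measure.measurePreserving_sub_left (volume : Measure ℂ) 1
    have hpre : (fun w : ℂ => 1 - w) ⁻¹' Metric.ball 1 (1 / 2) = Metric.ball 0 (1 / 2) := by
      ext w; simp [dist_eq_norm]
    rw [← hp.integrableOn_comp_preimage (MeasurableEquiv.subLeft (1 : ℂ)).measurableEmbedding, hpre]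
    refine integrableOn_ball_of_norm_le_rpow (α := 2 * c) (C := (1 / 2 : ℝ) ^ (-(2 - c)))
      (by rw [finrank_real_complex]; norm_num) (by rw [hfin]; linarith) ?_
      (hm.comp (by fun_prop)).aestronglyMeasurable
    filter_upwards [ae_restrict_mem Metric.isOpen_ball.measurableSet] with w hw
    rw [mem_ball_zero_iff] at hw
    have h2 : 1 / 2 ≤ ‖1 - w‖ := by
      have h2 := norm_sub_norm_le (1 : ℂ) w
      rw [norm_one] at h2
      linarith
    rw [Function.comp_apply, hn, heq _ (norm_pos_iff.1 (by linarith)), sub_sub_cancel]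
    exact mul_le_mul_of_nonneg_right (hfar _ _ (by linarith) h2) (by positivity)
  have h2 : IntegrableOn h (Metric.ball 0 (1 / 2) ∪ Metric.ball 1 (1 / 2))ᶜ := by
    refine Integrable.mono' (((integrable_one_add_norm (E := ℂ) (μ := volume) (r := 2 + c)
      (by rw [hfin]; linarith)).const_mul ((3 : ℝ) ^ (2 - c) * 5 ^ (2 * c))).integrableOn)
      hm.aestronglyMeasurable ?_
    filter_upwards [ae_restrict_mem
      (Metric.isOpen_ball.union Metric.isOpen_ball).measurableSet.compl] with w hw
    rw [Set.compl_union] at hw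
    have hw0 : 1 / 2 ≤ ‖w‖ := by simpa using hw.1
    have hw1 : 1 / 2 ≤ ‖1 - w‖ := by
      have := hw.2
      rw [Set.mem_compl_iff, Metric.mem_ball, dist_eq_norm, norm_sub_rev] at this
      linarith
    have hwp : 0 < ‖w‖ := by linarith
    have e1 : (1 + ‖w‖) / 3 ≤ ‖w‖ := by linarith
    have e2 : (1 + ‖w‖) / 5 ≤ ‖1 - w‖ := by
      have h3 := norm_sub_norm_le w 1
      rw [norm_one, norm_sub_rev] at h3
      by_cases h4 : ‖w‖ ≤ 3 / 2 <;> linarith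
    rw [hn, heq w (norm_pos_iff.1 hwp)]
    have f1 : ‖w‖ ^ (-(2 - c)) ≤ 3 ^ (2 - c) * (1 + ‖w‖) ^ (-(2 - c)) := by
      refine (Real.rpow_le_rpow_of_nonpos (by positivity) e1 (by linarith)).trans (le_of_eq ?_)
      rw [Real.div_rpow (by positivity) (by norm_num), Real.rpow_neg (by norm_num : (0 : ℝ) ≤ 3),
        div_inv_eq_mul, mul_comm]
    have f2 : ‖1 - w‖ ^ (-(2 * c)) ≤ 5 ^ (2 * c) * (1 + ‖w‖) ^ (-(2 * c)) := by
      refine (Real.rpow_le_rpow_of_nonpos (by positivity) e2 (by linarith)).trans (le_of_eq ?_)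
      rw [Real.div_rpow (by positivity) (by norm_num), Real.rpow_neg (by norm_num : (0 : ℝ) ≤ 5),
        div_inv_eq_mul, mul_comm]
    refine (mul_le_mul f1 f2 (by positivity) (by positivity)).trans (le_of_eq ?_)
    rw [show -(2 + c) = -(2 - c) + -(2 * c) by ring, Real.rpow_add (by positivity)]
    ring
  rw [← integrableOn_univ, ← Set.union_compl_self (Metric.ball (0 : ℂ) (1 / 2) ∪ Metric.ball 1 (1 / 2))]
  exact (h0.union h1).union h2

/-- The mass of the propagator. -/
def propagatorMass (c : ℝ) : ENNReal := ∫⁻ w, ENNReal.ofReal (propagator c w) ∂mulHaar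

theorem propagatorMass_lt_top {c : ℝ} (hc : 0 < c) (hc1 : c < 1) : propagatorMass c < ⊤ := by
  rw [propagatorMass, lintegral_mulHaar]
  have := (integrable_propagator hc hc1).lintegral_lt_top
  refine lt_of_eq_of_lt (lintegral_congr fun w => ?_) this
  rw [haarDensity, ← ENNReal.ofReal_mul (by positivity)]

theorem rpow_mul_rpow_le {a b d s : ℝ} (hs : 0 ≤ s) (ha : 0 < a) (hb : 0 < b) (hd : 0 < d)
    (h : d ≤ a + b) :
    a ^ (-s) * b ^ (-s) ≤ 2 ^ s * d ^ (-s) * (a ^ (-s) + b ^ (-s)) := by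
  have key : ∀ x : ℝ, d / 2 ≤ x → x ^ (-s) ≤ 2 ^ s * d ^ (-s) := fun x hx => by
    refine (Real.rpow_le_rpow_of_nonpos (by positivity) hx (by linarith)).trans (le_of_eq ?_)
    rw [Real.div_rpow hd.le (by norm_num), Real.rpow_neg (by norm_num : (0 : ℝ) ≤ 2),
      div_inv_eq_mul, mul_comm]
  have hA : 0 < a ^ (-s) := by positivity
  have hB : 0 < b ^ (-s) := by positivity
  have hD : 0 < 2 ^ s * d ^ (-s) := by positivity
  rcases le_total a b with hab | hab
  · have := key b (by linarith)
    nlinarith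
  · have := key a (by linarith)
    nlinarith

/-- The triangle inequality bounds a product of two propagators by a sum. -/
theorem propagator_mul_le {c : ℝ} (hc : 0 < c) {x w : ℂ} (hx : x ≠ 0) (hx1 : x ≠ 1) (hw : w ≠ 0) :
    propagator c (x / w) * ‖1 - w‖ ^ (-(2 * c)) ≤
      2 ^ (2 * c) * ‖1 - x‖ ^ (-(2 * c)) *
        (propagator c (x⁻¹ * w) + ‖x‖ ^ c * propagator c w) := by
  have hxp : 0 < ‖x‖ := norm_pos_iff.2 hx
  have hwp : 0 < ‖w‖ := norm_pos_iff.2 hw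
  have e1 : propagator c (x / w) = ‖x‖ ^ c * ‖w‖ ^ c * ‖x - w‖ ^ (-(2 * c)) := by
    have h1 : ‖1 - x / w‖ = ‖x - w‖ * ‖w‖⁻¹ := by
      rw [← norm_inv, ← norm_mul, norm_sub_rev]
      congr 1; field_simp
    rw [propagator, h1, norm_div, Real.div_rpow hxp.le hwp.le, Real.mul_rpow (by positivity)
      (by positivity), Real.inv_rpow hwp.le, ← Real.rpow_neg hwp.le, neg_neg, two_mul,
      Real.rpow_add hwp]
    have : ‖w‖ ^ c ≠ 0 := by positivity
    field_simp
  have e2 : propagator c (x⁻¹ * w) = ‖x‖ ^ c * ‖w‖ ^ c * ‖x - w‖ ^ (-(2 * c)) := by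
    rw [← e1, ← propagator_inv, mul_inv, inv_inv, div_eq_mul_inv]
  by_cases hw1 : w = 1
  · rw [hw1, sub_self, norm_zero, Real.zero_rpow (by linarith), mul_zero]
    have := propagator_nonneg c
    positivity [this (x⁻¹ * 1), this 1]
  by_cases hwx : x = w
  · rw [e1, hwx, sub_self, norm_zero, Real.zero_rpow (by linarith), mul_zero, zero_mul]
    have := propagator_nonneg c
    positivity [this (w⁻¹ * w), this w]
  have key := rpow_mul_rpow_le (s := 2 * c) (by linarith) (norm_pos_iff.2 (sub_ne_zero.2 hwx))
    (norm_pos_iff.2 (sub_ne_zero.2 (Ne.symm hw1))) (norm_pos_iff.2 (sub_ne_zero.2 (Ne.symm hx1)))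
    (show ‖1 - x‖ ≤ ‖x - w‖ + ‖1 - w‖ by
      rw [norm_sub_rev x w, add_comm]
      simpa using norm_add_le (1 - w) (w - x))
  rw [e1, e2, propagator]
  have := mul_le_mul_of_nonneg_left key (show 0 ≤ ‖x‖ ^ c * ‖w‖ ^ c by positivity)
  refine le_trans (le_of_eq ?_) (this.trans (le_of_eq ?_)) <;> ring

/-- A function which dominates its own convolution with the propagator, up to a constant. -/
def envelope (c : ℝ) (w : ℂ) : ENNReal :=
  ENNReal.ofReal (‖1 - w‖ ^ (-(2 * c))) + ENNReal.ofReal (‖1 - w⁻¹‖ ^ (-(2 * c)))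

theorem norm_one_sub_inv_rpow (c : ℝ) {w : ℂ} (hw : w ≠ 0) :
    ‖1 - w⁻¹‖ ^ (-(2 * c)) = (‖w‖ ^ c) ^ 2 * ‖1 - w‖ ^ (-(2 * c)) := by
  have hw' : 0 < ‖w‖ := norm_pos_iff.2 hw
  have : ‖1 - w⁻¹‖ = ‖1 - w‖ * ‖w‖⁻¹ := by
    rw [← norm_inv, ← norm_mul, norm_sub_rev, sub_mul, one_mul, mul_inv_cancel₀ hw]
  rw [this, Real.mul_rpow (norm_nonneg _) (by positivity), Real.inv_rpow hw'.le,
    ← Real.rpow_neg hw'.le, neg_neg, two_mul, Real.rpow_add hw']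
  ring

theorem lintegral_propagator_mul_le {c : ℝ} (hc : 0 < c) {x : ℂ} (hx : x ≠ 0) (hx1 : x ≠ 1) :
    ∫⁻ w, ENNReal.ofReal (propagator c (x / w)) * ENNReal.ofReal (‖1 - w‖ ^ (-(2 * c))) ∂mulHaar ≤
      2 * (ENNReal.ofReal (2 ^ (2 * c)) * propagatorMass c) * envelope c x := by
  have hm := measurable_propagator c
  have hP := propagator_nonneg c
  have hbound : ∫⁻ w, ENNReal.ofReal (propagator c (x / w)) *
      ENNReal.ofReal (‖1 - w‖ ^ (-(2 * c))) ∂mulHaar ≤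
      ∫⁻ w, ENNReal.ofReal (2 ^ (2 * c) * ‖1 - x‖ ^ (-(2 * c))) *
        (ENNReal.ofReal (propagator c (x⁻¹ * w)) +
          ENNReal.ofReal (‖x‖ ^ c) * ENNReal.ofReal (propagator c w)) ∂mulHaar := by
    refine lintegral_mono_ae ?_
    filter_upwards [ae_mulHaar_ne 0] with w hw
    rw [← ENNReal.ofReal_mul (hP _), ← ENNReal.ofReal_mul (by positivity),
      ← ENNReal.ofReal_add (hP _) (mul_nonneg (by positivity) (hP _)),
      ← ENNReal.ofReal_mul (by positivity)]
    exact ENNReal.ofReal_le_ofReal (propagator_mul_le hc hx hx1 hw)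
  have h1 : ∫⁻ w, ENNReal.ofReal (propagator c (x⁻¹ * w)) ∂mulHaar = propagatorMass c :=
    (measurePreserving_const_mul (inv_ne_zero hx)).lintegral_comp hm.ennreal_ofReal
  refine hbound.trans ?_
  rw [lintegral_const_mul _ (by fun_prop), lintegral_add_left (by fun_prop),
    lintegral_const_mul _ (by fun_prop), h1, ← propagatorMass, envelope, norm_one_sub_inv_rpow c hx]
  set t := ‖x‖ ^ c
  set y := ‖1 - x‖ ^ (-(2 * c))
  have ht : 0 ≤ t := by positivity
  have hy : 0 ≤ y := by positivity
  have key : ENNReal.ofReal y * (1 + ENNReal.ofReal t) ≤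
      2 * (ENNReal.ofReal y + ENNReal.ofReal (t ^ 2 * y)) := by
    rw [← ENNReal.ofReal_one, ← ENNReal.ofReal_add zero_le_one ht, ← ENNReal.ofReal_mul hy,
      ← ENNReal.ofReal_add hy (by positivity), show (2 : ENNReal) = ENNReal.ofReal 2 by simp,
      ← ENNReal.ofReal_mul (by norm_num)]
    refine ENNReal.ofReal_le_ofReal ?_
    nlinarith [mul_nonneg hy (sq_nonneg (t - 1)), mul_nonneg hy (sq_nonneg (2 * t - 1))]
  rw [ENNReal.ofReal_mul (by positivity)]
  calc _ = ENNReal.ofReal (2 ^ (2 * c)) * propagatorMass c *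
      (ENNReal.ofReal y * (1 + ENNReal.ofReal t)) := by ring
    _ ≤ ENNReal.ofReal (2 ^ (2 * c)) * propagatorMass c *
      (2 * (ENNReal.ofReal y + ENNReal.ofReal (t ^ 2 * y))) := by gcongr
    _ = _ := by ring

theorem lintegral_propagator_mul_envelope_le {c : ℝ} (hc : 0 < c) {x : ℂ} (hx : x ≠ 0)
    (hx1 : x ≠ 1) :
    ∫⁻ w, ENNReal.ofReal (propagator c (x / w)) * envelope c w ∂mulHaar ≤
      4 * (ENNReal.ofReal (2 ^ (2 * c)) * propagatorMass c) * envelope c x := by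
  have hm := measurable_propagator c
  have h1 := lintegral_propagator_mul_le hc hx hx1
  have h2 := lintegral_propagator_mul_le hc (inv_ne_zero hx) (inv_ne_one.2 hx1)
  have h3 := measurePreserving_inv.lintegral_comp (f := fun w =>
    ENNReal.ofReal (propagator c (x * w)) * ENNReal.ofReal (‖1 - w‖ ^ (-(2 * c)))) (by fun_prop)
  have h4 : ∫⁻ w, ENNReal.ofReal (propagator c (x / w)) *
      ENNReal.ofReal (‖1 - w⁻¹‖ ^ (-(2 * c))) ∂mulHaar ≤
      2 * (ENNReal.ofReal (2 ^ (2 * c)) * propagatorMass c) * envelope c x := by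
    simp only [div_eq_mul_inv]
    rw [h3]
    convert! h2 using 1
    · refine lintegral_congr fun w => ?_
      rw [← propagator_inv, mul_inv, div_eq_mul_inv]
    · rw [envelope, envelope, inv_inv, add_comm (ENNReal.ofReal (‖1 - x‖ ^ (-(2 * c))))]
  simp only [envelope, mul_add] at h1 h4 ⊢
  rw [lintegral_add_left (by fun_prop)]
  refine (add_le_add h1 h4).trans (le_of_eq ?_)
  ring

theorem iterPropagator_le {c : ℝ} (hc : 0 < c) (L : ℕ) {z : ℂ} (hz : z ≠ 0) (hz1 : z ≠ 1) :
    iterPropagator c L z ≤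
      (4 * (ENNReal.ofReal (2 ^ (2 * c)) * propagatorMass c)) ^ L * envelope c z := by
  induction L generalizing z with
  | zero =>
    change ENNReal.ofReal (‖z‖ ^ c * ‖1 - z‖ ^ (-(2 * c))) ≤ _
    rw [pow_zero, one_mul, envelope, ← ENNReal.ofReal_add (by positivity) (by positivity),
      norm_one_sub_inv_rpow c hz]
    refine ENNReal.ofReal_le_ofReal ?_
    have : 0 ≤ ‖1 - z‖ ^ (-(2 * c)) := by positivity
    nlinarith [mul_nonneg this (sq_nonneg (‖z‖ ^ c - 1)), mul_nonneg this (sq_nonneg (‖z‖ ^ c))]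
  | succ L ih =>
    set B := 4 * (ENNReal.ofReal (2 ^ (2 * c)) * propagatorMass c)
    have hm := measurable_propagator c
    calc _ ≤ ∫⁻ w, B ^ L * (ENNReal.ofReal (propagator c (z / w)) * envelope c w) ∂mulHaar := by
          refine lintegral_mono_ae ?_
          filter_upwards [ae_mulHaar_ne 0, ae_mulHaar_ne 1] with w hw hw1
          refine (mul_le_mul_right (ih hw hw1) _).trans (le_of_eq ?_)
          ring
      _ = B ^ L * ∫⁻ w, ENNReal.ofReal (propagator c (z / w)) * envelope c w ∂mulHaar :=
          lintegral_const_mul _ (by unfold envelope; fun_prop)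
      _ ≤ B ^ L * (B * envelope c z) :=
          mul_le_mul_right (lintegral_propagator_mul_envelope_le hc hz hz1) _
      _ = _ := by ring

theorem iterPropagator_lt_top {c : ℝ} (hc : 0 < c) (hc1 : c < 1) (L : ℕ) {z : ℂ} (hz : z ≠ 0)
    (hz1 : z ≠ 1) : iterPropagator c L z < ⊤ := by
  refine (iterPropagator_le hc L hz hz1).trans_lt (ENNReal.mul_lt_top (ENNReal.pow_lt_top ?_) ?_)
  · exact ENNReal.mul_lt_top (by simp)
      (ENNReal.mul_lt_top ENNReal.ofReal_lt_top (propagatorMass_lt_top hc hc1))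
  · exact ENNReal.add_lt_top.2 ⟨ENNReal.ofReal_lt_top, ENNReal.ofReal_lt_top⟩

/-! ### The ladder integral in multiplicative coordinates -/

/-- The Möbius map of the plane which takes `x₂`, `x₃`, `x₄` to `0`, `1`, `∞`. -/
def moebius (x₂ x₃ x₄ p : ℂ) : ℂ := (x₄ - x₃) / (x₃ - x₂) * ((p - x₂) / (x₄ - p))

theorem zVar_eq {x₁ x₂ x₃ x₄ : ℂ} (h12 : x₁ ≠ x₂) (h14 : x₁ ≠ x₄) (h23 : x₂ ≠ x₃) (h24 : x₂ ≠ x₄) :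
    zVar x₁ x₂ x₃ x₄ = conj (moebius x₂ x₃ x₄ x₁) := by
  have e1 := sub_ne_zero.2 h12
  have e2 := sub_ne_zero.2 h14.symm
  have e3 := sub_ne_zero.2 h23.symm
  have e4 := sub_ne_zero.2 h24.symm
  simp only [zVar, inversion, moebius]
  rw [← map_inv₀, ← map_inv₀, ← map_inv₀, ← map_sub, ← map_sub, ← map_div₀]
  congr 1
  have h5 : (x₁ - x₂)⁻¹ - (x₄ - x₂)⁻¹ = (x₄ - x₁) / ((x₁ - x₂) * (x₄ - x₂)) := by
    field_simp; ring
  have h6 : (x₃ - x₂)⁻¹ - (x₄ - x₂)⁻¹ = (x₄ - x₃) / ((x₃ - x₂) * (x₄ - x₂)) := by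
    field_simp; ring
  rw [h5, h6]
  field_simp

/-- The density which the Möbius map takes to the invariant measure. -/
def moebiusDensity (x₂ x₄ p : ℂ) : ENNReal :=
  ENNReal.ofReal (‖x₄ - x₂‖ ^ 2 / (‖p - x₂‖ ^ 2 * ‖x₄ - p‖ ^ 2))

theorem measurePreserving_moebius {x₂ x₃ x₄ : ℂ} (h23 : x₂ ≠ x₃) (h24 : x₂ ≠ x₄) (h34 : x₃ ≠ x₄) :
    MeasurePreserving (moebius x₂ x₃ x₄) (volume.withDensity (moebiusDensity x₂ x₄)) mulHaar := by
  have e3 := sub_ne_zero.2 h23.symm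
  have e4 := sub_ne_zero.2 h24.symm
  have e5 := sub_ne_zero.2 h34.symm
  set C : ℂ := (x₄ - x₃) / (x₃ - x₂) with hC
  have hC0 : C ≠ 0 := div_ne_zero e5 e3
  refine measurePreserving_of_hasDerivAt (s := {x₂}ᶜ ∩ {x₄}ᶜ)
    (f' := fun p => C * (x₄ - x₂) / (x₄ - p) ^ 2)
    ((measurableSet_singleton _).compl.inter (measurableSet_singleton _).compl) ?_ ?_ ?_ ?_ ?_ ?_
  · rintro p ⟨-, hp⟩
    have hp' : x₄ - p ≠ 0 := sub_ne_zero.2 fun h => hp (by simp [h])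
    have := (((hasDerivAt_id p).sub_const x₂).div ((hasDerivAt_id p).const_sub x₄) hp').const_mul C
    convert! this using 1
    simp only [id]
    rw [mul_div_assoc]
    congr 2
    ring
  · rintro p ⟨-, hp⟩ q ⟨-, hq⟩ h
    have hp' : x₄ - p ≠ 0 := sub_ne_zero.2 fun h => hp (by simp [h])
    have hq' : x₄ - q ≠ 0 := sub_ne_zero.2 fun h => hq (by simp [h])
    have h1 := mul_left_cancel₀ hC0 h
    rw [div_eq_div_iff hp' hq'] at h1
    have h2 : (x₄ - x₂) * (p - q) = 0 := by linear_combination h1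
    exact sub_eq_zero.1 ((mul_eq_zero.1 h2).resolve_left e4)
  · filter_upwards [Measure.ae_ne volume (0 : ℂ), Measure.ae_ne volume (-C)] with w hw hw'
    have hw1 : C + w ≠ 0 := fun h => hw' (by linear_combination h)
    have h1 : (w * x₄ + C * x₂) / (C + w) - x₂ = w * (x₄ - x₂) / (C + w) := by
      field_simp; ring
    have h2 : x₄ - (w * x₄ + C * x₂) / (C + w) = C * (x₄ - x₂) / (C + w) := by
      field_simp; ring
    refine ⟨(w * x₄ + C * x₂) / (C + w), ⟨fun h => ?_, fun h => ?_⟩, ?_⟩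
    · rw [Set.mem_singleton_iff, ← sub_eq_zero, h1] at h
      exact div_ne_zero (mul_ne_zero hw e4) hw1 h
    · rw [Set.mem_singleton_iff, eq_comm, ← sub_eq_zero, h2] at h
      exact div_ne_zero (mul_ne_zero hC0 e4) hw1 h
    · rw [moebius, h1, h2, ← hC]
      field_simp
  · unfold moebius; fun_prop
  · intro p hp
    rw [moebiusDensity]
    by_cases h2 : p = x₂
    · simp [h2]
    · have : p = x₄ := by
        by_contra h4
        exact hp ⟨h2, h4⟩
      simp [this]
  · rintro p ⟨hp2, hp⟩
    have hp' : 0 < ‖x₄ - p‖ := norm_pos_iff.2 (sub_ne_zero.2 fun h => hp (by simp [h]))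
    have hp2' : 0 < ‖p - x₂‖ := norm_pos_iff.2 (sub_ne_zero.2 fun h => hp2 (by simp [h]))
    have hCn : 0 < ‖C‖ := norm_pos_iff.2 hC0
    rw [moebiusDensity, haarDensity, ← ENNReal.ofReal_mul (by positivity), moebius, ← hC]
    congr 1
    rw [norm_div, norm_mul, norm_mul, norm_div, norm_pow, norm_div]
    field_simp

/-- The conformal weight which relates the propagators of the two coordinates. -/
def confWeight (c : ℝ) (x₂ x₄ p : ℂ) : ℝ := (‖p - x₂‖ * ‖x₄ - p‖ / ‖x₄ - x₂‖) ^ c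

theorem propagator_moebius (c : ℝ) {x₂ x₃ x₄ x p : ℂ} (h23 : x₂ ≠ x₃) (h24 : x₂ ≠ x₄)
    (h34 : x₃ ≠ x₄) (hx2 : x ≠ x₂) (hx4 : x ≠ x₄) (hp2 : p ≠ x₂) (hp4 : p ≠ x₄) :
    propagator c (moebius x₂ x₃ x₄ x / moebius x₂ x₃ x₄ p) =
      confWeight c x₂ x₄ x * confWeight c x₂ x₄ p * ‖x - p‖ ^ (-(2 * c)) := by
  have e3 := sub_ne_zero.2 h23.symm
  have e4 := sub_ne_zero.2 h24.symm
  have e5 := sub_ne_zero.2 h34.symm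
  have f1 := sub_ne_zero.2 hx2
  have f2 := sub_ne_zero.2 hx4.symm
  have f3 := sub_ne_zero.2 hp2
  have f4 := sub_ne_zero.2 hp4.symm
  have g1 : moebius x₂ x₃ x₄ x / moebius x₂ x₃ x₄ p =
      ((x - x₂) * (x₄ - p)) / ((x₄ - x) * (p - x₂)) := by
    rw [moebius, moebius]; field_simp
  have g2 : 1 - ((x - x₂) * (x₄ - p)) / ((x₄ - x) * (p - x₂)) =
      (x₄ - x₂) * (p - x) / ((x₄ - x) * (p - x₂)) := by
    field_simp; ring
  have n0 := norm_pos_iff.2 e4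
  have n1 := norm_pos_iff.2 f1
  have n2 := norm_pos_iff.2 f2
  have n3 := norm_pos_iff.2 f3
  have n4 := norm_pos_iff.2 f4
  rw [g1, propagator, g2, norm_div, norm_div, norm_mul, norm_mul, norm_mul, norm_sub_rev p x,
    confWeight, confWeight]
  set a := ‖x - x₂‖
  set b := ‖x₄ - p‖
  set d := ‖x₄ - x‖
  set e := ‖p - x₂‖
  set D := ‖x₄ - x₂‖
  have hy := norm_nonneg (x - p)
  set y := ‖x - p‖
  rw [Real.div_rpow (by positivity) (by positivity), Real.div_rpow (by positivity) (by positivity),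
    Real.div_rpow (by positivity) (by positivity), Real.div_rpow (by positivity) (by positivity),
    Real.mul_rpow n1.le n4.le, Real.mul_rpow n2.le n3.le, Real.mul_rpow n0.le hy,
    Real.mul_rpow n2.le n3.le, Real.mul_rpow n1.le n2.le, Real.mul_rpow n3.le n4.le]
  have hneg : ∀ t : ℝ, 0 < t → t ^ (-(2 * c)) = ((t ^ c) ^ 2)⁻¹ := fun t ht => by
    rw [Real.rpow_neg ht.le, two_mul, Real.rpow_add ht, sq]
  rw [hneg D n0, hneg d n2, hneg e n3]
  have m0 : D ^ c ≠ 0 := by positivity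
  have m1 : a ^ c ≠ 0 := by positivity
  have m2 : d ^ c ≠ 0 := by positivity
  have m3 : e ^ c ≠ 0 := by positivity
  have m4 : b ^ c ≠ 0 := by positivity
  field_simp

theorem sqPow_ofReal (w : ℂ) (s : ℝ) : sqPow w s = ((‖w‖ ^ (2 * s) : ℝ) : ℂ) := by
  rw [sqPow, ← ofReal_cpow (by positivity), Real.rpow_mul (norm_nonneg w), Real.rpow_two]

theorem chainPts_cons (L : ℕ) (x₁ x₃ p : ℂ) (q : Fin L → ℂ) :
    chainPts (L + 1) x₁ x₃ (Fin.cons p q) = Fin.cons x₁ (chainPts L p x₃ q) := by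
  rw [chainPts, chainPts, ← Fin.cons_snoc_eq_snoc_cons]

theorem ladderIntegrand_cons (L : ℕ) (β x₁ x₂ x₃ x₄ p : ℂ) (q : Fin L → ℂ) :
    ladderIntegrand (L + 1) β x₁ x₂ x₃ x₄ (Fin.cons p q) =
      sqPow (x₂ - p) (-β) * sqPow (x₄ - p) (-β) * sqPow (x₁ - p) (-(1 - β)) *
        ladderIntegrand L β p x₂ x₃ x₄ q := by
  rw [ladderIntegrand, chainPts_cons, Fin.prod_univ_succ, Fin.prod_univ_succ (n := L + 1),
    ladderIntegrand]
  have h0 : (Fin.cons x₁ (chainPts L p x₃ q) : Fin (L + 3) → ℂ) (Fin.succ 0) = p := by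
    simp [chainPts]
  have h1 : (Fin.cons x₁ (chainPts L p x₃ q) : Fin (L + 3) → ℂ) (Fin.castSucc 0) = x₁ := by
    simp
  rw [h0, h1]
  simp only [Fin.cons_zero, Fin.cons_succ, ← Fin.succ_castSucc]
  ring

theorem measurable_sqPow (s : ℂ) : Measurable fun w => sqPow w s := by
  unfold sqPow; fun_prop

theorem measurable_chainPts (L : ℕ) (x₃ : ℂ) :
    Measurable fun p : ℂ × (Fin L → ℂ) => chainPts L p.1 x₃ p.2 := by
  refine measurable_pi_lambda _ fun i => ?_
  refine Fin.cases ?_ (fun j => ?_) i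
  · simp only [chainPts, Fin.cons_zero]; exact measurable_fst
  · simp only [chainPts, Fin.cons_succ]
    refine Fin.lastCases ?_ (fun k => ?_) j
    · simp only [Fin.snoc_last]; exact measurable_const
    · simp only [Fin.snoc_castSucc]; exact (measurable_pi_apply k).comp measurable_snd

theorem measurable_ladderIntegrand (L : ℕ) (β x₂ x₃ x₄ : ℂ) :
    Measurable fun p : ℂ × (Fin L → ℂ) => ladderIntegrand L β p.1 x₂ x₃ x₄ p.2 := by
  have h := measurable_pi_iff.1 (measurable_chainPts L x₃)
  have hs := measurable_sqPow
  refine Measurable.mul (Finset.measurable_prod _ fun i _ => ?_)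
    (Finset.measurable_prod _ fun m _ => ?_)
  · have : Measurable fun p : ℂ × (Fin L → ℂ) => p.2 i := (measurable_pi_apply i).comp measurable_snd
    exact ((hs (-β)).comp (measurable_const.sub this)).mul
      ((hs (-β)).comp (measurable_const.sub this))
  · exact (hs _).comp ((h m.castSucc).sub (h m.succ))

/-- The integral of the absolute value of the integrand of the ladder integral. -/
def ladderMass (L : ℕ) (b : ℝ) (x₁ x₂ x₃ x₄ : ℂ) : ENNReal :=
  ∫⁻ q : Fin L → ℂ, ‖ladderIntegrand L b x₁ x₂ x₃ x₄ q‖ₑ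

theorem ladderMass_zero (b : ℝ) (x₁ x₂ x₃ x₄ : ℂ) :
    ladderMass 0 b x₁ x₂ x₃ x₄ = ENNReal.ofReal (‖x₁ - x₃‖ ^ (-(2 * (1 - b)))) := by
  have h : ∀ q, ladderIntegrand 0 b x₁ x₂ x₃ x₄ q = ((‖x₁ - x₃‖ ^ (-(2 * (1 - b))) : ℝ) : ℂ) := by
    intro q
    have h1 := sqPow_ofReal (x₁ - x₃) (-(1 - b))
    push_cast at h1
    have h2 : chainPts 0 x₁ x₃ q (Fin.castSucc 0) = x₁ := rfl
    have h3 : chainPts 0 x₁ x₃ q (Fin.succ 0) = x₃ := rfl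
    rw [ladderIntegrand, Fin.prod_univ_zero, one_mul, Fin.prod_univ_one, h2, h3, h1, mul_neg]
  rw [ladderMass]
  simp only [h]
  rw [lintegral_const, volume_pi, Measure.pi_of_empty, Measure.dirac_apply_of_mem (Set.mem_univ _),
    mul_one, ← ofReal_norm, norm_real, Real.norm_of_nonneg (by positivity)]

/-- Integration over the first vertex of the chain. -/
theorem ladderMass_succ (L : ℕ) (b : ℝ) (x₁ x₂ x₃ x₄ : ℂ) :
    ladderMass (L + 1) b x₁ x₂ x₃ x₄ =
      ∫⁻ p, ENNReal.ofReal (‖p - x₂‖ ^ (-(2 * b)) * ‖x₄ - p‖ ^ (-(2 * b)) *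
        ‖x₁ - p‖ ^ (-(2 * (1 - b)))) * ladderMass L b p x₂ x₃ x₄ := by
  have hmp := (volume_preserving_piFinSuccAbove (fun _ : Fin (L + 1) => ℂ) 0).symm
  have hm : Measurable fun q => ‖ladderIntegrand (L + 1) b x₁ x₂ x₃ x₄ q‖ₑ :=
    ((measurable_ladderIntegrand (L + 1) b x₂ x₃ x₄).comp
      (measurable_const.prodMk measurable_id : Measurable fun q => (x₁, q))).enorm
  have hcons : ∀ p : ℂ × (Fin L → ℂ),
      (MeasurableEquiv.piFinSuccAbove (fun _ : Fin (L + 1) => ℂ) 0).symm p = Fin.cons p.1 p.2 := by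
    intro p
    simp [MeasurableEquiv.piFinSuccAbove, Fin.consEquiv]
  have hfac : ∀ p, ‖sqPow (x₂ - p) (-(b : ℂ)) * sqPow (x₄ - p) (-(b : ℂ)) *
      sqPow (x₁ - p) (-(1 - (b : ℂ)))‖ₑ = ENNReal.ofReal (‖p - x₂‖ ^ (-(2 * b)) *
        ‖x₄ - p‖ ^ (-(2 * b)) * ‖x₁ - p‖ ^ (-(2 * (1 - b)))) := by
    intro p
    have h1 := fun w => sqPow_ofReal w (-b)
    have h2 := fun w => sqPow_ofReal w (-(1 - b))
    push_cast at h1 h2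
    rw [h1, h1, h2, ← ofReal_norm, norm_mul, norm_mul, norm_real, norm_real, norm_real,
      Real.norm_of_nonneg (by positivity), Real.norm_of_nonneg (by positivity),
      Real.norm_of_nonneg (by positivity), norm_sub_rev x₂ p]
    ring_nf
  rw [ladderMass, ← hmp.lintegral_comp hm, Measure.volume_eq_prod, lintegral_prod]
  · refine lintegral_congr fun p => ?_
    have hmp' : Measurable fun q => ‖ladderIntegrand L b p x₂ x₃ x₄ q‖ₑ :=
      ((measurable_ladderIntegrand L b x₂ x₃ x₄).comp
        (measurable_const.prodMk measurable_id : Measurable fun q => (p, q))).enorm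
    rw [ladderMass, ← hfac, ← lintegral_const_mul _ hmp']
    refine lintegral_congr fun q => ?_
    rw [hcons, ladderIntegrand_cons, enorm_mul]
  · exact (hm.comp (MeasurableEquiv.measurable _)).aemeasurable

/-- The ladder integral is a conformal weight times the iterated propagator. -/
theorem ladderMass_eq {b : ℝ} {x₂ x₃ x₄ : ℂ} (h23 : x₂ ≠ x₃) (h24 : x₂ ≠ x₄) (h34 : x₃ ≠ x₄)
    (L : ℕ) {x₁ : ℂ} (h12 : x₁ ≠ x₂) (h14 : x₁ ≠ x₄) :
    ladderMass L b x₁ x₂ x₃ x₄ =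
      ENNReal.ofReal (‖x₄ - x₂‖ ^ (-(2 * b * L)) /
        (confWeight (1 - b) x₂ x₄ x₁ * confWeight (1 - b) x₂ x₄ x₃)) *
        iterPropagator (1 - b) L (moebius x₂ x₃ x₄ x₁) := by
  set c := 1 - b with hc
  have hD : 0 < ‖x₄ - x₂‖ := norm_pos_iff.2 (sub_ne_zero.2 h24.symm)
  have hw : ∀ p, p ≠ x₂ → p ≠ x₄ → 0 < confWeight c x₂ x₄ p := fun p h2 h4 => by
    have h1 := norm_pos_iff.2 (sub_ne_zero.2 h2)
    have h3 := norm_pos_iff.2 (sub_ne_zero.2 h4.symm)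
    rw [confWeight]; positivity
  have hw3 := hw x₃ h23.symm h34
  have hm3 : moebius x₂ x₃ x₄ x₃ = 1 := by
    have e3 := sub_ne_zero.2 h23.symm
    have e5 := sub_ne_zero.2 h34.symm
    rw [moebius]; field_simp
  induction L generalizing x₁ with
  | zero =>
    have hk := propagator_moebius c h23 h24 h34 h12 h14 h23.symm h34
    rw [hm3, div_one] at hk
    have hw1 := hw x₁ h12 h14
    rw [ladderMass_zero, iterPropagator_zero, hk, ← ENNReal.ofReal_mul (by positivity)]
    congr 1
    rw [Nat.cast_zero, mul_zero, neg_zero, Real.rpow_zero, ← hc]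
    field_simp
  | succ L ih =>
    have hw1 := hw x₁ h12 h14
    have hmeas : Measurable fun w => ENNReal.ofReal (propagator c (moebius x₂ x₃ x₄ x₁ / w)) *
        iterPropagator c L w := by
      have h1 := measurable_propagator c
      have h2 := measurable_iterPropagator c L
      fun_prop
    have hden : Measurable (moebiusDensity x₂ x₄) := by unfold moebiusDensity; fun_prop
    have hmp := measurePreserving_moebius h23 h24 h34
    have hcomp := hmeas.comp hmp.measurable
    have hint := (lintegral_withDensity_eq_lintegral_mul volume hden hcomp).symm.trans
      (hmp.lintegral_comp hmeas)
    rw [ladderMass_succ, iterPropagator_succ, ← hint, ← lintegral_const_mul _ (hden.mul hcomp)]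
    refine lintegral_congr_ae ?_
    filter_upwards [Measure.ae_ne volume x₂, Measure.ae_ne volume x₄] with p hp2 hp4
    have hwp := hw p hp2 hp4
    rw [ih hp2 hp4, Pi.mul_apply, Function.comp_apply,
      propagator_moebius c h23 h24 h34 h12 h14 hp2 hp4, moebiusDensity, ← mul_assoc, ← mul_assoc,
      ← mul_assoc, ← ENNReal.ofReal_mul (by positivity), ← ENNReal.ofReal_mul (by positivity),
      ← ENNReal.ofReal_mul (by positivity)]
    congr 2
    have hs := norm_pos_iff.2 (sub_ne_zero.2 hp2)
    have ht := norm_pos_iff.2 (sub_ne_zero.2 hp4.symm)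
    have hsq : ‖p - x₂‖ ^ (-(2 * b)) * ‖x₄ - p‖ ^ (-(2 * b)) =
        confWeight c x₂ x₄ p ^ 2 * (‖x₄ - x₂‖ ^ 2 / (‖p - x₂‖ ^ 2 * ‖x₄ - p‖ ^ 2)) *
          ‖x₄ - x₂‖ ^ (-(2 * b)) := by
      have hpow : ∀ t : ℝ, 0 < t → t ^ (-(2 * b)) = (t ^ c) ^ 2 / t ^ 2 := fun t h => by
        rw [← Real.rpow_natCast t 2, ← Real.rpow_natCast (t ^ c), ← Real.rpow_mul h.le,
          ← Real.rpow_sub h, hc]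
        congr 1
        push_cast; ring
      rw [hpow _ hs, hpow _ ht, hpow _ hD, confWeight, Real.div_rpow (by positivity) hD.le,
        Real.mul_rpow hs.le ht.le]
      have : ‖x₄ - x₂‖ ^ c ≠ 0 := by positivity
      field_simp
    have hA : ‖x₄ - x₂‖ ^ (-(2 * b * ((L + 1 : ℕ) : ℝ))) =
        ‖x₄ - x₂‖ ^ (-(2 * b * L)) * ‖x₄ - x₂‖ ^ (-(2 * b)) := by
      rw [← Real.rpow_add hD]; push_cast; ring_nf
    rw [hsq, hA, ← hc]
    field_simp

/-! ### The case without vertices -/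

theorem Gamma_add_natCast_eq_ascPochhammer {a : ℂ} (h : ∀ m : ℕ, a ≠ -m) (n : ℕ) :
    Gamma (a + n) = (ascPochhammer ℂ n).eval a * Gamma a := by
  induction n with
  | zero => simp
  | succ n ih =>
    have h1 : a + n ≠ 0 := fun h0 => h n (by linear_combination h0)
    rw [ascPochhammer_succ_eval, mul_right_comm, ← ih, Nat.cast_succ, ← add_assoc,
      Gamma_add_one _ h1, mul_comm]

theorem Gamma_div_factorial_eq {a : ℂ} (h : ∀ m : ℕ, a ≠ -m) (n : ℕ) :
    Gamma (a + n) / Gamma (1 + n) = Gamma a * Ring.choose (a + n - 1) n := by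
  have h1 : Ring.choose (a + n - 1) n = Ring.multichoose a n := by
    rw [Ring.choose]; congr 1; ring
  have h2 := Ring.factorial_nsmul_multichoose_eq_ascPochhammer a n
  rw [Polynomial.ascPochhammer_smeval_eq_eval, nsmul_eq_mul] at h2
  have h3 : (n.factorial : ℂ) ≠ 0 := by exact_mod_cast n.factorial_ne_zero
  rw [Gamma_add_natCast_eq_ascPochhammer h, ← h2, h1, add_comm (1 : ℂ), Gamma_nat_eq_factorial]
  field_simp

/-- The binomial series. -/
theorem FSeries_zero {β z : ℂ} (hβ : β ∈ genericIndex) (hz : ‖z‖ < 1) :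
    FSeries 0 β 0 z = Gamma (1 - β) / (1 - z) ^ (1 - β) := by
  have h := (one_div_one_sub_cpow_hasFPowerSeriesOnBall_zero (1 - β)).hasSum (y := z)
    (by simpa [← ofReal_norm] using hz)
  simp only [FormalMultilinearSeries.ofScalars_apply_eq, smul_eq_mul, zero_add] at h
  have hg : ∀ m : ℕ, (1 - β : ℂ) ≠ -m := fun m hm => hβ m (by linear_combination -hm)
  rw [FSeries, div_eq_mul_one_div, ← h.tsum_eq, ← tsum_mul_left]
  refine tsum_congr fun k => ?_
  rw [FTerm, zero_add, pow_one, pow_one, sub_zero, sub_zero, Gamma_div_factorial_eq hg]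
  ring

theorem one_sub_cpow_mul_conj {z s : ℂ} (hz : ‖z‖ < 1) :
    (1 - z) ^ s * (1 - conj z) ^ s = sqPow (1 - z) s := by
  have hre : 0 < (1 - z).re := by
    rw [sub_re, one_re]
    linarith [(abs_lt.1 ((abs_re_le_norm z).trans_lt hz)).2]
  have h0 : 1 - z ≠ 0 := fun h => by rw [h] at hre; simp at hre
  have h1 : 1 - conj z ≠ 0 := by
    rw [show 1 - conj z = conj (1 - z) by simp]
    exact (map_ne_zero _).2 h0
  have harg : (1 - z).arg ≠ Real.pi := by
    rw [Ne, arg_eq_pi_iff]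
    rintro ⟨h, -⟩
    linarith
  rw [cpow_def_of_ne_zero h0, cpow_def_of_ne_zero h1, ← Complex.exp_add, sqPow_eq_exp h0,
    show 1 - conj z = conj (1 - z) by simp, log_conj _ harg, ← add_mul, add_conj, log_re]
  rw [mul_comm s]

/-- For `L = 0` the power series are binomial series, and the derivative formula gives the
propagator. -/
theorem ladderDeriv_zero {β z : ℂ} (hβ : β ∈ genericIndex) (hb : 0 < β.re) (hb1 : β.re < 1)
    (hz : ‖z‖ < 1) :
    (4 : ℂ) ^ β * ladderDeriv 0 z β =
      2 * Real.pi * (Gamma (1 - β) / Gamma β) * (sqPow z (1 / 2) / sqPow (1 - z) (1 - β)) := by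
  have h4 : (4 : ℂ) ^ β * (4 : ℂ) ^ (-β * ((0 : ℕ) + 1)) = 1 := by
    rw [← cpow_add _ _ (by norm_num)]; simp
  have hG : Gamma β ≠ 0 := Gamma_ne_zero_of_re_pos hb
  have hpi : (Real.pi : ℂ) ≠ 0 := by exact_mod_cast Real.pi_ne_zero
  have hrefl := Complex.Gamma_mul_Gamma_one_sub β
  have hG1 : Gamma (1 - β) ≠ 0 := Gamma_ne_zero_of_re_pos (by rw [sub_re, one_re]; linarith)
  have hs : sin (Real.pi * β) ≠ 0 := fun h => by
    rw [h, div_zero] at hrefl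
    exact (mul_ne_zero hG hG1) hrefl
  rw [eq_div_iff hs] at hrefl
  have hcz : ‖conj z‖ < 1 := by simpa using hz
  have hF : FSeries 0 β 0 z * FSeries 0 β 0 (conj z) =
      Gamma (1 - β) ^ 2 / sqPow (1 - z) (1 - β) := by
    rw [FSeries_zero hβ hz, FSeries_zero hβ hcz, div_mul_div_comm, one_sub_cpow_mul_conj hz, sq]
  have hS : sqPow (1 - z) (1 - β) ≠ 0 := sqPow_ne_zero
    (sub_ne_zero.2 fun h => by rw [← h, norm_one] at hz; exact lt_irrefl _ hz) _
  rw [ladderDeriv, iteratedDeriv_zero, regBracket, prefactor, mul_assoc (_ * _ * _), hF]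
  simp only [sub_zero, add_zero, Gamma_one, zero_add, pow_one, Nat.factorial_zero, Nat.cast_one,
    div_one, mul_one] at h4 ⊢
  calc _ = (4 : ℂ) ^ β * (4 : ℂ) ^ (-β * ((0 : ℕ) + 1)) * (2 * Real.pi * (sqPow z (1 / 2) *
        sin (Real.pi * β) * (1 / Real.pi) * (Gamma (1 - β) ^ 2 / sqPow (1 - z) (1 - β)))) := by
        ring
    _ = _ := by
        rw [h4]
        field_simp
        linear_combination sqPow z (1 / 2) * hrefl

section

open scoped FourierTransform

/-! ### The Mellin-Barnes integral on a straight line -/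

/-- The horizontal line half-way between the two series of poles, for real `b`. -/
def midLine (b t : ℝ) : ℂ := t - (b / 2 : ℝ) * I

theorem midLine_eq (b : ℝ) : midLine b = fun t : ℝ => (t : ℂ) + ((-(b / 2) : ℝ) : ℂ) * I := by
  ext t; rw [midLine]; push_cast; ring

theorem isSeparatingContour_midLine {b : ℝ} (hb1 : b < 1) (n : ℤ) :
    IsSeparatingContour b n (midLine b) := by
  have hN : (0 : ℝ) ≤ n.natAbs := Nat.cast_nonneg _
  have hint : ∀ p s : ℂ, p.im ≠ -(b / 2) → Tendsto (fun T : ℝ => ∫ t in (-T)..T,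
      ((t : ℂ) + ((-(b / 2) : ℝ) : ℂ) * I - p)⁻¹) atTop (𝓝 s) →
      HasIndexIntegral (midLine b) p s := by
    intro p s hp h
    refine ⟨fun t ht => hp ?_, ?_⟩
    · rw [← ht, midLine]; simp
    · simpa only [midLine_eq, deriv_horizontal, one_div] using h
  refine ⟨?_, ⟨b / 2, 0, fun t _ => rfl⟩, fun k => ?_, fun k => ?_⟩
  · rw [midLine_eq]
    exact ofRealCLM.contDiff.add contDiff_const
  · have h : -(b / 2) < (upperPole b n k).im := by
      rw [upperPole_im, ofReal_re]
      have : (0 : ℝ) ≤ k := Nat.cast_nonneg _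
      linarith
    exact hint _ _ h.ne' (tendsto_integral_line_of_lt h)
  · have h : (lowerPole n k).im < -(b / 2) := by
      rw [lowerPole_im]
      have : (0 : ℝ) ≤ k := Nat.cast_nonneg _
      linarith
    exact hint _ _ h.ne (tendsto_integral_line_of_gt h)

/-- The kernel of the Mellin-Barnes integral on the line half-way between the poles. -/
def lineKernel (b : ℝ) (N : ℕ) (t : ℝ) : ℂ := mellinKernel b N (midLine b t)

theorem lineKernel_neg (b : ℝ) (N : ℕ) (t : ℝ) : lineKernel b N (-t) = lineKernel b N t := by
  rw [lineKernel, lineKernel, ← mellinKernel_symm]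
  congr 1
  rw [midLine, midLine]; push_cast; ring

theorem continuous_lineKernel {b : ℝ} (hb1 : b < 1) (N : ℕ) :
    Continuous (lineKernel b N) := by
  have hsep := isSeparatingContour_midLine hb1 N
  have h1 : ∀ ν, mellinKernel b N ν = regIntegrand 0 b 1 N ν := fun ν => by
    simp [regIntegrand, zPow, sqPow_one]
  have h2 : lineKernel b N = fun t => regIntegrand 0 b 1 N (midLine b t) := by
    ext t; rw [lineKernel, h1]
  rw [h2]
  refine continuous_iff_continuousAt.2 fun t => ?_
  refine ContinuousAt.comp (f := midLine b) (g := regIntegrand 0 b 1 N)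
    (differentiableAt_regIntegrand one_ne_zero ?_).continuousAt hsep.1.continuous.continuousAt
  rintro (⟨j, hj⟩ | ⟨j, hj⟩)
  exacts [(hsep.2.2.1 j).1 t hj.symm, (hsep.2.2.2 j).1 t hj.symm]

/-- The kernel decays like `|t|^{-2κ}` for every `κ < b`, so it is integrable for `b > 1/2`. -/
theorem exists_lineKernel_bound {b : ℝ} (hb : 1 / 2 < b) (hb1 : b < 1) (N : ℕ) :
    ∃ C s : ℝ, 0 < C ∧ 1 < s ∧ ∀ t, ‖lineKernel b N t‖ ≤ C * (1 + ‖t‖) ^ (-s) := by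
  obtain ⟨κ, hκ, hκb⟩ := exists_between hb
  obtain ⟨C, hC, h⟩ := norm_mellinKernel_le (β := b) (κ := κ) (by linarith) (by linarith)
    (by simpa using hκb) N 0
  obtain ⟨B, hB⟩ := (isCompact_Icc (a := (-1 : ℝ)) (b := 1)).exists_bound_of_continuousOn
    (continuous_lineKernel hb1 N).continuousOn
  have hB0 : 0 ≤ B := (norm_nonneg _).trans (hB 0 (by norm_num))
  refine ⟨(C + B) * 2 ^ (2 * κ), 2 * κ, by positivity, by linarith, fun t => ?_⟩
  have hle : ∀ x : ℝ, 0 < x → (1 + ‖t‖) / 2 ≤ x → x ^ (-(2 * κ)) ≤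
      2 ^ (2 * κ) * (1 + ‖t‖) ^ (-(2 * κ)) := fun x hx hxt => by
    refine (Real.rpow_le_rpow_of_nonpos (by positivity) hxt (by linarith)).trans (le_of_eq ?_)
    rw [Real.div_rpow (by positivity) (by norm_num), Real.rpow_neg (by norm_num : (0 : ℝ) ≤ 2),
      div_inv_eq_mul, mul_comm]
  by_cases ht : 1 ≤ |t|
  · have := h (midLine b t) (by simpa [midLine] using ht) (by simp [midLine]; linarith)
    have hre : (midLine b t).re = t := by simp [midLine]
    rw [hre, ofReal_im, abs_zero, sub_zero] at this
    refine this.trans ?_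
    have h2 := hle |t| (by linarith) (by rw [Real.norm_eq_abs]; linarith)
    calc _ ≤ C * (2 ^ (2 * κ) * (1 + ‖t‖) ^ (-(2 * κ))) := by gcongr
      _ ≤ (C + B) * (2 ^ (2 * κ) * (1 + ‖t‖) ^ (-(2 * κ))) := by gcongr; linarith
      _ = _ := by ring
  · push Not at ht
    have h1 := hB t (abs_le.1 ht.le)
    have h2 := hle 1 one_pos (by rw [Real.norm_eq_abs]; linarith)
    rw [Real.one_rpow] at h2
    calc _ ≤ B * 1 := by rwa [mul_one]
      _ ≤ (C + B) * (2 ^ (2 * κ) * (1 + ‖t‖) ^ (-(2 * κ))) := by gcongr; linarith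
      _ = _ := by ring

theorem integrable_lineKernel_pow {b : ℝ} (hb : 1 / 2 < b) (hb1 : b < 1) (N L : ℕ) :
    Integrable fun t => lineKernel b N t ^ (L + 1) := by
  obtain ⟨C, s, hC, hs, h⟩ := exists_lineKernel_bound hb hb1 N
  have hc := continuous_lineKernel hb1 N
  refine Integrable.mono' ((integrable_one_add_norm (E := ℝ) (μ := volume) (r := s)
    (by simpa using hs)).const_mul (C ^ (L + 1))) (hc.pow _).aestronglyMeasurable
    (Eventually.of_forall fun t => ?_)
  rw [norm_pow]
  refine (pow_le_pow_left₀ (norm_nonneg _) (h t) _).trans ?_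
  rw [mul_pow]
  refine mul_le_mul_of_nonneg_left ?_ (by positivity)
  refine pow_le_of_le_one (by positivity) ?_ (Nat.succ_ne_zero L)
  exact Real.rpow_le_one_of_one_le_of_nonpos (by linarith [norm_nonneg t]) (by linarith)

/-- The angular Fourier coefficients of the ladder integral, up to a constant: the Fourier
transforms of the powers of the kernel. -/
def angularCoeff (b : ℝ) (L N : ℕ) (u : ℝ) : ℂ :=
  ∫ t : ℝ, lineKernel b N t ^ (L + 1) * cexp (2 * t * u * I)

theorem norm_phase (t u : ℝ) : ‖cexp (2 * t * u * I)‖ = 1 := by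
  rw [show (2 * t * u * I : ℂ) = ((2 * t * u : ℝ) : ℂ) * I by push_cast; ring, norm_exp_ofReal_mul_I]

theorem continuous_angularCoeff {b : ℝ} (hb : 1 / 2 < b) (hb1 : b < 1) (L N : ℕ) :
    Continuous (angularCoeff b L N) := by
  have hi := integrable_lineKernel_pow hb hb1 N L
  refine continuous_of_dominated (bound := fun t => ‖lineKernel b N t ^ (L + 1)‖)
    (fun u => ?_) (fun u => Eventually.of_forall fun t => ?_) hi.norm
    (Eventually.of_forall fun t => by fun_prop)
  · exact hi.aestronglyMeasurable.mul
      (Continuous.aestronglyMeasurable (by fun_prop))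
  · rw [norm_mul, norm_phase, mul_one]

theorem exists_norm_angularCoeff_le {b : ℝ} (L N : ℕ) :
    ∃ M, ∀ u, ‖angularCoeff b L N u‖ ≤ M := by
  refine ⟨∫ t : ℝ, ‖lineKernel b N t ^ (L + 1)‖, fun u => ?_⟩
  refine (norm_integral_le_integral_norm _).trans (le_of_eq ?_)
  simp only [norm_mul, norm_phase, mul_one]

theorem angularCoeff_neg (b : ℝ) (L N : ℕ) (u : ℝ) :
    angularCoeff b L N (-u) = angularCoeff b L N u := by
  rw [angularCoeff, ← integral_neg_eq_self]
  refine integral_congr_ae (Eventually.of_forall fun t => ?_)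
  simp only [lineKernel_neg]
  push_cast
  ring_nf

theorem zPow_midLine (b u θ : ℝ) (n : ℤ) (t : ℝ) :
    zPow (cexp (u + θ * I)) n (midLine b t) =
      cexp (b * u) * cexp (n * θ * I) * cexp (2 * t * u * I) := by
  have hn : Real.log ‖cexp (u + θ * I)‖ = u := by
    rw [Complex.norm_exp, Real.log_exp]; simp
  rw [zPow, sqPow_eq_exp (exp_ne_zero _), hn, ← Complex.exp_int_mul, ← Complex.exp_add,
    ← Complex.exp_add, ← Complex.exp_add, midLine]
  congr 1
  push_cast
  linear_combination (-b * u) * I_mul_I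

theorem hasContourIntegral_midLine {b : ℝ} (hb : 1 / 2 < b) (hb1 : b < 1) (L : ℕ) (n : ℤ)
    (u θ : ℝ) : HasContourIntegral (regIntegrand L b (cexp (u + θ * I)) n) (midLine b)
      (cexp (b * u) * (angularCoeff b L n.natAbs u * cexp (n * θ * I))) := by
  have hi := integrable_lineKernel_pow hb hb1 n.natAbs L
  have hint : Integrable fun t => lineKernel b n.natAbs t ^ (L + 1) * cexp (2 * t * u * I) := by
    refine hi.mul_bdd (c := 1) (Continuous.aestronglyMeasurable (by fun_prop))
      (Eventually.of_forall fun t => ?_)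
    rw [norm_phase]
  have h := (intervalIntegral_tendsto_integral (l := atTop ×ˢ atTop)
    (hint.mul_const (cexp (b * u) * cexp (n * θ * I)))
    (tendsto_neg_atTop_atBot.comp tendsto_fst) tendsto_snd)
  rw [integral_mul_const] at h
  rw [HasContourIntegral]
  convert! h using 1
  · ext T
    refine intervalIntegral.integral_congr fun t _ => ?_
    simp only [regIntegrand, zPow_midLine]
    rw [midLine_eq, deriv_horizontal, mul_one, ← midLine_eq, ← lineKernel]
    ring
  · rw [angularCoeff]; congr 1; ring

/-- The ladder function as a Fourier series in the angular variable. -/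
theorem hasSum_angularCoeff_ladderDeriv {b : ℝ} (hb : 1 / 2 < b) (hb1 : b < 1) (L : ℕ) {u : ℝ}
    (hu : u < 0) (θ : ℝ) :
    HasSum (fun n : ℤ => angularCoeff b L n.natAbs u * cexp (n * θ * I))
      ((4 : ℂ) ^ ((b : ℂ) * (L + 1)) * cexp (-(b * u)) * ladderDeriv L (cexp (u + θ * I)) b) := by
  set z := cexp (u + θ * I) with hz
  have hz0 : z ≠ 0 := exp_ne_zero _
  have hz1 : ‖z‖ < 1 := by
    rw [hz, Complex.norm_exp]; simpa using hu
  have hβ : (b : ℂ) ∈ genericIndex := mem_genericIndex_of_re_lt_one (by simpa using hb1)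
  obtain ⟨J, hJ, hs, ht⟩ := mellinBarnes_of_norm_lt_one L hβ (by simp; linarith) hz0 hz1
    (γ := fun _ => midLine b) fun n => isSeparatingContour_midLine hb1 n
  have hJe : ∀ n, J n = cexp (b * u) * (angularCoeff b L n.natAbs u * cexp (n * θ * I)) := fun n =>
    tendsto_nhds_unique (hJ n) (hasContourIntegral_midLine hb hb1 L n u θ)
  have h := hs.hasSum.mul_left (cexp (-(b * u)))
  have h4 : (4 : ℂ) ^ ((b : ℂ) * (L + 1)) * (4 : ℂ) ^ (-(b : ℂ) * (L + 1)) = 1 := by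
    rw [← cpow_add _ _ (by norm_num)]; simp
  convert! h using 1
  · ext n
    rw [hJe, ← mul_assoc, ← Complex.exp_add, neg_add_cancel, Complex.exp_zero, one_mul]
  · rw [ht]
    linear_combination (cexp (-(b * u)) * ∑' n, J n) * h4

end

section

open scoped FourierTransform ComplexOrder

/-! ### The angular coefficients of the propagator -/

/-- The constant which relates the propagator to the Fourier transform of the kernel. -/
def kernelConst (b : ℝ) : ℝ := 2 * Real.pi * (Real.Gamma (1 - b) / Real.Gamma b)

theorem kernelConst_pos {b : ℝ} (hb : 0 < b) (hb1 : b < 1) : 0 < kernelConst b := by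
  have h1 := Real.Gamma_pos_of_pos hb
  have h2 := Real.Gamma_pos_of_pos (sub_pos.2 hb1)
  have := Real.pi_pos
  unfold kernelConst; positivity

theorem propagator_conj (c : ℝ) (w : ℂ) : propagator c (conj w) = propagator c w := by
  rw [propagator, propagator, RCLike.norm_conj, show 1 - conj w = conj (1 - w) by simp,
    RCLike.norm_conj]

theorem norm_exp_add_mul_I (u θ : ℝ) : ‖cexp (u + θ * I)‖ = Real.exp u := by
  rw [Complex.norm_exp]; simp

/-- The angular expansion of the propagator. The expansion for `u < 0` extends to `u > 0`, as both
sides are even in `u`. -/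
theorem hasSum_angularCoeff_zero {b : ℝ} (hb : 1 / 2 < b) (hb1 : b < 1) {u : ℝ} (hu : u ≠ 0)
    (θ : ℝ) : HasSum (fun n : ℤ => angularCoeff b 0 n.natAbs u * cexp (n * θ * I))
      ((kernelConst b * propagator (1 - b) (cexp (u + θ * I)) : ℝ) : ℂ) := by
  wlog hneg : u < 0 generalizing u
  · have h := this (neg_ne_zero.2 hu) (neg_neg_of_pos (lt_of_le_of_ne (not_lt.1 hneg) hu.symm))
    have e : cexp (((-u : ℝ) : ℂ) + θ * I) = conj (cexp (u + θ * I))⁻¹ := by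
      rw [← Complex.exp_neg, ← Complex.exp_conj]
      congr 1
      apply Complex.ext <;> simp
    rw [e, propagator_conj, propagator_inv] at h
    simpa only [angularCoeff_neg] using h
  convert! hasSum_angularCoeff_ladderDeriv hb hb1 0 hneg θ using 1
  set z := cexp (u + θ * I) with hz
  have hnz : ‖z‖ = Real.exp u := norm_exp_add_mul_I u θ
  have hz1 : ‖z‖ < 1 := by rw [hnz]; simpa using hneg
  have hβ : (b : ℂ) ∈ genericIndex := mem_genericIndex_of_re_lt_one (by simpa using hb1)
  have h := ladderDeriv_zero hβ (by simp; linarith) (by simpa using hb1) hz1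
  have h0 : 0 < ‖1 - z‖ := norm_pos_iff.2 (sub_ne_zero.2 fun h => by
    rw [← h, norm_one] at hz1; exact lt_irrefl _ hz1)
  have e1 := sqPow_ofReal z (1 / 2)
  have e2 := sqPow_ofReal (1 - z) (1 - b)
  push_cast at e1 e2
  rw [Nat.cast_zero, zero_add, mul_one, mul_comm ((4 : ℂ) ^ (b : ℂ)), mul_assoc, h, e1, e2,
    ← ofReal_one, ← ofReal_sub, Complex.Gamma_ofReal, Complex.Gamma_ofReal,
    show -((b : ℂ) * u) = ((-(b * u) : ℝ) : ℂ) by push_cast; ring, ← ofReal_exp]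
  norm_cast
  rw [kernelConst, propagator, hnz, show (2 : ℝ) * (1 / 2) = 1 by norm_num, Real.rpow_one,
    Real.rpow_neg h0.le, ← Real.exp_mul]
  have : Real.exp (u * (1 - b)) = Real.exp (-(b * u)) * Real.exp u := by
    rw [← Real.exp_add]; ring_nf
  rw [this]
  ring

theorem residueTerm_zero {β z : ℂ} {δ : ℝ} (h : IsGoodRadius β δ) (hz : z ≠ 0) (i j : ℕ) :
    residueTerm 0 β z δ i j =
      2 * Real.pi * (prefactor 0 β z 0 * coef 0 β 0 i * coef 0 β 0 j * (z ^ i * conj z ^ j)) := by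
  have hδ := h.1
  have h8 := h.2.1
  have hd : DifferentiableOn ℂ (fun ε => prefactor 0 β z ε * coef 0 β ε i * coef 0 β ε j *
      (z ^ i * conj z ^ j)) (Metric.closedBall 0 δ) := by
    intro ε hε
    rw [mem_closedBall_zero_iff] at hε
    have hc : ∀ i, DifferentiableAt ℂ (fun ε => coef 0 β ε i) ε := fun i =>
      differentiableAt_coef (differentiableAt_const β) differentiableAt_id
        (h.mem_genericIndex (by simp only [id]; linarith)) 0 i
    exact ((((differentiableAt_prefactor 0 hz (differentiableAt_const β) differentiableAt_id
      (by simp only [id]; linarith)).mul (hc i)).mul (hc j)).mul_const _).differentiableWithinAt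
  have key := hd.circleIntegral_sub_inv_smul (w := 0) (by simpa using hδ)
  rw [residueTerm]
  have e : ∀ ε : ℂ, prefactor 0 β z ε * coef 0 β ε i * coef 0 β ε j / ε ^ (0 + 1) *
      (z ^ i * conj z ^ j) = (ε - 0)⁻¹ • (prefactor 0 β z ε * coef 0 β ε i * coef 0 β ε j *
      (z ^ i * conj z ^ j)) := fun ε => by
    rw [sub_zero, zero_add, pow_one, smul_eq_mul]; ring
  simp only [e]
  rw [key, smul_eq_mul]
  linear_combination (-2 * Real.pi * (prefactor 0 β z 0 * coef 0 β 0 i * coef 0 β 0 j *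
    (z ^ i * conj z ^ j))) * I_mul_I

theorem residueTerm_zero_nonneg {b : ℝ} (hb : 0 < b) (hb1 : b < 1) {δ : ℝ}
    (h : IsGoodRadius b δ) (u : ℝ) (i j : ℕ) : 0 ≤ residueTerm 0 b (cexp u) δ i j := by
  have hcoef : ∀ k, 0 ≤ coef 0 b 0 k := fun k => by
    have e1 : (1 - b + k - 0 : ℂ) = ((1 - b + k : ℝ) : ℂ) := by push_cast; ring
    have e2 : (1 + k - 0 : ℂ) = ((1 + k : ℝ) : ℂ) := by push_cast; ring
    have hk : (0 : ℝ) ≤ k := k.cast_nonneg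
    rw [coef, zero_add, pow_one, e1, e2, Complex.Gamma_ofReal, Complex.Gamma_ofReal, ← ofReal_div,
      zero_le_real]
    exact div_nonneg (Real.Gamma_nonneg_of_nonneg (by linarith))
      (Real.Gamma_nonneg_of_nonneg (by linarith))
  have hpre : 0 ≤ prefactor 0 b (cexp u) 0 := by
    have e1 := sqPow_ofReal (cexp u) (1 / 2)
    push_cast at e1
    have e3 : (Real.pi : ℂ) * b = ((Real.pi * b : ℝ) : ℂ) := by push_cast; rfl
    rw [prefactor, sub_zero, add_zero, add_zero, sub_zero, Gamma_one, zero_add, pow_one, pow_one,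
      mul_one, e1, e3, ← ofReal_sin, ← ofReal_one, ← ofReal_div, ← ofReal_mul, ← ofReal_mul,
      zero_le_real]
    have := Real.sin_nonneg_of_nonneg_of_le_pi (x := Real.pi * b)
      (by have := Real.pi_pos; positivity) (by nlinarith [Real.pi_pos])
    have := Real.pi_pos
    positivity
  have hz : 0 ≤ cexp u ^ i * conj (cexp u) ^ j := by
    rw [← ofReal_exp, conj_ofReal, ← ofReal_pow, ← ofReal_pow, ← ofReal_mul, zero_le_real]
    positivity
  have hpi : (0 : ℂ) ≤ 2 * Real.pi := by
    rw [← ofReal_ofNat, ← ofReal_mul, zero_le_real]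
    have := Real.pi_pos
    positivity
  rw [residueTerm_zero h (exp_ne_zero _)]
  exact mul_nonneg hpi (mul_nonneg (mul_nonneg (mul_nonneg hpre (hcoef i)) (hcoef j)) hz)

/-- The angular coefficients of the propagator are positive, being power series with positive
coefficients. -/
theorem angularCoeff_zero_nonneg {b : ℝ} (hb : 1 / 2 < b) (hb1 : b < 1) (N : ℕ) {u : ℝ}
    (hu : u ≠ 0) : 0 ≤ angularCoeff b 0 N u := by
  wlog hneg : u < 0 generalizing u
  · rw [← angularCoeff_neg]
    exact this (neg_ne_zero.2 hu) (neg_neg_of_pos (lt_of_le_of_ne (not_lt.1 hneg) hu.symm))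
  have hβ : (b : ℂ) ∈ genericIndex := mem_genericIndex_of_re_lt_one (by simpa using hb1)
  obtain ⟨δ, hδ, h⟩ := exists_isGoodRadius hβ
  have hgood := h b (Metric.mem_closedBall_self hδ.le)
  have h1 := hasContourIntegral_midLine hb hb1 0 N u 0
  have h2 := hasContourIntegral_regIntegrand (L := 0) hgood (by simp; linarith)
    (exp_ne_zero (u + (0 : ℝ) * I)) (by rw [norm_exp_add_mul_I]; simpa using hneg)
    (isSeparatingContour_midLine hb1 N)
  have h3 := tendsto_nhds_unique h1 h2
  have h4 : angularCoeff b 0 N u = ((Real.exp (-(b * u)) : ℝ) : ℂ) *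
      ∑' k, residueTerm 0 b (cexp u) δ (k + (N : ℤ).toNat) (k + (-(N : ℤ)).toNat) := by
    rw [ofReal_zero, zero_mul, add_zero] at h3
    rw [← h3, ofReal_exp, ← mul_assoc, ← Complex.exp_add]
    simp
  rw [h4]
  refine mul_nonneg (zero_le_real.2 (Real.exp_pos _).le) (tsum_nonneg fun k => ?_)
  exact residueTerm_zero_nonneg (by linarith) hb1 hgood u _ _

/-- A nonnegative angular coefficient is at most the sum of all of them, which is the propagator on
the positive axis. -/
theorem exists_norm_angularCoeff_zero_le {b : ℝ} (hb : 1 / 2 < b) (hb1 : b < 1) (N : ℕ) :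
    ∃ D, ∀ u : ℝ, ‖angularCoeff b 0 N u‖ ≤ D * Real.exp (-((1 - b) * |u|)) := by
  obtain ⟨M, hM⟩ := exists_norm_angularCoeff_le (b := b) 0 N
  have hM0 : 0 ≤ M := (norm_nonneg _).trans (hM 0)
  have hK := kernelConst_pos (by linarith) hb1
  have he : 0 < 1 - Real.exp (-1) := by
    have : Real.exp (-1) < 1 := by simp
    linarith
  set A := kernelConst b * (1 - Real.exp (-1)) ^ (-(2 * (1 - b))) with hA
  have hA0 : 0 < A := by positivity
  have hfar : ∀ u : ℝ, u ≤ -1 → ‖angularCoeff b 0 N u‖ ≤ A * Real.exp ((1 - b) * u) := by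
    intro u hu
    have hu0 : u ≠ 0 := by rintro rfl; linarith
    have hs := hasSum_angularCoeff_zero hb hb1 hu0 0
    have hs' : HasSum (fun n : ℤ => ‖angularCoeff b 0 n.natAbs u‖)
        (kernelConst b * propagator (1 - b) (cexp (u + (0 : ℝ) * I))) := by
      rw [← hasSum_ofReal]
      convert! hs using 1
      ext n
      rw [← eq_coe_norm_of_nonneg (angularCoeff_zero_nonneg hb hb1 n.natAbs hu0)]
      simp
    have h1 := le_hasSum hs' (N : ℤ) fun _ _ => norm_nonneg _
    rw [Int.natAbs_natCast] at h1
    refine h1.trans ?_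
    rw [propagator, norm_exp_add_mul_I, ← Real.exp_mul, hA]
    have h2 : 1 - Real.exp (-1) ≤ ‖1 - cexp (u + (0 : ℝ) * I)‖ := by
      have h3 := norm_sub_norm_le 1 (cexp (u + (0 : ℝ) * I))
      rw [norm_one, norm_exp_add_mul_I] at h3
      have := Real.exp_le_exp.2 hu
      linarith
    have h4 := Real.rpow_le_rpow_of_nonpos he h2 (show -(2 * (1 - b)) ≤ 0 by linarith)
    rw [mul_comm u, mul_assoc, mul_comm ((1 - Real.exp (-1)) ^ _)]
    gcongr
  refine ⟨A + M * Real.exp (1 - b), fun u => ?_⟩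
  have hpos : 0 < Real.exp (-((1 - b) * |u|)) := Real.exp_pos _
  rcases le_or_gt |u| 1 with h | h
  · calc _ ≤ M * (Real.exp (1 - b) * Real.exp (-((1 - b) * |u|))) := by
          refine (hM u).trans (le_mul_of_one_le_right hM0 ?_)
          rw [← Real.exp_add]
          exact Real.one_le_exp (by nlinarith)
      _ ≤ _ := by nlinarith
  · have h1 : ‖angularCoeff b 0 N u‖ ≤ A * Real.exp (-((1 - b) * |u|)) := by
      have h2 := hfar (-|u|) (by linarith)
      rw [mul_neg] at h2
      refine le_trans (le_of_eq ?_) h2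
      rcases abs_choice u with h3 | h3 <;> rw [h3]
      · rw [angularCoeff_neg]
      · rw [neg_neg]
    have : 0 ≤ M * Real.exp (1 - b) * Real.exp (-((1 - b) * |u|)) := by positivity
    linarith

theorem integrable_exp_neg_mul_abs {c : ℝ} (hc : 0 < c) :
    Integrable fun u : ℝ => Real.exp (-(c * |u|)) := by
  set d := min 1 (c / 2) with hd
  have hd0 : 0 < d := by positivity
  refine Integrable.mono' ((integrable_one_add_norm (E := ℝ) (μ := volume) (r := 2)
    (by simp)).const_mul (d ^ 2)⁻¹) (Continuous.aestronglyMeasurable (by fun_prop))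
    (Eventually.of_forall fun u => ?_)
  have h1 : d * (1 + |u|) ≤ Real.exp (c * |u| / 2) := by
    have h2 := Real.add_one_le_exp (c * |u| / 2)
    have h3 : d ≤ 1 := min_le_left _ _
    have h4 : d ≤ c / 2 := min_le_right _ _
    nlinarith [abs_nonneg u]
  have h5 : (d * (1 + |u|)) ^ 2 ≤ Real.exp (c * |u|) := by
    refine (pow_le_pow_left₀ (by positivity) h1 2).trans (le_of_eq ?_)
    rw [← Real.exp_nat_mul]; congr 1; push_cast; ring
  rw [Real.norm_of_nonneg (Real.exp_pos _).le, Real.exp_neg, Real.rpow_neg (by positivity),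
    Real.rpow_two, ← mul_inv, Real.norm_eq_abs, ← mul_pow]
  exact inv_anti₀ (by positivity) h5

theorem integrable_angularCoeff_zero {b : ℝ} (hb : 1 / 2 < b) (hb1 : b < 1) (N : ℕ) :
    Integrable (angularCoeff b 0 N) := by
  obtain ⟨D, hD⟩ := exists_norm_angularCoeff_zero_le hb hb1 N
  exact Integrable.mono' ((integrable_exp_neg_mul_abs (sub_pos.2 hb1)).const_mul D)
    (continuous_angularCoeff hb hb1 0 N).aestronglyMeasurable (Eventually.of_forall hD)

/-- Fourier inversion for the kernel. -/
theorem integral_angularCoeff_zero {b : ℝ} (hb : 1 / 2 < b) (hb1 : b < 1) (N : ℕ) (t : ℝ) :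
    ∫ u : ℝ, angularCoeff b 0 N u * cexp (-(2 * t * u * I)) = Real.pi * lineKernel b N t := by
  have hi := integrable_lineKernel_pow hb hb1 N 0
  simp only [zero_add, pow_one] at hi
  have hinv : ∀ x : ℝ, 𝓕⁻ (lineKernel b N) x = angularCoeff b 0 N (Real.pi * x) := fun x => by
    rw [Real.fourierInv_eq', angularCoeff]
    refine integral_congr_ae (Eventually.of_forall fun t => ?_)
    simp only [smul_eq_mul, zero_add, pow_one, RCLike.inner_apply, conj_trivial]
    rw [mul_comm]
    congr 2
    push_cast; ring
  have hint : Integrable (𝓕 (lineKernel b N)) := by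
    have : 𝓕 (lineKernel b N) = fun x => angularCoeff b 0 N (Real.pi * x) := by
      ext x
      rw [← angularCoeff_neg, ← mul_neg, ← hinv, Real.fourierInv_eq_fourier_neg, neg_neg]
    rw [this]
    exact (integrable_angularCoeff_zero hb hb1 N).comp_mul_left' Real.pi_ne_zero
  have key := congrFun ((continuous_lineKernel hb1 N).fourier_fourierInv_eq hi hint) t
  rw [Real.fourier_real_eq_integral_exp_smul] at key
  have h := Measure.integral_comp_mul_left
    (fun u : ℝ => angularCoeff b 0 N u * cexp (-(2 * t * u * I))) Real.pi
  have h2 : ∫ x : ℝ, angularCoeff b 0 N (Real.pi * x) * cexp (-(2 * t * ((Real.pi * x : ℝ) : ℂ) * I)) =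
      lineKernel b N t := by
    rw [← key]
    refine integral_congr_ae (Eventually.of_forall fun x => ?_)
    simp only [hinv, smul_eq_mul]
    rw [mul_comm]
    congr 2
    push_cast; ring
  rw [h2, abs_of_pos (inv_pos.2 Real.pi_pos), real_smul, ofReal_inv] at h
  have hpi : (Real.pi : ℂ) ≠ 0 := by exact_mod_cast Real.pi_ne_zero
  rw [h, mul_inv_cancel_left₀ hpi]

/-- In the logarithmic radial variable, convolution with the coefficients of the propagator
multiplies the Fourier transform by the kernel. -/
theorem integral_angularCoeff_convolution {b : ℝ} (hb : 1 / 2 < b) (hb1 : b < 1) (L N : ℕ)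
    (u : ℝ) : ∫ v : ℝ, angularCoeff b 0 N (u - v) * angularCoeff b L N v =
      Real.pi * angularCoeff b (L + 1) N u := by
  have h0 := integral_sub_left_eq_self (fun v => angularCoeff b 0 N v * angularCoeff b L N (u - v))
    volume u
  simp only [sub_sub_cancel] at h0
  rw [h0]
  have hf := integrable_angularCoeff_zero hb hb1 N
  have hg := integrable_lineKernel_pow hb hb1 N L
  have hfg : Integrable (fun p : ℝ × ℝ => angularCoeff b 0 N p.1 *
      lineKernel b N p.2 ^ (L + 1) * cexp (2 * p.2 * ((u - p.1 : ℝ) : ℂ) * I))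
      (volume.prod volume) := by
    refine (hf.mul_prod hg).mul_bdd (c := 1) (Continuous.aestronglyMeasurable (by fun_prop))
      (Eventually.of_forall fun p => ?_)
    rw [norm_phase]
  calc _ = ∫ v : ℝ, ∫ t : ℝ, angularCoeff b 0 N v * lineKernel b N t ^ (L + 1) *
        cexp (2 * t * ((u - v : ℝ) : ℂ) * I) := by
        refine integral_congr_ae (Eventually.of_forall fun v => ?_)
        simp only [mul_assoc]
        rw [integral_const_mul, angularCoeff.eq_1 b L N]
        simp only [mul_assoc]
    _ = ∫ t : ℝ, ∫ v : ℝ, angularCoeff b 0 N v * lineKernel b N t ^ (L + 1) *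
        cexp (2 * t * ((u - v : ℝ) : ℂ) * I) := integral_integral_swap hfg
    _ = ∫ t : ℝ, Real.pi * (lineKernel b N t ^ (L + 1 + 1) * cexp (2 * t * u * I)) := by
        refine integral_congr_ae (Eventually.of_forall fun t => ?_)
        have : ∀ v : ℝ, angularCoeff b 0 N v * lineKernel b N t ^ (L + 1) *
            cexp (2 * t * ((u - v : ℝ) : ℂ) * I) = lineKernel b N t ^ (L + 1) *
            cexp (2 * t * u * I) * (angularCoeff b 0 N v * cexp (-(2 * t * v * I))) := fun v => by
          have : cexp (2 * t * ((u - v : ℝ) : ℂ) * I) =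
              cexp (2 * t * u * I) * cexp (-(2 * t * v * I)) := by
            rw [← Complex.exp_add]; congr 1; push_cast; ring
          rw [this]; ring
        simp only [this]
        rw [integral_const_mul, integral_angularCoeff_zero hb hb1]
        ring
    _ = _ := by rw [integral_const_mul, angularCoeff]

end

section

open scoped ComplexOrder

/-! ### The angular expansion of the ladder integral -/

theorem integral_circle_exp (k : ℤ) :
    ∫ φ in Set.Ioo (-Real.pi) Real.pi, cexp (k * φ * I) =
      (if k = 0 then 2 * Real.pi else 0 : ℂ) := by
  rw [← integral_Ioc_eq_integral_Ioo,
    ← intervalIntegral.integral_of_le (by linarith [Real.pi_pos])]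
  split_ifs with hk
  · simp only [hk, Int.cast_zero, zero_mul, Complex.exp_zero, intervalIntegral.integral_const,
      real_smul, mul_one]
    push_cast; ring
  · have hk' : (k : ℂ) * I ≠ 0 := mul_ne_zero (by exact_mod_cast hk) I_ne_zero
    have h := integral_exp_mul_complex (a := -Real.pi) (b := Real.pi) hk'
    have e : ∀ φ : ℝ, cexp (k * φ * I) = cexp (k * I * φ) := fun φ => by ring_nf
    simp only [e]
    rw [h, div_eq_zero_iff, sub_eq_zero]
    left
    rw [show (k : ℂ) * I * Real.pi = k * I * ((-Real.pi : ℝ) : ℂ) + k * (2 * Real.pi * I) by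
      push_cast; ring]
    exact Complex.exp_periodic.int_mul k _

/-- Fourier series turn convolution on the circle into multiplication. -/
theorem hasSum_circle_convolution {a b : ℤ → ℂ} (ha : Summable fun n => ‖a n‖)
    (hb : Summable fun n => ‖b n‖) (θ : ℝ) :
    HasSum (fun n : ℤ => 2 * Real.pi * (a n * b n * cexp (n * θ * I)))
      (∫ φ in Set.Ioo (-Real.pi) Real.pi, (∑' n : ℤ, a n * cexp (n * ((θ - φ : ℝ) : ℂ) * I)) *
        ∑' m : ℤ, b m * cexp (m * φ * I)) := by
  have hn : ∀ (n : ℤ) (x : ℝ), ‖cexp (n * x * I)‖ = 1 := fun n x => by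
    rw [show (n * x * I : ℂ) = ((n * x : ℝ) : ℂ) * I by push_cast; ring, norm_exp_ofReal_mul_I]
  have ha' : ∀ x : ℝ, Summable fun n : ℤ => ‖a n * cexp (n * x * I)‖ := fun x => by
    simpa only [norm_mul, hn, mul_one] using ha
  have hb' : ∀ x : ℝ, Summable fun n : ℤ => ‖b n * cexp (n * x * I)‖ := fun x => by
    simpa only [norm_mul, hn, mul_one] using hb
  let F : ℤ × ℤ → ℝ → ℂ := fun p φ =>
    a p.1 * cexp (p.1 * ((θ - φ : ℝ) : ℂ) * I) * (b p.2 * cexp (p.2 * φ * I))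
  have hF : ∀ p φ, ‖F p φ‖ = ‖a p.1‖ * ‖b p.2‖ := fun p φ => by
    simp only [F, norm_mul, hn, mul_one]
  have hFc : ∀ p, Continuous (F p) := fun p => by
    simp only [F]; fun_prop
  have hFi : ∀ p, Integrable (F p) (volume.restrict (Set.Ioo (-Real.pi) Real.pi)) := fun p =>
    ((hFc p).integrableOn_Icc (a := -Real.pi) (b := Real.pi)).mono_set Set.Ioo_subset_Icc_self
  have hsum : Summable fun p : ℤ × ℤ =>
      ∫ φ in Set.Ioo (-Real.pi) Real.pi, ‖F p φ‖ := by
    simp only [hF, integral_const]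
    exact (ha.mul_of_nonneg hb (fun _ => norm_nonneg _) fun _ => norm_nonneg _).const_smul _
  have key := hasSum_integral_of_summable_integral_norm hFi hsum
  have h1 : ∀ p, ∫ φ in Set.Ioo (-Real.pi) Real.pi, F p φ =
      if p.1 = p.2 then 2 * Real.pi * (a p.1 * b p.2 * cexp (p.1 * θ * I)) else 0 := by
    intro p
    have e : ∀ φ : ℝ, F p φ = a p.1 * b p.2 * cexp (p.1 * θ * I) *
        cexp (((p.2 - p.1 : ℤ) : ℂ) * φ * I) := fun φ => by
      have : cexp (p.1 * ((θ - φ : ℝ) : ℂ) * I) * cexp (p.2 * φ * I) =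
          cexp (p.1 * θ * I) * cexp (((p.2 - p.1 : ℤ) : ℂ) * φ * I) := by
        rw [← Complex.exp_add, ← Complex.exp_add]; congr 1; push_cast; ring
      simp only [F]
      linear_combination a p.1 * b p.2 * this
    simp only [e]
    rw [integral_const_mul, integral_circle_exp]
    have : p.2 - p.1 = 0 ↔ p.1 = p.2 := by omega
    simp only [this]
    split_ifs <;> ring
  have h2 : ∀ φ, ∑' p, F p φ = (∑' n : ℤ, a n * cexp (n * ((θ - φ : ℝ) : ℂ) * I)) *
      ∑' m : ℤ, b m * cexp (m * φ * I) := fun φ =>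
    (tsum_mul_tsum_of_summable_norm (ha' (θ - φ)) (hb' φ)).symm
  simp only [h1, h2] at key
  have hinj : Function.Injective fun n : ℤ => ((n, n) : ℤ × ℤ) := fun m n h => (Prod.ext_iff.1 h).1
  refine ((hinj.hasSum_iff ?_).2 key).congr_fun fun n => ?_
  · rintro ⟨m, n⟩ h
    exact if_neg fun h' : m = n => h ⟨m, by rw [h']⟩
  · simp

variable {b : ℝ}

/-- The convolution with the propagator, in logarithmic polar coordinates. -/
theorem integral_convolution_exp {c : ℝ} (hc : 0 < c) (hc1 : c < 1) (L : ℕ) {z : ℂ} (hz : z ≠ 0)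
    (hz1 : z ≠ 1) :
    Integrable (fun v : ℝ => ∫ φ in Set.Ioo (-Real.pi) Real.pi,
      propagator c (z / cexp (v + φ * I)) * (iterPropagator c L (cexp (v + φ * I))).toReal) ∧
    ∫ v : ℝ, ∫ φ in Set.Ioo (-Real.pi) Real.pi,
      propagator c (z / cexp (v + φ * I)) * (iterPropagator c L (cexp (v + φ * I))).toReal =
        (iterPropagator c (L + 1) z).toReal := by
  set G : ℂ → ℝ := fun w => propagator c (z / w) * (iterPropagator c L w).toReal with hG
  have hG0 : ∀ w, 0 ≤ G w := fun w => mul_nonneg (propagator_nonneg _ _) ENNReal.toReal_nonneg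
  have hGm : Measurable G := by
    have h1 := measurable_propagator c
    have h2 := measurable_iterPropagator c L
    fun_prop
  have hl : ∫⁻ w, ENNReal.ofReal (G w) ∂mulHaar = iterPropagator c (L + 1) z := by
    rw [iterPropagator_succ]
    refine lintegral_congr_ae ?_
    filter_upwards [ae_mulHaar_ne 0, ae_mulHaar_ne 1] with w hw hw1
    rw [hG, ENNReal.ofReal_mul (propagator_nonneg _ _),
      ENNReal.ofReal_toReal (iterPropagator_lt_top hc hc1 L hw hw1).ne]
  have hi : Integrable G mulHaar := by
    rw [← lintegral_ofReal_ne_top_iff_integrable hGm.aestronglyMeasurable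
      (Eventually.of_forall hG0), hl]
    exact (iterPropagator_lt_top hc hc1 (L + 1) hz hz1).ne
  have hmp := measurePreserving_exp
  have hie := hmp.integrable_comp_of_integrable hi
  refine ⟨hie.integral_prod_left, ?_⟩
  have h1 := integral_prod _ hie
  have h2 : ∫ p, (G ∘ fun p : ℝ × ℝ => cexp (p.1 + p.2 * I)) p
      ∂(volume.prod (volume.restrict (Set.Ioo (-Real.pi) Real.pi))) = ∫ w, G w ∂mulHaar := by
    rw [← hmp.map_eq, integral_map hmp.measurable.aemeasurable hGm.aestronglyMeasurable]
    rfl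
  rw [← hl, ← integral_eq_lintegral_of_nonneg_ae (Eventually.of_forall hG0)
    hGm.aestronglyMeasurable, ← h2, h1]
  rfl

theorem exp_add_mul_I_ne_one {u : ℝ} (hu : u ≠ 0) (θ : ℝ) : cexp (u + θ * I) ≠ 1 := by
  intro h
  have := congrArg norm h
  rw [norm_exp_add_mul_I, norm_one, Real.exp_eq_one_iff] at this
  exact hu this

/-- The ratio of the angular expansion with coefficients `angularCoeff b L` to the iterated
propagator. -/
def ladderConst (b : ℝ) (L : ℕ) : ℝ := kernelConst b ^ (L + 1) / (2 * Real.pi ^ 2) ^ L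

theorem hasSum_norm_of_nonneg {a : ℤ → ℂ} (ha : ∀ n, 0 ≤ a n) {s : ℝ}
    (h : HasSum (fun n : ℤ => a n * cexp (n * ((0 : ℝ) : ℂ) * I)) (s : ℂ)) :
    HasSum (fun n => ‖a n‖) s := by
  rw [← hasSum_ofReal]
  convert! h using 1
  ext n
  rw [← eq_coe_norm_of_nonneg (ha n)]
  simp

/-- The angular expansion of the iterated convolutions of the propagator. -/
theorem hasSum_angularCoeff (hb : 1 / 2 < b) (hb1 : b < 1) (L : ℕ) {u : ℝ} (hu : u ≠ 0) :
    (∀ N, 0 ≤ angularCoeff b L N u) ∧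
    ∀ θ : ℝ, HasSum (fun n : ℤ => angularCoeff b L n.natAbs u * cexp (n * θ * I))
      ((ladderConst b L * (iterPropagator (1 - b) L (cexp (u + θ * I))).toReal : ℝ) : ℂ) := by
  induction L generalizing u with
  | zero =>
    refine ⟨fun N => angularCoeff_zero_nonneg hb hb1 N hu, fun θ => ?_⟩
    rw [iterPropagator_zero, ENNReal.toReal_ofReal (propagator_nonneg _ _), ladderConst, zero_add,
      pow_one, pow_zero, div_one]
    exact hasSum_angularCoeff_zero hb hb1 hu θ
  | succ L ih =>
    have hK := kernelConst_pos (by linarith) hb1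
    have hpi := Real.pi_pos
    have hC : 0 < ladderConst b L := by unfold ladderConst; positivity
    have hnn : ∀ v : ℝ, v ≠ 0 → v ≠ u → ∀ N,
        0 ≤ angularCoeff b 0 N (u - v) * angularCoeff b L N v := fun v hv hvu N =>
      mul_nonneg (angularCoeff_zero_nonneg hb hb1 N (sub_ne_zero.2 hvu.symm)) ((ih hv).1 N)
    set f : ℤ → ℝ → ℂ := fun n v =>
      angularCoeff b 0 n.natAbs (u - v) * angularCoeff b L n.natAbs v with hf
    set D : ℝ := 2 * Real.pi / (kernelConst b * ladderConst b L) with hD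
    have hD0 : 0 < D := by positivity
    have hfi : ∀ n, Integrable (f n) := fun n => by
      obtain ⟨M, hM⟩ := exists_norm_angularCoeff_le (b := b) L n.natAbs
      exact ((integrable_angularCoeff_zero hb hb1 n.natAbs).comp_sub_left u).mul_bdd
        (continuous_angularCoeff hb hb1 L _).aestronglyMeasurable (Eventually.of_forall hM)
    -- the angular part of the convolution, at a fixed radial variable `v`
    let inner : ℝ → ℝ → ℝ := fun θ v => ∫ φ in Set.Ioo (-Real.pi) Real.pi,
      propagator (1 - b) (cexp (u + θ * I) / cexp (v + φ * I)) *
        (iterPropagator (1 - b) L (cexp (v + φ * I))).toReal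
    have hinner : ∀ θ, Integrable (inner θ) ∧
        ∫ v, inner θ v = (iterPropagator (1 - b) (L + 1) (cexp (u + θ * I))).toReal := fun θ =>
      integral_convolution_exp (by linarith) (by linarith) L (exp_ne_zero _)
        (exp_add_mul_I_ne_one hu θ)
    have hsum : ∀ θ v : ℝ, v ≠ 0 → v ≠ u →
        HasSum (fun n : ℤ => (D * f n v) * cexp (n * θ * I)) (inner θ v : ℂ) := by
      intro θ v hv hvu
      have huv : u - v ≠ 0 := sub_ne_zero.2 hvu.symm
      have hA := hasSum_angularCoeff_zero hb hb1 huv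
      have hB := (ih hv).2
      have h1 := hasSum_circle_convolution
        (hasSum_norm_of_nonneg (fun n : ℤ => angularCoeff_zero_nonneg hb hb1 n.natAbs huv)
          (hA 0)).summable
        (hasSum_norm_of_nonneg (fun n : ℤ => (ih hv).1 n.natAbs) (hB 0)).summable θ
      have h2 := h1.mul_left ((1 / (kernelConst b * ladderConst b L) : ℝ) : ℂ)
      convert! h2 using 1
      · ext n
        rw [hf, hD]
        push_cast
        ring
      · rw [← integral_const_mul]
        simp only [inner]
        rw [← integral_complex_ofReal]
        refine integral_congr_ae (Eventually.of_forall fun φ => ?_)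
        simp only [(hA (θ - φ)).tsum_eq, (hB φ).tsum_eq]
        rw [← Complex.exp_sub, show (u + θ * I - (v + φ * I) : ℂ) =
          ((u - v : ℝ) : ℂ) + ((θ - φ : ℝ) : ℂ) * I by push_cast; ring]
        norm_cast
        field_simp
    have hae : ∀ᵐ v : ℝ, v ≠ 0 ∧ v ≠ u :=
      (Measure.ae_ne volume 0).and (Measure.ae_ne volume u)
    have hDf : ∀ v : ℝ, v ≠ 0 → v ≠ u → ∀ n, 0 ≤ D * f n v := fun v hv hvu n =>
      mul_nonneg (zero_le_real.2 hD0.le) (hnn v hv hvu n.natAbs)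
    refine ⟨fun N => ?_, fun θ => ?_⟩
    · have h1 := integral_angularCoeff_convolution hb hb1 L N u
      have h2 : ∫ v : ℝ, angularCoeff b 0 N (u - v) * angularCoeff b L N v =
          ((∫ v : ℝ, ‖angularCoeff b 0 N (u - v) * angularCoeff b L N v‖ : ℝ) : ℂ) := by
        rw [← integral_complex_ofReal]
        refine integral_congr_ae ?_
        filter_upwards [hae] with v hv
        exact eq_coe_norm_of_nonneg (hnn v hv.1 hv.2 N)
      have h3 : angularCoeff b (L + 1) N u = ((Real.pi⁻¹ *
          ∫ v : ℝ, ‖angularCoeff b 0 N (u - v) * angularCoeff b L N v‖ : ℝ) : ℂ) := by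
        rw [ofReal_mul, ← h2, h1, ofReal_inv, inv_mul_cancel_left₀]
        exact_mod_cast hpi.ne'
      rw [h3, zero_le_real]
      exact mul_nonneg (by positivity) (integral_nonneg fun _ => norm_nonneg _)
    · let h : ℤ → ℝ → ℂ := fun n v => (D * f n v) * cexp (n * θ * I)
      have hhn : ∀ n v, ‖h n v‖ = ‖D * f n v‖ := fun n v => by
        simp only [h]
        rw [norm_mul, show (n * θ * I : ℂ) = ((n * θ : ℝ) : ℂ) * I by push_cast; ring,
          norm_exp_ofReal_mul_I, mul_one]
      have hhi : ∀ n, Integrable (h n) := fun n => ((hfi n).const_mul _).mul_const _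
      -- as the coefficients are nonnegative, the sum of their absolute values is `inner 0 v`
      have hsumm : Summable fun n => ∫ v, ‖h n v‖ := by
        refine summable_of_sum_le (c := ∫ v, inner 0 v)
          (fun n => integral_nonneg fun _ => norm_nonneg _) fun S => ?_
        rw [← integral_finsetSum _ fun n _ => (hhi n).norm]
        refine integral_mono_ae (integrable_finsetSum _ fun n _ => (hhi n).norm) (hinner 0).1 ?_
        filter_upwards [hae] with v hv
        simp only [hhn]
        exact sum_le_hasSum S (fun _ _ => norm_nonneg _)
          (hasSum_norm_of_nonneg (hDf v hv.1 hv.2) (hsum 0 v hv.1 hv.2))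
      have key := hasSum_integral_of_summable_integral_norm hhi hsumm
      have h1 : ∫ v, ∑' n, h n v =
          ((iterPropagator (1 - b) (L + 1) (cexp (u + θ * I))).toReal : ℂ) := by
        rw [← (hinner θ).2, ← integral_complex_ofReal]
        refine integral_congr_ae ?_
        filter_upwards [hae] with v hv
        exact (hsum θ v hv.1 hv.2).tsum_eq
      have h2 : ∀ n, ∫ v, h n v =
          (D * Real.pi : ℝ) * (angularCoeff b (L + 1) n.natAbs u * cexp (n * θ * I)) := fun n => by
        simp only [h, hf]
        rw [integral_mul_const, integral_const_mul, integral_angularCoeff_convolution hb hb1]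
        push_cast; ring
      rw [h1] at key
      simp only [h2] at key
      have key2 := key.mul_left (((D * Real.pi)⁻¹ : ℝ) : ℂ)
      convert! key2 using 1
      · ext n
        rw [← mul_assoc, ← ofReal_mul, inv_mul_cancel₀ (by positivity), ofReal_one, one_mul]
      · rw [← ofReal_mul]
        congr 2
        rw [hD, ladderConst, ladderConst]
        field_simp
        ring

end

section

open scoped ComplexOrder

/-! ### The ladder integral on the strip `0 < Re β < 1` -/

theorem ladderIntegrand_nonneg (L : ℕ) (b : ℝ) (x₁ x₂ x₃ x₄ : ℂ) (q : Fin L → ℂ) :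
    0 ≤ ladderIntegrand L b x₁ x₂ x₃ x₄ q := by
  have h : ∀ (w : ℂ) (s : ℝ), 0 ≤ sqPow w s := fun w s => by
    rw [sqPow_ofReal, zero_le_real]; positivity
  have h1 := fun w => h w (-b)
  have h2 := fun w => h w (-(1 - b))
  push_cast at h1 h2
  rw [ladderIntegrand]
  exact mul_nonneg (Finset.prod_nonneg fun _ _ => mul_nonneg (h1 _) (h1 _))
    (Finset.prod_nonneg fun _ _ => h2 _)

theorem aestronglyMeasurable_ladderIntegrand (L : ℕ) (β x₁ x₂ x₃ x₄ : ℂ) :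
    AEStronglyMeasurable (ladderIntegrand L β x₁ x₂ x₃ x₄) :=
  ((measurable_ladderIntegrand L β x₂ x₃ x₄).comp
    (measurable_const.prodMk measurable_id : Measurable fun q => (x₁, q))).aestronglyMeasurable

theorem ladderIntegral_ofReal (L : ℕ) (b : ℝ) (x₁ x₂ x₃ x₄ : ℂ) :
    ladderIntegral L b x₁ x₂ x₃ x₄ = ((ladderMass L b x₁ x₂ x₃ x₄).toReal : ℂ) := by
  rw [ladderIntegral, ladderMass,
    ← integral_norm_eq_lintegral_enorm (aestronglyMeasurable_ladderIntegrand L b x₁ x₂ x₃ x₄),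
    ← integral_complex_ofReal]
  exact integral_congr_ae (Eventually.of_forall fun q =>
    eq_coe_norm_of_nonneg (ladderIntegrand_nonneg L b x₁ x₂ x₃ x₄ q))

theorem moebius_ne_zero {x₂ x₃ x₄ x : ℂ} (h2 : x ≠ x₂) (h4 : x ≠ x₄) (h23 : x₂ ≠ x₃)
    (h34 : x₃ ≠ x₄) : moebius x₂ x₃ x₄ x ≠ 0 := by
  have e1 := sub_ne_zero.2 h2
  have e2 := sub_ne_zero.2 h4.symm
  have e3 := sub_ne_zero.2 h23.symm
  have e4 := sub_ne_zero.2 h34.symm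
  rw [moebius]; positivity

theorem moebius_self {x₂ x₃ x₄ : ℂ} (h23 : x₂ ≠ x₃) (h34 : x₃ ≠ x₄) :
    moebius x₂ x₃ x₄ x₃ = 1 := by
  have e3 := sub_ne_zero.2 h23.symm
  have e5 := sub_ne_zero.2 h34.symm
  rw [moebius]; field_simp

theorem moebius_ne_one {x₂ x₃ x₄ x : ℂ} (h3 : x ≠ x₃) (h4 : x ≠ x₄) (h23 : x₂ ≠ x₃)
    (h24 : x₂ ≠ x₄) : moebius x₂ x₃ x₄ x ≠ 1 := by
  have e1 := sub_ne_zero.2 h3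
  have e2 := sub_ne_zero.2 h4.symm
  have e3 := sub_ne_zero.2 h23.symm
  have e4 := sub_ne_zero.2 h24.symm
  rw [moebius, div_mul_div_comm, Ne, div_eq_one_iff_eq (mul_ne_zero e3 e2), ← sub_eq_zero,
    show (x₄ - x₃) * (x - x₂) - (x₃ - x₂) * (x₄ - x) = (x - x₃) * (x₄ - x₂) by ring]
  exact mul_ne_zero e1 e4

theorem moebius_swap (x₂ x₃ x₄ x : ℂ) : moebius x₄ x₃ x₂ x = (moebius x₂ x₃ x₄ x)⁻¹ := by
  rw [moebius, moebius, mul_inv, inv_div, inv_div, ← neg_sub x₃ x₂, ← neg_sub x₄ x₃,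
    ← neg_sub x₄ x, ← neg_sub x x₂, neg_div_neg_eq, neg_div_neg_eq]

/-- For a real index, the conformally normalized integral is a ratio of functions of the
variable `z` alone. -/
theorem confLadder_ofReal {b : ℝ} {x₁ x₂ x₃ x₄ : ℂ} (L : ℕ) (h12 : x₁ ≠ x₂) (h13 : x₁ ≠ x₃)
    (h14 : x₁ ≠ x₄) (h23 : x₂ ≠ x₃) (h24 : x₂ ≠ x₄) (h34 : x₃ ≠ x₄) :
    confLadder L b x₁ x₂ x₃ x₄ = (((iterPropagator (1 - b) L (moebius x₂ x₃ x₄ x₁)).toReal /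
      propagator (1 - b) (moebius x₂ x₃ x₄ x₁) : ℝ) : ℂ) := by
  have hw : ∀ p, p ≠ x₂ → p ≠ x₄ → 0 < confWeight (1 - b) x₂ x₄ p := fun p h2 h4 => by
    have h1 := norm_pos_iff.2 (sub_ne_zero.2 h2)
    have h3 := norm_pos_iff.2 (sub_ne_zero.2 h4.symm)
    have hD := norm_pos_iff.2 (sub_ne_zero.2 h24.symm)
    rw [confWeight]; positivity
  have hw1 := hw x₁ h12 h14
  have hw3 := hw x₃ h23.symm h34
  have hk := propagator_moebius (1 - b) h23 h24 h34 h12 h14 h23.symm h34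
  rw [moebius_self h23 h34, div_one] at hk
  have h1 := sqPow_ofReal (x₂ - x₄) (L * b)
  have h2 := sqPow_ofReal (x₁ - x₃) (1 - b)
  push_cast at h1 h2
  have hD := norm_pos_iff.2 (sub_ne_zero.2 h24)
  have h13' := norm_pos_iff.2 (sub_ne_zero.2 h13)
  rw [confLadder, h1, h2, ladderIntegral_ofReal, ladderMass_eq h23 h24 h34 L h12 h14,
    ENNReal.toReal_mul, ENNReal.toReal_ofReal (by positivity), hk]
  simp only [← ofReal_mul]
  norm_cast
  rw [norm_sub_rev x₄ x₂, Real.rpow_neg hD.le, Real.rpow_neg h13'.le,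
    show 2 * (L * b) = 2 * b * L by ring]
  have : 0 < ‖x₂ - x₄‖ ^ (2 * b * L) := by positivity
  have : 0 < ‖x₁ - x₃‖ ^ (2 * (1 - b)) := by positivity
  field_simp

/-! ### Holomorphy in the propagator index -/

theorem norm_sqPow_of_re_ne_zero (w : ℂ) {s : ℂ} (hs : s.re ≠ 0) :
    ‖sqPow w s‖ = (‖w‖ ^ 2) ^ s.re := by
  rw [sqPow, norm_cpow_eq_rpow_re_of_nonneg (by positivity) hs]

/-- The absolute value of the integrand is logarithmically affine in `Re β`. -/
theorem norm_ladderIntegrand_eq {β : ℂ} (h0 : 0 < β.re) (h1 : β.re < 1) (L : ℕ)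
    (x₁ x₂ x₃ x₄ : ℂ) (q : Fin L → ℂ) :
    ‖ladderIntegrand L β x₁ x₂ x₃ x₄ q‖ =
      (∏ i : Fin L, (‖x₂ - q i‖ ^ 2) ^ (-β.re) * (‖x₄ - q i‖ ^ 2) ^ (-β.re)) *
      ∏ m : Fin (L + 1),
        (‖chainPts L x₁ x₃ q m.castSucc - chainPts L x₁ x₃ q m.succ‖ ^ 2) ^ (-(1 - β.re)) := by
  have e1 : (-β).re = -β.re := rfl
  have e2 : (-(1 - β)).re = -(1 - β.re) := rfl
  have h2 : (-β).re ≠ 0 := by rw [e1]; linarith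
  have h3 : (-(1 - β)).re ≠ 0 := by rw [e2]; linarith
  rw [ladderIntegrand, norm_mul, norm_prod, norm_prod]
  simp only [norm_mul, norm_sqPow_of_re_ne_zero _ h2, norm_sqPow_of_re_ne_zero _ h3, e1, e2]

/-- Domination on a strip: the weighted inequality of the geometric and the arithmetic mean bounds
the integrand at `β` by the integrands at two surrounding real indices. -/
theorem norm_ladderIntegrand_le_add {β : ℂ} {b₁ b₂ : ℝ} (h0 : 0 < b₁) (hb₁ : b₁ < β.re)
    (hb₂ : β.re < b₂) (h1 : b₂ < 1) (L : ℕ) (x₁ x₂ x₃ x₄ : ℂ) (q : Fin L → ℂ) :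
    ‖ladderIntegrand L β x₁ x₂ x₃ x₄ q‖ ≤
      ‖ladderIntegrand L b₁ x₁ x₂ x₃ x₄ q‖ + ‖ladderIntegrand L b₂ x₁ x₂ x₃ x₄ q‖ := by
  obtain ⟨t, ht0, ht1, ht⟩ : ∃ t : ℝ, 0 < t ∧ t < 1 ∧ β.re = t * b₁ + (1 - t) * b₂ := by
    have : 0 < b₂ - b₁ := by linarith
    refine ⟨(b₂ - β.re) / (b₂ - b₁), div_pos (by linarith) this, ?_, ?_⟩
    · rw [div_lt_one this]; linarith
    · field_simp; ring
  have ht1' : 0 < 1 - t := by linarith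
  have key : ∀ x : ℝ, 0 ≤ x → ∀ r s : ℝ, r ≠ 0 → t * r + (1 - t) * s ≠ 0 →
      x ^ (t * r + (1 - t) * s) = (x ^ r) ^ t * (x ^ s) ^ (1 - t) := by
    intro x hx r s hr hrs
    rcases hx.eq_or_lt with rfl | hx
    · rw [Real.zero_rpow hrs, Real.zero_rpow hr, Real.zero_rpow ht0.ne', zero_mul]
    · rw [← Real.rpow_mul hx.le, ← Real.rpow_mul hx.le, ← Real.rpow_add hx]
      ring_nf
  set A := ‖ladderIntegrand L b₁ x₁ x₂ x₃ x₄ q‖ with hA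
  set B := ‖ladderIntegrand L b₂ x₁ x₂ x₃ x₄ q‖ with hB
  have hAB : ‖ladderIntegrand L β x₁ x₂ x₃ x₄ q‖ = A ^ t * B ^ (1 - t) := by
    rw [norm_ladderIntegrand_eq (by linarith) (by linarith), hA, hB,
      norm_ladderIntegrand_eq (by simpa using h0) (by rw [ofReal_re]; linarith),
      norm_ladderIntegrand_eq (by rw [ofReal_re]; linarith) (by simpa using h1), ofReal_re,
      ofReal_re, Real.mul_rpow (by positivity) (by positivity),
      Real.mul_rpow (by positivity) (by positivity), ← Real.finsetProd_rpow _ _ (by intros; positivity),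
      ← Real.finsetProd_rpow _ _ (by intros; positivity),
      ← Real.finsetProd_rpow _ _ (by intros; positivity),
      ← Real.finsetProd_rpow _ _ (by intros; positivity), mul_mul_mul_comm,
      ← Finset.prod_mul_distrib, ← Finset.prod_mul_distrib]
    have k1 : ∀ x : ℝ, 0 ≤ x → x ^ (-β.re) = (x ^ (-b₁)) ^ t * (x ^ (-b₂)) ^ (1 - t) := by
      intro x hx
      rw [← key x hx _ _ (by linarith) (by linarith)]
      congr 1
      rw [ht]; ring
    have k2 : ∀ x : ℝ, 0 ≤ x →
        x ^ (-(1 - β.re)) = (x ^ (-(1 - b₁))) ^ t * (x ^ (-(1 - b₂))) ^ (1 - t) := by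
      intro x hx
      rw [← key x hx _ _ (by linarith) (by linarith)]
      congr 1
      rw [ht]; ring
    congr 1
    · refine Finset.prod_congr rfl fun i _ => ?_
      rw [k1 _ (by positivity), k1 _ (by positivity), Real.mul_rpow (by positivity) (by positivity),
        Real.mul_rpow (by positivity) (by positivity)]
      ring
    · exact Finset.prod_congr rfl fun i _ => k2 _ (by positivity)
  have hA0 : 0 ≤ A := norm_nonneg _
  have hB0 : 0 ≤ B := norm_nonneg _
  rw [hAB]
  refine (Real.geom_mean_le_arith_mean2_weighted ht0.le ht1'.le hA0 hB0 (by ring)).trans ?_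
  nlinarith [mul_nonneg ht0.le hB0, mul_nonneg ht1'.le hA0]

/-- Absolute convergence of the ladder integral. The absolute value of the integrand depends on
`Re β` only, also at degenerate positions of the vertices, where both sides vanish. -/
theorem integrable_ladderIntegrand {β : ℂ} (h0 : 0 < β.re) (h1 : β.re < 1) {x₁ x₂ x₃ x₄ : ℂ}
    (L : ℕ) (h12 : x₁ ≠ x₂) (h13 : x₁ ≠ x₃)
    (h14 : x₁ ≠ x₄) (h23 : x₂ ≠ x₃) (h24 : x₂ ≠ x₄) (h34 : x₃ ≠ x₄) :
    Integrable (ladderIntegrand L β x₁ x₂ x₃ x₄) := by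
  refine ⟨aestronglyMeasurable_ladderIntegrand .., ?_⟩
  have h : HasFiniteIntegral (ladderIntegrand L (β.re : ℝ) x₁ x₂ x₃ x₄) := by
    change ladderMass L β.re x₁ x₂ x₃ x₄ < ⊤
    rw [ladderMass_eq h23 h24 h34 L h12 h14]
    exact ENNReal.mul_lt_top ENNReal.ofReal_lt_top (iterPropagator_lt_top (by linarith)
      (by linarith) L (moebius_ne_zero h12 h14 h23 h34) (moebius_ne_one h13 h14 h23 h24))
  refine h.mono (Eventually.of_forall fun q => ?_)
  rw [norm_ladderIntegrand_eq h0 h1, norm_ladderIntegrand_eq (by simpa using h0) (by simpa using h1),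
    ofReal_re]

theorem differentiableAt_ladderIntegrand {β : ℂ} (h0 : 0 < β.re) (h1 : β.re < 1) (L : ℕ)
    (x₁ x₂ x₃ x₄ : ℂ) (q : Fin L → ℂ) :
    DifferentiableAt ℂ (fun β => ladderIntegrand L β x₁ x₂ x₃ x₄ q) β := by
  have h2 : -β ≠ 0 := fun h => by
    have := congrArg re h; simp at this; linarith
  have h3 : -(1 - β) ≠ 0 := fun h => by
    have := congrArg re h; simp at this; linarith
  have d1 : ∀ w, DifferentiableAt ℂ (fun β => sqPow w (-β)) β := fun w =>
    DifferentiableAt.const_cpow (by fun_prop) (Or.inr h2)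
  have d2 : ∀ w, DifferentiableAt ℂ (fun β => sqPow w (-(1 - β))) β := fun w =>
    DifferentiableAt.const_cpow (by fun_prop) (Or.inr h3)
  unfold ladderIntegrand
  exact (DifferentiableAt.fun_finsetProd fun i _ => (d1 _).mul (d1 _)).mul
    (DifferentiableAt.fun_finsetProd fun i _ => d2 _)

theorem differentiableAt_ladderIntegral {β : ℂ} (h0 : 0 < β.re) (h1 : β.re < 1) {x₁ x₂ x₃ x₄ : ℂ}
    (L : ℕ) (h12 : x₁ ≠ x₂) (h13 : x₁ ≠ x₃)
    (h14 : x₁ ≠ x₄) (h23 : x₂ ≠ x₃) (h24 : x₂ ≠ x₄) (h34 : x₃ ≠ x₄) :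
    DifferentiableAt ℂ (fun β => ladderIntegral L β x₁ x₂ x₃ x₄) β := by
  obtain ⟨b₁, hb₁, hb₁'⟩ := exists_between h0
  obtain ⟨b₂, hb₂, hb₂'⟩ := exists_between h1
  have hr : 0 < min (β.re - b₁) (b₂ - β.re) := lt_min (by linarith) (by linarith)
  have hball : ∀ x ∈ Metric.ball β (min (β.re - b₁) (b₂ - β.re)), b₁ < x.re ∧ x.re < b₂ := by
    intro x hx
    rw [Metric.mem_ball, dist_eq, lt_min_iff] at hx
    have := abs_le.1 (abs_re_le_norm (x - β))
    rw [sub_re] at this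
    constructor <;> linarith
  have hi : ∀ b : ℝ, 0 < b → b < 1 → Integrable (ladderIntegrand L b x₁ x₂ x₃ x₄) :=
    fun b hb hb' => integrable_ladderIntegrand (by simpa using hb) (by simpa using hb') L
      h12 h13 h14 h23 h24 h34
  refine differentiableAt_integral_of_dominated hr
    (fun x _ => aestronglyMeasurable_ladderIntegrand L x x₁ x₂ x₃ x₄)
    ((hi b₁ hb₁ (by linarith)).norm.add (hi b₂ (by linarith) hb₂').norm)
    (Eventually.of_forall fun q x hx => ?_) (Eventually.of_forall fun q x hx => ?_)
  · exact norm_ladderIntegrand_le_add hb₁ (hball x hx).1 (hball x hx).2 hb₂' L x₁ x₂ x₃ x₄ q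
  · exact (differentiableAt_ladderIntegrand (hb₁.trans (hball x hx).1)
      ((hball x hx).2.trans hb₂') L x₁ x₂ x₃ x₄ q).differentiableWithinAt

theorem differentiableAt_aConst {β : ℂ} (h0 : 0 < β.re) (h1 : β.re < 1) :
    DifferentiableAt ℂ aConst β := by
  have hne : ∀ s : ℂ, 0 < s.re → ∀ m : ℕ, s ≠ -m := fun s hs m h => by
    have h2 := congrArg re h
    simp at h2
    have : (0 : ℝ) ≤ m := m.cast_nonneg
    linarith
  have h1' : 0 < (1 - β).re := by simpa using h1
  have d1 := differentiableAt_Gamma _ (hne β h0)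
  have d2 : DifferentiableAt ℂ (fun β => Gamma (1 - β)) β :=
    (differentiableAt_Gamma _ (hne _ h1')).comp β (f := fun β => 1 - β) (by fun_prop)
  have hpi : (Real.pi : ℂ) ≠ 0 := by exact_mod_cast Real.pi_ne_zero
  have h4 : (4 : ℂ) ^ β ≠ 0 := by simp [cpow_eq_zero_iff]
  unfold aConst
  exact d2.div (((DifferentiableAt.const_cpow differentiableAt_id (Or.inl (by norm_num))).mul_const
    _).mul d1) (mul_ne_zero (mul_ne_zero h4 hpi) (Gamma_ne_zero_of_re_pos h0))

end

/-! ### Identification of the ladder function -/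

theorem four_cpow_ne_zero (s : ℂ) : (4 : ℂ) ^ s ≠ 0 := by simp [cpow_eq_zero_iff]

/-- The normalisation of the ladder function is the constant of the angular expansion. -/
theorem aConst_ofReal_pow (b : ℝ) (L : ℕ) :
    aConst b ^ (L + 1) * (2 * Real.pi ^ 2) * (4 : ℂ) ^ ((b : ℂ) * (L + 1)) = ladderConst b L := by
  have hpi : (Real.pi : ℂ) ≠ 0 := by exact_mod_cast Real.pi_ne_zero
  have h4 := four_cpow_ne_zero (b : ℂ)
  have h1 : (4 : ℂ) ^ ((b : ℂ) * (L + 1)) = ((4 : ℂ) ^ (b : ℂ)) ^ (L + 1) := by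
    rw [← cpow_mul_nat]; push_cast; rfl
  have h2 : aConst b = (kernelConst b : ℂ) / (2 * Real.pi ^ 2) / (4 : ℂ) ^ (b : ℂ) := by
    rw [aConst, kernelConst, ← ofReal_one, ← ofReal_sub, Gamma_ofReal, Gamma_ofReal]
    push_cast
    field_simp
  rw [h1, h2, ladderConst]
  push_cast
  rw [div_pow _ ((4 : ℂ) ^ (b : ℂ)), div_pow, pow_succ (2 * (Real.pi : ℂ) ^ 2)]
  field_simp

/-- For a real index in `(1/2, 1)`, comparison of the two angular expansions identifies the
iterated propagator. -/
theorem ladderDeriv_ofReal {b : ℝ} (hb : 1 / 2 < b) (hb1 : b < 1) (L : ℕ) {w : ℂ} (hw0 : w ≠ 0)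
    (hw : ‖w‖ < 1) :
    ladderDeriv L w b = aConst b ^ (L + 1) * (2 * Real.pi ^ 2) *
      ((‖w‖ ^ b * (iterPropagator (1 - b) L w).toReal : ℝ) : ℂ) := by
  have hn := norm_pos_iff.2 hw0
  have hu : Real.log ‖w‖ < 0 := Real.log_neg hn hw
  have hexp : cexp ((Real.log ‖w‖ : ℝ) + (arg w : ℝ) * I) = w := exp_log hw0
  have h := (hasSum_angularCoeff_ladderDeriv hb hb1 L hu (arg w)).unique
    ((hasSum_angularCoeff hb hb1 L hu.ne).2 (arg w))
  rw [hexp] at h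
  have h4 := four_cpow_ne_zero ((b : ℂ) * (L + 1))
  have hp : cexp (-((b : ℂ) * (Real.log ‖w‖ : ℝ))) = ((‖w‖ ^ b : ℝ) : ℂ)⁻¹ := by
    rw [Real.rpow_def_of_pos hn, ofReal_exp, ← Complex.exp_neg]
    congr 1
    push_cast; ring
  have hp0 : ((‖w‖ ^ b : ℝ) : ℂ) ≠ 0 := by exact_mod_cast (Real.rpow_pos_of_pos hn b).ne'
  rw [hp, ofReal_mul, ← aConst_ofReal_pow] at h
  rw [ofReal_mul]
  refine mul_left_cancel₀ (mul_ne_zero h4 (inv_ne_zero hp0)) (h.trans ?_)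
  field_simp

/-- The normalised ladder integral is given by the derivative formula, for real indices in
`(1/2, 1)`. -/
theorem prefactor_mul_confLadder_ofReal {b : ℝ} (hb : 1 / 2 < b) (hb1 : b < 1) (L : ℕ)
    {x₁ x₂ x₃ x₄ : ℂ} (h12 : x₁ ≠ x₂) (h13 : x₁ ≠ x₃) (h14 : x₁ ≠ x₄) (h23 : x₂ ≠ x₃)
    (h24 : x₂ ≠ x₄) (h34 : x₃ ≠ x₄) (hz : ‖zVar x₁ x₂ x₃ x₄‖ < 1) :
    aConst b ^ (L + 1) * (2 * Real.pi ^ 2) * (sqPow (zVar x₁ x₂ x₃ x₄) (1 / 2) /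
      sqPow (1 - zVar x₁ x₂ x₃ x₄) (1 - b)) * confLadder L b x₁ x₂ x₃ x₄ =
      ladderDeriv L (zVar x₁ x₂ x₃ x₄) b := by
  have hw0 := moebius_ne_zero h12 h14 h23 h34
  have hw1 := sub_ne_zero.2 (moebius_ne_one h13 h14 h23 h24).symm
  rw [confLadder_ofReal L h12 h13 h14 h23 h24 h34]
  rw [zVar_eq h12 h14 h23 h24] at hz ⊢
  set w := moebius x₂ x₃ x₄ x₁
  rw [RCLike.norm_conj] at hz
  have hc : 1 - conj w = conj (1 - w) := by simp
  have h1 := sqPow_ofReal w (1 / 2)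
  have h2 := sqPow_ofReal (1 - w) (1 - b)
  push_cast at h1 h2
  rw [ladderDeriv_conj, hc, sqPow_conj, sqPow_conj, ladderDeriv_ofReal hb hb1 L hw0 hz, h1, h2,
    mul_assoc _ (_ / _)]
  congr 1
  have hn := norm_pos_iff.2 hw0
  have hn1 := norm_pos_iff.2 hw1
  have hb' : ‖w‖ ^ b = ‖w‖ / ‖w‖ ^ (1 - b) := by
    rw [eq_div_iff (by positivity), ← Real.rpow_add hn]
    simp
  rw [hb', propagator, Real.rpow_neg hn1.le]
  have : 0 < ‖w‖ ^ (1 - b) := by positivity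
  have : 0 < ‖1 - w‖ ^ (2 * (1 - b)) := by positivity
  norm_num
  norm_cast
  field_simp

/-- The strip in which the ladder integral converges. -/
def unitStrip : Set ℂ := {β : ℂ | 0 < β.re ∧ β.re < 1}

theorem isOpen_unitStrip : IsOpen unitStrip :=
  (isOpen_lt continuous_const continuous_re).inter (isOpen_lt continuous_re continuous_const)

theorem isPreconnected_unitStrip : IsPreconnected unitStrip :=
  ((convex_halfSpace_re_gt 0).inter (convex_halfSpace_re_lt 1)).isPreconnected

theorem unitStrip_subset_genericIndex : unitStrip ⊆ genericIndex :=
  fun _ h => mem_genericIndex_of_re_lt_one h.2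

theorem three_div_four_mem_unitStrip : (3 / 4 : ℂ) ∈ unitStrip := by
  constructor <;> norm_num

/-- Analytic functions on the strip that agree at the real indices in `(1/2, 1)` are equal. -/
theorem eqOn_unitStrip_of_ofReal {f g : ℂ → ℂ} (hf : AnalyticOnNhd ℂ f unitStrip)
    (hg : AnalyticOnNhd ℂ g unitStrip) (h : ∀ b : ℝ, 1 / 2 < b → b < 1 → f b = g b) :
    Set.EqOn f g unitStrip := by
  refine hf.eqOn_of_preconnected_of_frequently_eq hg isPreconnected_unitStrip
    three_div_four_mem_unitStrip ?_
  have ht : Tendsto (fun b : ℝ => (b : ℂ)) (𝓝[≠] (3 / 4)) (𝓝[≠] (3 / 4 : ℂ)) := by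
    have h0 : ((3 / 4 : ℝ) : ℂ) = 3 / 4 := by norm_num
    rw [← h0]
    refine tendsto_nhdsWithin_iff.2
      ⟨(continuous_ofReal.tendsto _).mono_left nhdsWithin_le_nhds, ?_⟩
    filter_upwards [self_mem_nhdsWithin] with b hb using ofReal_injective.ne hb
  refine ht.frequently (Eventually.frequently ?_)
  have : ∀ᶠ b : ℝ in 𝓝 (3 / 4), 1 / 2 < b ∧ b < 1 :=
    Ioo_mem_nhds (by norm_num) (by norm_num)
  exact (this.filter_mono nhdsWithin_le_nhds).mono fun b hb => h b hb.1 hb.2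

/-- The normalised ladder integral is given by the derivative formula on the whole strip, by
analytic continuation in the index. -/
theorem prefactor_mul_confLadder {β : ℂ} (h0 : 0 < β.re) (h1 : β.re < 1) (L : ℕ)
    {x₁ x₂ x₃ x₄ : ℂ} (h12 : x₁ ≠ x₂) (h13 : x₁ ≠ x₃) (h14 : x₁ ≠ x₄) (h23 : x₂ ≠ x₃)
    (h24 : x₂ ≠ x₄) (h34 : x₃ ≠ x₄) (hz : ‖zVar x₁ x₂ x₃ x₄‖ < 1) :
    aConst β ^ (L + 1) * (2 * Real.pi ^ 2) * (sqPow (zVar x₁ x₂ x₃ x₄) (1 / 2) /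
      sqPow (1 - zVar x₁ x₂ x₃ x₄) (1 - β)) * confLadder L β x₁ x₂ x₃ x₄ =
      ladderDeriv L (zVar x₁ x₂ x₃ x₄) β := by
  have hz0 : zVar x₁ x₂ x₃ x₄ ≠ 0 := by
    rw [zVar_eq h12 h14 h23 h24]
    simpa using moebius_ne_zero h12 h14 h23 h34
  have hz1 : 1 - zVar x₁ x₂ x₃ x₄ ≠ 0 := by
    rw [sub_ne_zero]
    rintro h
    rw [← h, norm_one] at hz
    exact lt_irrefl _ hz
  refine eqOn_unitStrip_of_ofReal
    (f := fun β => aConst β ^ (L + 1) * (2 * Real.pi ^ 2) * (sqPow (zVar x₁ x₂ x₃ x₄) (1 / 2) /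
      sqPow (1 - zVar x₁ x₂ x₃ x₄) (1 - β)) * confLadder L β x₁ x₂ x₃ x₄)
    (DifferentiableOn.analyticOnNhd (fun β hβ => DifferentiableAt.differentiableWithinAt ?_)
      isOpen_unitStrip)
    ((analyticOnNhd_ladderDeriv L hz0 hz).mono unitStrip_subset_genericIndex)
    (fun b hb hb1 => prefactor_mul_confLadder_ofReal hb hb1 L h12 h13 h14 h23 h24 h34 hz) ⟨h0, h1⟩
  have d1 := differentiableAt_aConst hβ.1 hβ.2
  have d2 := differentiableAt_ladderIntegral hβ.1 hβ.2 L h12 h13 h14 h23 h24 h34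
  have d3 : DifferentiableAt ℂ (fun β : ℂ => sqPow (1 - zVar x₁ x₂ x₃ x₄) (1 - β)) β :=
    (differentiable_sqPow hz1 _).comp β (f := fun β => 1 - β) (by fun_prop)
  have d4 : DifferentiableAt ℂ (fun β : ℂ => sqPow (x₂ - x₄) (L * β)) β :=
    (differentiable_sqPow (sub_ne_zero.2 h24) _).comp β (f := fun β : ℂ => (L : ℂ) * β) (by fun_prop)
  have d5 : DifferentiableAt ℂ (fun β : ℂ => sqPow (x₁ - x₃) (1 - β)) β :=
    (differentiable_sqPow (sub_ne_zero.2 h13) _).comp β (f := fun β => 1 - β) (by fun_prop)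
  unfold confLadder
  exact (((d1.pow _).mul_const _).mul ((differentiableAt_const _).div d3
    (sqPow_ne_zero hz1 _))).mul ((d4.mul d5).mul d2)

theorem confLadder_swap (L : ℕ) (β x₁ x₂ x₃ x₄ : ℂ) :
    confLadder L β x₁ x₄ x₃ x₂ = confLadder L β x₁ x₂ x₃ x₄ := by
  rw [confLadder, confLadder, ladderIntegral, ladderIntegral, sqPow_congr (norm_sub_rev x₄ x₂)]
  congr 2
  ext q
  simp only [ladderIntegrand, mul_comm (sqPow (x₄ - _) _)]

theorem zVar_swap {x₁ x₂ x₃ x₄ : ℂ} (h12 : x₁ ≠ x₂) (h14 : x₁ ≠ x₄) (h23 : x₂ ≠ x₃)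
    (h24 : x₂ ≠ x₄) (h34 : x₃ ≠ x₄) : zVar x₁ x₄ x₃ x₂ = (zVar x₁ x₂ x₃ x₄)⁻¹ := by
  rw [zVar_eq h12 h14 h23 h24, zVar_eq h14 h12 h34.symm h24.symm, moebius_swap, map_inv₀]

/-- The closed form of the ladder function, for both ranges of `|z|`. -/
def ladderClosedForm (L : ℕ) (z β : ℂ) : ℂ :=
  if ‖z‖ < 1 then ladderDeriv L z β else sqPow z β * ladderDeriv L z⁻¹ β

theorem isLadderFunction_ladderClosedForm (L : ℕ) {z : ℂ} (hz0 : z ≠ 0) (hz1 : ‖z‖ ≠ 1) :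
    IsLadderFunction L z (ladderClosedForm L z) := by
  refine ⟨?_, fun β h0 h1 x₁ x₂ x₃ x₄ h12 h13 h14 h23 h24 h34 hz =>
    ⟨integrable_ladderIntegrand h0 h1 L h12 h13 h14 h23 h24 h34, ?_⟩⟩
  · unfold ladderClosedForm
    split_ifs with h
    · exact analyticOnNhd_ladderDeriv L hz0 h
    · have hi : ‖z⁻¹‖ < 1 := by
        rw [norm_inv]
        exact inv_lt_one_of_one_lt₀ (lt_of_le_of_ne (not_lt.1 h) hz1.symm)
      exact fun β hβ => ((differentiable_sqPow hz0).analyticAt β).mul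
        (analyticOnNhd_ladderDeriv L (inv_ne_zero hz0) hi β hβ)
  · subst hz
    unfold ladderClosedForm
    split_ifs with h
    · exact (prefactor_mul_confLadder h0 h1 L h12 h13 h14 h23 h24 h34 h).symm
    · have hs := zVar_swap h12 h14 h23 h24 h34
      have hi : ‖zVar x₁ x₄ x₃ x₂‖ < 1 := by
        rw [hs, norm_inv]
        exact inv_lt_one_of_one_lt₀ (lt_of_le_of_ne (not_lt.1 h) hz1.symm)
      have key := prefactor_mul_confLadder h0 h1 L h14 h13 h12 h34.symm h24.symm h23.symm hi
      rw [hs, confLadder_swap] at key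
      rw [← key]
      set z := zVar x₁ x₂ x₃ x₄
      have e1 : 1 - z⁻¹ = -(1 - z) / z := by field_simp; ring
      have e2 : 1 - z ≠ 0 := by
        rw [sub_ne_zero]
        intro h
        rw [← h, norm_one] at hz1
        exact hz1 rfl
      have e3 := sqPow_ne_zero e2 (1 - β)
      have e4 := sqPow_ne_zero hz0 (1 / 2)
      have e5 : sqPow z β * sqPow z (1 - β) = sqPow z (1 / 2) * sqPow z (1 / 2) := by
        rw [← sqPow_add hz0, ← sqPow_add hz0]; ring_nf
      have e6 := sqPow_ne_zero hz0 (1 - β)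
      rw [e1, sqPow_div, sqPow_inv, sqPow_congr (norm_neg (1 - z))]
      field_simp
      rw [pow_two, ← e5]
      ring

theorem inversion_inversion (w : ℂ) : inversion (inversion w) = w := by simp [inversion]

/-- A configuration of four distinct points with a prescribed variable. -/
theorem exists_zVar_eq {z : ℂ} (hz0 : z ≠ 0) (hz1 : z ≠ 1) :
    ∃ x₁ x₂ x₃ x₄ : ℂ, x₁ ≠ x₂ ∧ x₁ ≠ x₃ ∧ x₁ ≠ x₄ ∧ x₂ ≠ x₃ ∧ x₂ ≠ x₄ ∧ x₃ ≠ x₄ ∧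
      zVar x₁ x₂ x₃ x₄ = z := by
  -- `0` and the images under inversion of `a + 1`, `a + z` and `a`, for a large real number `a`
  set a : ℂ := ((‖z‖ + 1 : ℝ) : ℂ) with ha
  have hre : ∀ w : ℂ, ‖w‖ < ‖z‖ + 1 → a + w ≠ 0 := fun w hw h => by
    have h1 := congrArg norm (eq_neg_of_add_eq_zero_right h)
    rw [norm_neg, ha, norm_real, Real.norm_of_nonneg (by positivity)] at h1
    linarith
  have ha1 : a + 1 ≠ 0 := hre 1 (by simpa using norm_pos_iff.2 hz0)
  have haz : a + z ≠ 0 := hre z (by linarith)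
  have ha0 : a ≠ 0 := by simpa using hre 0 (by rw [norm_zero]; positivity)
  have hinj : Function.Injective inversion :=
    Function.LeftInverse.injective inversion_inversion
  have h0 : ∀ w : ℂ, w ≠ 0 → inversion w ≠ 0 := fun w hw => by simpa [inversion] using hw
  refine ⟨inversion (a + 1), 0, inversion (a + z), inversion a, h0 _ ha1, hinj.ne ?_, hinj.ne ?_,
    (h0 _ haz).symm, (h0 _ ha0).symm, hinj.ne ?_, ?_⟩
  · simpa using hz1.symm
  · simp
  · simpa using hz0
  · simp [zVar, inversion_inversion]

/-- The ladder function is the closed form: any two functions with the defining property agree on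
the strip, because a configuration with variable `z` exists, hence on all generic indices. -/
theorem ladderFunction_eq (L : ℕ) {β z : ℂ} (hβ : β ∈ genericIndex) (hz0 : z ≠ 0)
    (hz1 : ‖z‖ ≠ 1) : ladderFunction L β z = ladderClosedForm L z β := by
  have hF := isLadderFunction_ladderClosedForm L hz0 hz1
  have hex : ∃ Φ : ℂ → ℂ, IsLadderFunction L z Φ := ⟨_, hF⟩
  rw [ladderFunction, dif_pos hex]
  obtain ⟨x₁, x₂, x₃, x₄, h12, h13, h14, h23, h24, h34, hz⟩ :=
    exists_zVar_eq hz0 (fun h => hz1 (by rw [h, norm_one]))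
  refine hex.choose_spec.1.eqOn_of_preconnected_of_eventuallyEq hF.1 isPreconnected_genericIndex
    (unitStrip_subset_genericIndex three_div_four_mem_unitStrip) ?_ hβ
  filter_upwards [isOpen_unitStrip.mem_nhds three_div_four_mem_unitStrip] with s hs
  rw [(hex.choose_spec.2 s hs.1 hs.2 x₁ x₂ x₃ x₄ h12 h13 h14 h23 h24 h34 hz).2,
    (hF.2 s hs.1 hs.2 x₁ x₂ x₃ x₄ h12 h13 h14 h23 h24 h34 hz).2]

end Ladder

end

theorem proposition6 (L : ℕ) (z : ℂ) (hz0 : z ≠ 0) (hz1 : ‖z‖ ≠ 1) :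
    (∃ Φ : ℂ → ℂ, Ladder.IsLadderFunction L z Φ) ∧
    ∀ β : ℂ, β ∈ Ladder.genericIndex →
      (0 < β.re → ∀ γ : ℤ → ℝ → ℂ, (∀ n : ℤ, Ladder.IsSeparatingContour β n (γ n)) →
        ∃ J : ℤ → ℂ,
          (∀ n : ℤ, Ladder.HasContourIntegral (Ladder.mbIntegrand L β z n) (γ n) (J n)) ∧
          Summable J ∧
          Ladder.ladderFunction L β z = (4 : ℂ) ^ (-β * ((L : ℂ) + 1)) * ∑' n : ℤ, J n) ∧
      (‖z‖ < 1 →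
        (∀ ε : ℂ, Summable (Ladder.FTerm L β ε z) ∧
          Summable (Ladder.FTerm L β ε (starRingEnd ℂ z))) ∧
        AnalyticAt ℂ (Ladder.bracketExt L β z) 0 ∧
        Ladder.ladderFunction L β z =
          2 * Real.pi / (L.factorial : ℂ) * (4 : ℂ) ^ (-β * ((L : ℂ) + 1)) *
            iteratedDeriv L (Ladder.bracketExt L β z) 0) := by
  refine ⟨⟨_, Ladder.isLadderFunction_ladderClosedForm L hz0 hz1⟩, fun β hβ => ⟨?_, ?_⟩⟩
  · intro hb γ hγ
    rw [Ladder.ladderFunction_eq L hβ hz0 hz1, Ladder.ladderClosedForm]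
    split_ifs with hz
    · obtain ⟨J, hJ, hs, h⟩ := Ladder.mellinBarnes_of_norm_lt_one L hβ hb hz0 hz hγ
      exact ⟨J, fun n => (hJ n).mbIntegrand, hs, h⟩
    · obtain ⟨J, hJ, hs, h⟩ := Ladder.mellinBarnes_of_one_lt_norm L hβ hb
        (lt_of_le_of_ne (not_lt.1 hz) hz1.symm) hγ
      exact ⟨J, fun n => (hJ n).mbIntegrand, hs, h⟩
  · intro hz
    rw [Ladder.bracketExt_eq_regBracket hβ hz0 hz, Ladder.ladderFunction_eq L hβ hz0 hz1,
      Ladder.ladderClosedForm, if_pos hz]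
    exact ⟨fun ε => ⟨Ladder.summable_FTerm L β ε hz,
      Ladder.summable_FTerm L β ε (by rwa [RCLike.norm_conj])⟩,
      Ladder.analyticAt_regBracket hβ hz0 hz, rfl⟩
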